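/- Let $n\in\{2,3\}$, let $B_r$ be the open ball of radius $r$ centred at $0$ in $\mathbb R^n$, let $\mathcal C E=\mathbb R^n\setminus E$, and write $x=(x',x_n)$ with $x'\in\mathbb R^{n-1}$. Let $K:\mathbb R^n\setminus\{0\}\to\mathbb R$ be twice differentiable and vanish outside a bounded set, and suppose that - $K\ge 0$, $K(z)=K(-z)$, $\int_{\mathbb R^n}K(z)\min\{1,|z|\}\,dz<\infty$, and $K\ge 1$ in $B_2\setminus\{0\}$; - for all $z\ne0$ and all unit vectors $e$, $$\max\Big\{|z|\,|\partial_eK(z)|,\ |z|^2\sup_{|y-z|\le|z|/2}|\partial_{ee}K(y)|\Big\}\le K^*(z),$$ where $K^*$ is of one of the following three forms: $K^*=C_1K$; $K^*=C_1(K+\chi_{\{|z|<R_0\}})$ with some $R_0\ge2$; or $K^*\in L^1(\mathbb R^n)$. For measurable sets put $L_K(A,B)=\int_A\int_BK(x-y)\,dy\,dx$ and $$P_{K,\Omega}(E)=L_K(E\cap\Omega,\mathcal CE\cap\Omega)+L_K(E\cap\Omega,\mathcal CE\setminus\Omega)+L_K(E\setminus\Omega,\mathcal CE\cap\Omega).$$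 A measurable set $E$ is a minimizer in $\Omega$ if $P_{K,\Omega}(E)<\infty$ and $P_{K,\Omega}(E)\le P_{K,\Omega}(F)$ for every measurable $F$ with $F\setminus\Omega=E\setminus\Omega$. Denote by $$\mathrm{Per}_\Omega(E)=\sup\Big\{\int_{E\cap\Omega}\operatorname{div}\phi\ :\ \phi\in C^1_c(\Omega;\mathbb R^n),\ |\phi|\le1\Big\}$$ the classical perimeter. Then there are a constant $C_0>0$ depending only on $n$ and a constant $C>0$ depending only on $n$ and $K$ such that the following holds for every $R\ge4$ and every minimizer $E$ in $B_R$. Put $$\varepsilon=C R^{-1/2}\ \text{ if } n=2,\qquad \varepsilon=\frac{C}{\sqrt{\log R}}\ \text{ if } n=3.$$ After some rotation (that is, with $E$ replaced by $\rho(E)$ for some $\rho\in SO(n)$): - **(F1)** for some $t\in[-1,1]$, $\ |(E\triangle\{x_n\le t\})\cap B_1|\le\varepsilon$; - **(F2)** there are a measurable set $\mathcal B\subset B_1^{(n-1)}=\{x'\in\mathbb R^{n-1}:|x'|\le1\}$ with $|\mathcal B|\le\varepsilon$ and a measurable function $g:B_1^{(n-1)}\to[-1,1]$ such that, up to a Lebesgue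 null set, $$(E\cap B_1)\setminus(\mathcal B\times\mathbb R)=\{(y,x_n)\in B_1:\ y\in B_1^{(n-1)}\setminus\mathcal B,\ x_n\le g(y)\};$$ - **(F3)** with $F^\varepsilon=\{(x',x_n/\varepsilon):(x',x_n)\in F\}$, $\ \mathrm{Per}_{B_1^\varepsilon}(E^\varepsilon)\le C_0\max\{1,\varepsilon\}$; in particular it is at most $C_0$ whenever $\varepsilon\le1$. -/

import Mathlib

open MeasureTheory
open scoped ENNReal

namespace NonlocalPerimeter

/-! ### Kernels -/

/-- `K` is twice differentiable away from the origin and, for every `z ≠ 0` and every unit vector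
`e`, `max {|z| |∂ₑK(z)|, |z|² sup_{|y - z| ≤ |z|/2} |∂ₑₑK(y)|} ≤ Kstar(z)`.
(The supremum is spelled out as a bound for all such `y`; these `y` are automatically nonzero.) -/
structure DerivBound {n : ℕ} (K Kstar : EuclideanSpace ℝ (Fin n) → ℝ) : Prop where
  diff : ∀ z, z ≠ 0 → DifferentiableAt ℝ K z
  diff_two : ∀ z, z ≠ 0 → DifferentiableAt ℝ (fderiv ℝ K) z
  bound_one : ∀ z, z ≠ 0 → ∀ e : EuclideanSpace ℝ (Fin n), ‖e‖ = 1 →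
    ‖z‖ * |fderiv ℝ K z e| ≤ Kstar z
  bound_two : ∀ z, z ≠ 0 → ∀ e : EuclideanSpace ℝ (Fin n), ‖e‖ = 1 →
    ∀ y, ‖y - z‖ ≤ ‖z‖ / 2 → ‖z‖ ^ 2 * |fderiv ℝ (fderiv ℝ K) y e e| ≤ Kstar z

/-- The three admissible forms of the dominating kernel: `C₁ K`, or `C₁ (K + χ_{|z| < R₀})` with
`R₀ ≥ 2`, or an integrable kernel. -/
def AdmissibleMajorant {n : ℕ} (K Kstar : EuclideanSpace ℝ (Fin n) → ℝ) : Prop :=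
  (∃ C₁ : ℝ, ∀ z, Kstar z = C₁ * K z) ∨
  (∃ C₁ R₀ : ℝ, 2 ≤ R₀ ∧
    ∀ z, Kstar z = C₁ * (K z + (Metric.ball 0 R₀).indicator (fun _ => (1 : ℝ)) z)) ∨
  Integrable Kstar volume

/-- The standing assumptions on the interaction kernel. The kernel may be singular at the origin,
so its (irrelevant) value there is left unconstrained. -/
structure AdmissibleKernel {n : ℕ} (K : EuclideanSpace ℝ (Fin n) → ℝ) : Prop where
  nonneg : ∀ z, z ≠ 0 → 0 ≤ K z
  even : ∀ z, K (-z) = K z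
  integrable : Integrable (fun z => K z * min 1 ‖z‖) volume
  one_le : ∀ z, z ≠ 0 → ‖z‖ < 2 → 1 ≤ K z
  deriv_bound : ∃ Kstar : EuclideanSpace ℝ (Fin n) → ℝ,
    AdmissibleMajorant K Kstar ∧ DerivBound K Kstar

/-! ### The nonlocal perimeter and its minimizers -/

/-- The interaction `L_K(A, B) = ∫_A ∫_B K(x - y) dy dx`, with values in `[0, ∞]`. -/
noncomputable def interaction {n : ℕ} (K : EuclideanSpace ℝ (Fin n) → ℝ)
    (A B : Set (EuclideanSpace ℝ (Fin n))) : ℝ≥0∞ :=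
  ∫⁻ x in A, ∫⁻ y in B, ENNReal.ofReal (K (x - y))

/-- The `K`-perimeter `P_{K,Ω}(E)` of `E` inside `Ω`. -/
noncomputable def perK {n : ℕ} (K : EuclideanSpace ℝ (Fin n) → ℝ)
    (Ω E : Set (EuclideanSpace ℝ (Fin n))) : ℝ≥0∞ :=
  interaction K (E ∩ Ω) (Eᶜ ∩ Ω) + interaction K (E ∩ Ω) (Eᶜ \ Ω) +
    interaction K (E \ Ω) (Eᶜ ∩ Ω)

/-- `E` is a minimizer of `P_{K,Ω}`: a (Lebesgue) measurable set with finite `K`-perimeter in `Ω`,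
which is not larger than that of any measurable set coinciding with `E` outside `Ω`. -/
def IsMinimizer {n : ℕ} (K : EuclideanSpace ℝ (Fin n) → ℝ)
    (Ω E : Set (EuclideanSpace ℝ (Fin n))) : Prop :=
  NullMeasurableSet E volume ∧ perK K Ω E < ∞ ∧
    ∀ F : Set (EuclideanSpace ℝ (Fin n)), NullMeasurableSet F volume → F \ Ω = E \ Ω →
      perK K Ω E ≤ perK K Ω F

/-! ### The classical perimeter -/

/-- The divergence of a vector field. -/
noncomputable def divergence {n : ℕ}
    (φ : EuclideanSpace ℝ (Fin n) → EuclideanSpace ℝ (Fin n)) (x : EuclideanSpace ℝ (Fin n)) : ℝ :=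
  ∑ i : Fin n, fderiv ℝ φ x (EuclideanSpace.single i 1) i

/-- Vector fields `φ ∈ C¹_c(Ω; ℝⁿ)` with `|φ| ≤ 1`. -/
def IsTestField {n : ℕ} (Ω : Set (EuclideanSpace ℝ (Fin n)))
    (φ : EuclideanSpace ℝ (Fin n) → EuclideanSpace ℝ (Fin n)) : Prop :=
  ContDiff ℝ 1 φ ∧ HasCompactSupport φ ∧ tsupport φ ⊆ Ω ∧ ∀ x, ‖φ x‖ ≤ 1

/-- The classical (De Giorgi) perimeter `Per_Ω(E) = |∇χ_E|(Ω)`, with values in `[0, ∞]`.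
The class of test fields is symmetric, so truncating at `0` by `ENNReal.ofReal` is harmless. -/
noncomputable def perimeter {n : ℕ} (Ω E : Set (EuclideanSpace ℝ (Fin n))) : ℝ≥0∞ :=
  ⨆ (φ : EuclideanSpace ℝ (Fin n) → EuclideanSpace ℝ (Fin n)) (_ : IsTestField Ω φ),
    ENNReal.ofReal (∫ x in E ∩ Ω, divergence φ x)

/-! ### Flatness. Points of `ℝⁿ`, `n = m + 1`, are written `(x', xₙ)` with `x' ∈ ℝᵐ`. -/

/-- The last coordinate `xₙ`. -/
def vert {m : ℕ} (x : EuclideanSpace ℝ (Fin (m + 1))) : ℝ := x (Fin.last m)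

/-- The first `n - 1` coordinates `x'`. -/
def horiz {m : ℕ} (x : EuclideanSpace ℝ (Fin (m + 1))) : EuclideanSpace ℝ (Fin m) :=
  WithLp.toLp 2 (fun i => x i.castSucc)

/-- The vertical rescaling `(x', xₙ) ↦ (x', xₙ / ε)`. -/
noncomputable def stretch {m : ℕ} (ε : ℝ) (x : EuclideanSpace ℝ (Fin (m + 1))) :
    EuclideanSpace ℝ (Fin (m + 1)) :=
  WithLp.toLp 2 (fun i => if i = Fin.last m then x i / ε else x i)

/-- `E` is `L¹`-close in `B₁` to a half-space `{xₙ ≤ t}`. -/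
def FlatOne {m : ℕ} (ε : ℝ) (E : Set (EuclideanSpace ℝ (Fin (m + 1)))) : Prop :=
  ∃ t ∈ Set.Icc (-1 : ℝ) 1,
    volume (symmDiff E {x | vert x ≤ t} ∩ Metric.ball 0 1) ≤ ENNReal.ofReal ε

/-- Outside a cylinder over a set of small measure, `E` is in `B₁` the subgraph of a measurable
function. As measurable sets are only determined up to null sets by the functional, the equality of
sets is meant up to a Lebesgue null set. -/
def FlatTwo {m : ℕ} (ε : ℝ) (E : Set (EuclideanSpace ℝ (Fin (m + 1)))) : Prop :=
  ∃ (B : Set (EuclideanSpace ℝ (Fin m))) (g : EuclideanSpace ℝ (Fin m) → ℝ),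
    MeasurableSet B ∧ B ⊆ Metric.closedBall 0 1 ∧ volume B ≤ ENNReal.ofReal ε ∧
    Measurable g ∧ (∀ y ∈ Metric.closedBall 0 1, g y ∈ Set.Icc (-1 : ℝ) 1) ∧
    ((E ∩ Metric.ball 0 1) \ {x | horiz x ∈ B} : Set (EuclideanSpace ℝ (Fin (m + 1))))
      =ᵐ[volume]
      ({x | x ∈ Metric.ball 0 1 ∧ horiz x ∈ Metric.closedBall 0 1 \ B ∧ vert x ≤ g (horiz x)} :
        Set (EuclideanSpace ℝ (Fin (m + 1))))

/-- The perimeter of the vertical rescaling of `E` by the factor `1 / ε`, inside the rescaled unit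
ball, is at most `C₀` (at most `C₀ ε` in the degenerate range `ε > 1`). -/
def FlatThree {m : ℕ} (C₀ ε : ℝ) (E : Set (EuclideanSpace ℝ (Fin (m + 1)))) : Prop :=
  perimeter (stretch ε '' Metric.ball 0 1) (stretch ε '' E) ≤ ENNReal.ofReal (C₀ * max 1 ε)

/-- The flatness parameter: `C R^{-1/2}` in dimension two, `C / √(log R)` in dimension three
(the only dimensions in which it is used). -/
noncomputable def flatnessRate (n : ℕ) (C R : ℝ) : ℝ :=
  if n = 2 then C * R ^ (-(1 / 2) : ℝ) else C / √(Real.log R)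

end NonlocalPerimeter

/-! The proof is a quantitative second variation argument. Move `E` by the flow `x ↦ x + t φ(x) e`,
where `φ = 1` on `B_2` and `φ = 0` outside `B_R`. The kernel's derivative bounds cancel the
first-order terms in the energies of the two deformed sets at times `t` and `-t`. Their sum is
therefore at most twice the energy of `E` plus `C t²` times the integral of `σ²` against the
interaction density of `E`, where `σ` controls the variation of `φ` (`second_variation_le`). The
energy is submodular with a gain: for a competitor `F`, the interaction between `F \ E` and `E \ F`
is saved on passing to `E ∪ F` and `E ∩ F`. Minimality bounds this gain by the second-order error
(`PairMinimizer.gain_le`). Since `K ≥ 1` near the origin and the flow is a translation in `B_1`, the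
volumes gained and lost there by a translation of length `t` have product at most that error.

The energy in `B_r` is `O(r^(n-1))`, by comparison with the ball (`exists_energy_bound`). A single
cutoff at scale `R` makes the error `O(t² / R)` when `n = 2`. When `n = 3`, averaging cutoffs over
about `log R` dyadic scales, a discrete logarithmic cutoff, makes it `O(t² / log R)`. So the product
of gain and loss is at most `(ε t)²`, with `ε` of the stated order (`exists_product_bound`).

For each translation, one of gain and loss is thus at most about `ε t`. The sign of a linear
functional of the direction, the derivative of a smoothed volume of the translated set, decides
which. Orthogonally to its gradient both are small; along the gradient one of them is
(`ProductBound.exists_direction`). Since gain and loss differ by at most the volume of a boundary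
layer of the ball, their sum is `O(t)` with a constant that is dimensional up to `2ε`.

Rotate the selected direction to the vertical. Rare upward crossings make almost every vertical line
meet `E` in an initial segment, up to a set of lines of measure `ε`: this is (F2). Small horizontal
variation and a Poincaré inequality make most horizontal slices nearly full or nearly empty. The
subgraph structure forbids an empty slice below a full one, which yields a threshold height and
(F1). For (F3), the vertical stretch multiplies the horizontal variation `O(ε)` by `1/ε` and leaves
the bounded vertical variation unchanged, so both become bounded. -/

namespace NonlocalPerimeter

set_option linter.unusedSectionVars false

/-! ### Perimeters as measures of pairs: submodularity and comparison -/

section CutPairs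

variable {V : Type*} [MeasurableSpace V]

/-- The pairs contributing to the perimeter of `E` in `Ω`. -/
def cutPairs (Ω E : Set V) : Set (V × V) := {p | p.1 ∈ E ∧ p.2 ∉ E ∧ (p.1 ∈ Ω ∨ p.2 ∈ Ω)}

/-- The pairs with first point in `A` that are separated by `E`. -/
def sepPairs (A E : Set V) : Set (V × V) := {p | p.1 ∈ A ∧ ¬ (p.1 ∈ E ↔ p.2 ∈ E)}

theorem measurableSet_cutPairs {Ω E : Set V} (hΩ : MeasurableSet Ω) (hE : MeasurableSet E) :
    MeasurableSet (cutPairs Ω E) :=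
  (measurable_fst hE).inter ((measurable_snd hE).compl.inter
    ((measurable_fst hΩ).union (measurable_snd hΩ)))

theorem measurableSet_sepPairs {A E : Set V} (hA : MeasurableSet A) (hE : MeasurableSet E) :
    MeasurableSet (sepPairs A E) :=
  (measurable_fst hA).inter
    ((measurable_fst hE).iff (measurable_snd hE)).compl

/-- `E` is a measurable minimizer in `Ω` of the perimeter defined by a measure on pairs. -/
structure PairMinimizer (ν : Measure (V × V)) (Ω E : Set V) : Prop where
  meas : MeasurableSet E
  measΩ : MeasurableSet Ω
  finite : ν (cutPairs Ω E) < ∞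
  le : ∀ F : Set V, MeasurableSet F → F \ Ω = E \ Ω → ν (cutPairs Ω E) ≤ ν (cutPairs Ω F)

/-- Submodularity of the perimeter, with the gain term. -/
theorem measure_cutPairs_submodular (ν : Measure (V × V)) {Ω E F : Set V} (hΩ : MeasurableSet Ω)
    (hE : MeasurableSet E) (hF : MeasurableSet F) (h : F \ Ω = E \ Ω) :
    ν (cutPairs Ω (E ∪ F)) + ν (cutPairs Ω (E ∩ F)) + ν ((F \ E) ×ˢ (E \ F)) ≤
      ν (cutPairs Ω E) + ν (cutPairs Ω F) := by
  have m1 := measurableSet_cutPairs hΩ (hE.union hF)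
  have m2 := measurableSet_cutPairs hΩ (hE.inter hF)
  have m3 : MeasurableSet ((F \ E) ×ˢ (E \ F)) := (hF.diff hE).prod (hE.diff hF)
  have m4 := measurableSet_cutPairs hΩ hE
  have m5 := measurableSet_cutPairs hΩ hF
  rw [← lintegral_indicator_one m1, ← lintegral_indicator_one m2, ← lintegral_indicator_one m3,
    ← lintegral_indicator_one m4, ← lintegral_indicator_one m5,
    ← lintegral_add_left (measurable_one.indicator m1),
    ← lintegral_add_right _ (measurable_one.indicator m3),
    ← lintegral_add_left (measurable_one.indicator m4)]
  refine lintegral_mono fun p => ?_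
  obtain ⟨x, y⟩ := p
  -- The sets differ only inside `Ω`, so a pair in the gain term always has a point in `Ω` and is
  -- charged to `F`. The inequality then holds pointwise for the indicators.
  have hx : x ∉ Ω → (x ∈ F ↔ x ∈ E) := fun hx => by
    have := Set.ext_iff.1 h x
    simp only [Set.mem_sdiff, hx, not_false_eq_true, and_true] at this; exact this
  by_cases a1 : x ∈ E <;> by_cases a2 : x ∈ F <;> by_cases a3 : y ∈ E <;> by_cases a4 : y ∈ F <;>
    by_cases a5 : x ∈ Ω <;> by_cases a6 : y ∈ Ω <;>
    simp_all [cutPairs, Set.indicator]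

/-- A minimizer compared with two competitors: the gain term is bounded by the second difference. -/
theorem PairMinimizer.gain_le {ν : Measure (V × V)} {Ω E F G : Set V} (h : PairMinimizer ν Ω E)
    (hF : MeasurableSet F) (hG : MeasurableSet G) (hFE : F \ Ω = E \ Ω) (hGE : G \ Ω = E \ Ω)
    {η : ℝ≥0∞} (hη : ν (cutPairs Ω F) + ν (cutPairs Ω G) ≤ 2 * ν (cutPairs Ω E) + η) :
    ν ((F \ E) ×ˢ (E \ F)) ≤ η := by
  have h1 := measure_cutPairs_submodular ν h.measΩ h.meas hF hFE
  have h2 := h.le (E ∪ F) (h.meas.union hF) (by rw [Set.union_sdiff_distrib, hFE, Set.union_self])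
  have h3 := h.le (E ∩ F) (h.meas.inter hF) (by
    ext x
    have := Set.ext_iff.1 hFE x
    simp only [Set.mem_sdiff, Set.mem_inter_iff] at this ⊢
    tauto)
  have h4 := h.le G hG hGE
  have hfin := h.finite
  set P := ν (cutPairs Ω E)
  -- The competitors `E ∪ F`, `E ∩ F` and `G` each cost at least `P`, while submodularity bounds
  -- their total cost plus the gain by `P` plus the costs of `F` and `G`. Finiteness of `P` allows
  -- cancellation.
  have : (2 * P + P) + ν ((F \ E) ×ˢ (E \ F)) ≤ (2 * P + P) + η := by
    calc (2 * P + P) + ν ((F \ E) ×ˢ (E \ F)) = P + P + ν ((F \ E) ×ˢ (E \ F)) + P := by ring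
      _ ≤ (ν (cutPairs Ω (E ∪ F)) + ν (cutPairs Ω (E ∩ F)) + ν ((F \ E) ×ˢ (E \ F)))
          + ν (cutPairs Ω G) := by gcongr
      _ ≤ P + ν (cutPairs Ω F) + ν (cutPairs Ω G) := by gcongr
      _ = P + (ν (cutPairs Ω F) + ν (cutPairs Ω G)) := by ring
      _ ≤ P + (2 * P + η) := by gcongr
      _ = _ := by ring
  refine (ENNReal.add_le_add_iff_left ?_).1 this
  exact (ENNReal.add_lt_top.2 ⟨ENNReal.mul_lt_top (by simp) hfin, hfin⟩).ne

/-- Compare with `E \ B`. The pairs no longer cut are exactly those from `E ∩ B` to the complement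
of `E`; any newly cut pair starts outside `B` and ends in `B`. -/
theorem PairMinimizer.inner_le {ν : Measure (V × V)} {Ω E B : Set V} (h : PairMinimizer ν Ω E)
    (hB : MeasurableSet B) (hBΩ : B ⊆ Ω) :
    ν ((E ∩ B) ×ˢ Eᶜ) ≤ ν (Bᶜ ×ˢ B) := by
  have hE := h.meas
  have hc := h.le (E \ B) (hE.diff hB) (by
    ext x; simp only [Set.mem_sdiff]; have := @hBΩ x; tauto)
  have hfin := h.finite
  set S : Set (V × V) := {p | p.1 ∈ E \ B ∧ p.2 ∉ E ∧ (p.1 ∈ Ω ∨ p.2 ∈ Ω)}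
  have mS : MeasurableSet S := (measurable_fst (hE.diff hB)).inter ((measurable_snd hE).compl.inter
    ((measurable_fst h.measΩ).union (measurable_snd h.measΩ)))
  have e1 : cutPairs Ω E = S ∪ (E ∩ B) ×ˢ Eᶜ := by
    ext ⟨x, y⟩; simp only [cutPairs, S, Set.mem_sdiff, Set.mem_union, Set.mem_prod, Set.mem_ofPred_eq,
      Set.mem_inter_iff, Set.mem_compl_iff]
    have := @hBΩ x; tauto
  have e2 : cutPairs Ω (E \ B) ⊆ S ∪ Bᶜ ×ˢ B := by
    rintro ⟨x, y⟩; simp only [cutPairs, S, Set.mem_sdiff, Set.mem_union, Set.mem_prod,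
      Set.mem_ofPred_eq, Set.mem_compl_iff]
    tauto
  have d1 : Disjoint S ((E ∩ B) ×ˢ Eᶜ) := by
    rw [Set.disjoint_left]; rintro ⟨x, y⟩ h1 h2
    exact h1.1.2 h2.1.2
  have hS : ν S ≠ ∞ := ((measure_mono (e1 ▸ Set.subset_union_left)).trans_lt hfin).ne
  refine (ENNReal.add_le_add_iff_left hS).1 ?_
  rw [← measure_union d1 (((hE.inter hB)).prod hE.compl), ← e1]
  exact hc.trans ((measure_mono e2).trans (measure_union_le _ _))

/-- Dual comparison, with `E ∪ B`: pairs from `E` to `B \ E` are no longer cut, and new pairs leave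
`B`. -/
theorem PairMinimizer.outer_le {ν : Measure (V × V)} {Ω E B : Set V} (h : PairMinimizer ν Ω E)
    (hB : MeasurableSet B) (hBΩ : B ⊆ Ω) :
    ν (E ×ˢ (B \ E)) ≤ ν (B ×ˢ Bᶜ) := by
  have hE := h.meas
  have hc := h.le (E ∪ B) (hE.union hB) (by
    ext x; simp only [Set.mem_sdiff, Set.mem_union]; have := @hBΩ x; tauto)
  have hfin := h.finite
  set S : Set (V × V) := {p | p.1 ∈ E ∧ p.2 ∉ E ∪ B ∧ (p.1 ∈ Ω ∨ p.2 ∈ Ω)}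
  have mS : MeasurableSet S := (measurable_fst hE).inter ((measurable_snd (hE.union hB)).compl.inter
    ((measurable_fst h.measΩ).union (measurable_snd h.measΩ)))
  have e1 : cutPairs Ω E = S ∪ E ×ˢ (B \ E) := by
    ext ⟨x, y⟩; simp only [cutPairs, S, Set.mem_sdiff, Set.mem_union, Set.mem_prod, Set.mem_ofPred_eq]
    have := @hBΩ y; tauto
  have e2 : cutPairs Ω (E ∪ B) ⊆ S ∪ B ×ˢ Bᶜ := by
    rintro ⟨x, y⟩; simp only [cutPairs, S, Set.mem_union, Set.mem_prod,
      Set.mem_ofPred_eq, Set.mem_compl_iff]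
    tauto
  have d1 : Disjoint S (E ×ˢ (B \ E)) := by
    rw [Set.disjoint_left]; rintro ⟨x, y⟩ h1 h2
    exact h1.2.1 (Or.inr h2.2.1)
  have hS : ν S ≠ ∞ := ((measure_mono (e1 ▸ Set.subset_union_left)).trans_lt hfin).ne
  refine (ENNReal.add_le_add_iff_left hS).1 ?_
  rw [← measure_union d1 (hE.prod (hB.diff hE)), ← e1]
  exact hc.trans ((measure_mono e2).trans (measure_union_le _ _))

end CutPairs

/-! ### The measure `k(x - y) dx dy` -/

section PairMeasure

variable {V : Type*} [NormedAddCommGroup V] [InnerProductSpace ℝ V] [FiniteDimensional ℝ V]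
  [MeasurableSpace V] [BorelSpace V]

/-- The measure `k(x - y) dx dy` on pairs of points. -/
noncomputable def pairMeasure (k : V → ℝ≥0∞) : Measure (V × V) :=
  (volume.prod volume).withDensity fun p => k (p.1 - p.2)

theorem pairMeasure_eq_lintegral {k : V → ℝ≥0∞} (hk : Measurable k) {S : Set (V × V)}
    (hS : MeasurableSet S) :
    pairMeasure k S = ∫⁻ x, ∫⁻ y, S.indicator 1 (x, y) * k (x - y) := by
  have hm : Measurable fun p : V × V => k (p.1 - p.2) := by fun_prop
  have h1 : Measurable fun p : V × V => S.indicator (1 : V × V → ℝ≥0∞) p * k (p.1 - p.2) :=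
    (measurable_one.indicator hS).mul hm
  rw [pairMeasure, withDensity_apply _ hS, ← lintegral_indicator hS,
    ← lintegral_prod _ h1.aemeasurable]
  congr 1; ext p
  by_cases h : p ∈ S <;> simp [h]

/-- Substituting `z = x - y` turns energies into weighted averages, over translations `z`, of
volumes. All energy estimates are reduced to volumes of translates in this way. -/
theorem pairMeasure_apply {k : V → ℝ≥0∞} (hk : Measurable k) {S : Set (V × V)}
    (hS : MeasurableSet S) :
    pairMeasure k S = ∫⁻ z, k z * volume {x | (x, x - z) ∈ S} := by
  rw [pairMeasure_eq_lintegral hk hS]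
  have e1 : ∀ x, ∫⁻ y, S.indicator (1 : V × V → ℝ≥0∞) (x, y) * k (x - y)
      = ∫⁻ z, S.indicator 1 (x, x - z) * k z := by
    intro x
    rw [← lintegral_sub_left_eq_self _ x]
    simp
  simp_rw [e1]
  have hm : Measurable fun p : V × V => S.indicator (1 : V × V → ℝ≥0∞) (p.1, p.1 - p.2) * k p.2 :=
    ((measurable_one.indicator hS).comp (by fun_prop)).mul (by fun_prop)
  rw [lintegral_lintegral_swap hm.aemeasurable]
  congr 1; ext z
  have hS' : MeasurableSet {x | (x, x - z) ∈ S} :=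
    hS.preimage (f := fun x : V => (x, x - z)) (by fun_prop)
  rw [lintegral_mul_const, mul_comm, ← lintegral_indicator_one hS']
  · rfl
  · exact (measurable_one.indicator hS).comp (by fun_prop)

theorem pairMeasure_swap {k : V → ℝ≥0∞} (hk : Measurable k) (he : ∀ z, k (-z) = k z)
    {S : Set (V × V)} (hS : MeasurableSet S) :
    pairMeasure k (Prod.swap ⁻¹' S) = pairMeasure k S := by
  rw [pairMeasure_eq_lintegral hk hS, pairMeasure_eq_lintegral hk (measurable_swap hS),
    lintegral_lintegral_swap]
  · congr 1; ext x; congr 1; ext y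
    rw [← he, neg_sub]; rfl
  · exact (((measurable_one.indicator (measurable_swap hS)).mul
      (by fun_prop : Measurable fun p : V × V => k (p.1 - p.2)))).aemeasurable

/-- The interaction of a minimizer with its complement near `B` is controlled by the interaction
of `B` with its complement. -/
theorem PairMinimizer.sepPairs_le {k : V → ℝ≥0∞} (hk : Measurable k) (he : ∀ z, k (-z) = k z)
    {Ω E B : Set V} (h : PairMinimizer (pairMeasure k) Ω E)
    (hB : MeasurableSet B) (hBΩ : B ⊆ Ω) :
    pairMeasure k (sepPairs B E) ≤ 2 * pairMeasure k (B ×ˢ Bᶜ) := by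
  have hE := h.meas
  have e : sepPairs B E ⊆ (E ∩ B) ×ˢ Eᶜ ∪ Prod.swap ⁻¹' (E ×ˢ (B \ E)) := by
    rintro ⟨x, y⟩; simp only [sepPairs, Set.mem_ofPred_eq, Set.mem_union, Set.mem_prod,
      Set.mem_inter_iff, Set.mem_preimage, Prod.swap, Set.mem_sdiff, Set.mem_compl_iff]
    tauto
  refine (measure_mono e).trans ((measure_union_le _ _).trans ?_)
  rw [pairMeasure_swap hk he (hE.prod (hB.diff hE)), two_mul]
  refine add_le_add ((h.inner_le hB hBΩ).trans ?_) (h.outer_le hB hBΩ)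
  rw [← pairMeasure_swap hk he (hB.prod hB.compl)]
  refine measure_mono ?_
  rintro ⟨x, y⟩ hxy
  exact ⟨hxy.2, hxy.1⟩

end PairMeasure

/-! ### Points separated from their translate -/

section Jump

/-- The set of points of `A` whose translate by `-h` lies on the other side of `E`. -/
def jumpSet {V : Type*} [Sub V] (A E : Set V) (h : V) : Set V := {x | x ∈ A ∧ ¬ (x ∈ E ↔ x - h ∈ E)}

theorem jumpSet_mono {V : Type*} [Sub V] {A B E : Set V} (hAB : A ⊆ B) (h : V) : jumpSet A E h ⊆ jumpSet B E h :=
  fun _ hx => ⟨hAB hx.1, hx.2⟩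

variable {V : Type*} [NormedAddCommGroup V] [InnerProductSpace ℝ V] [FiniteDimensional ℝ V]
  [MeasurableSpace V] [BorelSpace V]

/-- A jump from `x` to `x - a - b` must already occur from `x` to `x - a`, or from `x - a` to `x - a
- b`. The intermediate point may leave the ball, whence the larger radius. -/
theorem volume_jumpSet_add_le (E : Set V) (r : ℝ) (a b : V) :
    volume (jumpSet (Metric.ball 0 r) E (a + b)) ≤ volume (jumpSet (Metric.ball 0 r) E a) +
      volume (jumpSet (Metric.ball 0 (r + ‖a‖)) E b) := by
  have : jumpSet (Metric.ball 0 r) E (a + b) ⊆ jumpSet (Metric.ball 0 r) E a ∪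
      (fun x => x - a) ⁻¹' jumpSet (Metric.ball 0 (r + ‖a‖)) E b := by
    rintro x ⟨hx, hx'⟩
    by_cases h : x ∈ E ↔ x - a ∈ E
    · refine Or.inr ⟨?_, ?_⟩
      · have := norm_sub_le x a
        simp only [Metric.mem_ball, dist_zero_right] at hx ⊢
        linarith
      · rwa [← h, sub_sub]
    · exact Or.inl ⟨hx, h⟩
  refine (measure_mono this).trans ((measure_union_le _ _).trans ?_)
  refine add_le_add le_rfl ?_
  simp only [sub_eq_add_neg]
  exact (measure_preimage_add_right (volume : Measure V) (-a) _).le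

theorem volume_jumpSet_nsmul_le (E : Set V) (r : ℝ) (a : V) (N : ℕ) :
    volume (jumpSet (Metric.ball 0 r) E (N • a)) ≤
      N * volume (jumpSet (Metric.ball 0 (r + N * ‖a‖)) E a) := by
  induction N with
  | zero => simp [jumpSet]
  | succ N ih =>
    rw [succ_nsmul]
    refine (volume_jumpSet_add_le E r _ _).trans ?_
    push_cast
    rw [add_mul (N : ℝ≥0∞), one_mul]
    have hn : ‖N • a‖ ≤ N * ‖a‖ := norm_nsmul_le
    refine add_le_add (ih.trans ?_) ?_
    · gcongr
      exact jumpSet_mono (Metric.ball_subset_ball (by nlinarith [norm_nonneg a])) a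
    · refine measure_mono (jumpSet_mono (Metric.ball_subset_ball ?_) a)
      nlinarith [norm_nonneg a]

theorem measurable_volume_jumpSet {A E : Set V} (hA : MeasurableSet A) (hE : MeasurableSet E) :
    Measurable fun h => volume (jumpSet A E h) := by
  have hS : MeasurableSet {p : V × V | p.2 ∈ A ∧ ¬ (p.2 ∈ E ↔ p.2 - p.1 ∈ E)} :=
    (measurable_snd hA).inter (MeasurableSet.iff (measurable_snd hE)
      (measurableSet_preimage (measurable_snd.sub measurable_fst) hE)).compl
  exact measurable_measure_prodMk_left hS

theorem pairMeasure_sepPairs {k : V → ℝ≥0∞} (hk : Measurable k) {A E : Set V}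
    (hA : MeasurableSet A) (hE : MeasurableSet E) :
    pairMeasure k (sepPairs A E) = ∫⁻ z, k z * volume (jumpSet A E z) :=
  pairMeasure_apply hk (measurableSet_sepPairs hA hE)

end Jump

/-! ### Growth of the energy of a minimizer -/

section Energy

variable {V : Type*} [NormedAddCommGroup V] [InnerProductSpace ℝ V] [FiniteDimensional ℝ V]
  [MeasurableSpace V] [BorelSpace V]

theorem pow_sub_pow_le_mul {r a : ℝ} (ha : 0 ≤ a) (har : a ≤ r) (d : ℕ) :
    r ^ d - (r - a) ^ d ≤ d * r ^ (d - 1) * a := by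
  induction d with
  | zero => simp
  | succ d ih =>
    have h0 : 0 ≤ r - a := by linarith
    have hr : 0 ≤ r := by linarith
    have h1 : (r - a) ^ d ≤ r ^ d := pow_le_pow_left₀ h0 (by linarith) d
    have h2 : r ^ (d + 1) - (r - a) ^ (d + 1) = r * (r ^ d - (r - a) ^ d) + a * (r - a) ^ d := by
      ring
    rw [h2, Nat.add_sub_cancel]
    have h3 : r * (r ^ d - (r - a) ^ d) ≤ d * r ^ d * a := by
      refine (mul_le_mul_of_nonneg_left ih hr).trans (le_of_eq ?_)
      rcases d with _ | d
      · simp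
      · simp only [Nat.add_sub_cancel]; ring
    push_cast
    nlinarith [mul_le_mul_of_nonneg_left h1 ha]

/-- Points leaving the ball lie in a shell of width `‖z‖`; if `‖z‖ ≥ r`, the volume of the whole
ball already satisfies the bound. -/
theorem volume_ball_diff_translate_le (hd : 1 ≤ Module.finrank ℝ V) {r : ℝ} (hr : 0 < r) (z : V) :
    volume {x : V | x ∈ Metric.ball 0 r ∧ x - z ∉ Metric.ball 0 r} ≤
      ENNReal.ofReal (Module.finrank ℝ V * r ^ (Module.finrank ℝ V - 1) * ‖z‖) *
        volume (Metric.ball (0 : V) 1) := by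
  have : Nontrivial V := Module.nontrivial_of_finrank_pos (R := ℝ) (by omega)
  set d := Module.finrank ℝ V
  have hball : ∀ s : ℝ, 0 ≤ s → volume (Metric.ball (0 : V) s) =
      ENNReal.ofReal (s ^ d) * volume (Metric.ball (0 : V) 1) :=
    fun s hs => Measure.addHaar_ball volume 0 hs
  rcases le_total ‖z‖ r with hz | hz
  · have hsub : {x : V | x ∈ Metric.ball 0 r ∧ x - z ∉ Metric.ball 0 r} ⊆
        Metric.ball 0 r \ Metric.ball 0 (r - ‖z‖) := by
      rintro x ⟨hx, hx'⟩
      refine ⟨hx, fun h => hx' ?_⟩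
      have := norm_sub_le x z
      simp only [Metric.mem_ball, dist_zero_right] at h ⊢
      linarith
    refine (measure_mono hsub).trans ?_
    rw [measure_sdiff (Metric.ball_subset_ball (by linarith [norm_nonneg z]))
      measurableSet_ball.nullMeasurableSet measure_ball_lt_top.ne, hball r hr.le,
      hball (r - ‖z‖) (by linarith), ← ENNReal.sub_mul (fun _ _ => measure_ball_lt_top.ne),
      ← ENNReal.ofReal_sub _ (pow_nonneg (by linarith) _)]
    gcongr
    exact pow_sub_pow_le_mul (norm_nonneg z) hz d
  · refine (measure_mono (fun x hx => hx.1)).trans ?_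
    rw [hball r hr.le]
    gcongr
    obtain ⟨e, he⟩ : ∃ e, d = e + 1 := ⟨d - 1, by omega⟩
    rw [he, Nat.add_sub_cancel, pow_succ]
    push_cast
    have h0 : 0 ≤ r ^ e := by positivity
    have h1 : (0:ℝ) ≤ e := by positivity
    have h2 := mul_le_mul_of_nonneg_left hz h0
    nlinarith [mul_nonneg (mul_nonneg h1 h0) (norm_nonneg z)]

theorem pairMeasure_ball_compl_le {k : V → ℝ≥0∞} (hk : Measurable k)
    (hd : 1 ≤ Module.finrank ℝ V) {r : ℝ} (hr : 0 < r) :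
    pairMeasure k (Metric.ball 0 r ×ˢ (Metric.ball 0 r)ᶜ) ≤
      ENNReal.ofReal (Module.finrank ℝ V * r ^ (Module.finrank ℝ V - 1)) *
        volume (Metric.ball (0 : V) 1) * ∫⁻ z, k z * ENNReal.ofReal ‖z‖ := by
  rw [pairMeasure_apply hk (measurableSet_ball.prod measurableSet_ball.compl),
    ← lintegral_const_mul _ (by fun_prop)]
  refine lintegral_mono fun z => ?_
  refine (mul_le_mul_right (volume_ball_diff_translate_le hd hr z) _).trans (le_of_eq ?_)
  rw [ENNReal.ofReal_mul (by positivity)]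
  ring

/-- Translations of a set are controlled by the interaction through a kernel which is bounded
below near the origin. -/
theorem volume_jumpSet_mul_le {k : V → ℝ≥0∞} (hk : Measurable k)
    (h1 : ∀ z, z ≠ 0 → ‖z‖ < 2 → 1 ≤ k z) [Nontrivial V] {E : Set V} (hE : MeasurableSet E)
    (r : ℝ) {z : V} (hz : ‖z‖ ≤ 1) :
    volume (jumpSet (Metric.ball 0 r) E z) * volume (Metric.ball (0 : V) 1) ≤
      2 * pairMeasure k (sepPairs (Metric.ball 0 (r + 1)) E) := by
  set J : V → ℝ≥0∞ := fun w => volume (jumpSet (Metric.ball 0 (r + 1)) E w) with hJ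
  have hJm : Measurable J := measurable_volume_jumpSet measurableSet_ball hE
  have hJ2 : ∫⁻ w in Metric.ball 0 2, J w ≤ pairMeasure k (sepPairs (Metric.ball 0 (r + 1)) E) := by
    rw [pairMeasure_sepPairs hk measurableSet_ball hE]
    refine (lintegral_mono_ae ?_).trans (setLIntegral_le_lintegral (Metric.ball 0 2) _)
    have hne : ∀ᵐ w : V, w ≠ 0 := by simp [ae_iff]
    filter_upwards [ae_restrict_mem measurableSet_ball, ae_restrict_of_ae hne] with w hw hw0
    have := h1 w hw0 (by simpa using hw)
    calc J w = 1 * J w := (one_mul _).symm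
      _ ≤ _ := by gcongr
  calc volume (jumpSet (Metric.ball 0 r) E z) * volume (Metric.ball (0 : V) 1)
      = ∫⁻ _ in Metric.ball (0 : V) 1, volume (jumpSet (Metric.ball 0 r) E z) := by
        rw [setLIntegral_const]
    -- Split the translation as `w + (z - w)` and average over `w` in the unit ball. Both parts have
    -- length less than `2`, where the kernel is at least `1`, so the energy controls both averages.
    _ ≤ ∫⁻ w in Metric.ball (0 : V) 1, (J w + J (z - w)) := by
        refine setLIntegral_mono' measurableSet_ball fun w hw => ?_
        have hw' : ‖w‖ < 1 := by simpa using hw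
        have := volume_jumpSet_add_le E r w (z - w)
        rw [add_sub_cancel] at this
        refine this.trans (add_le_add ?_ ?_) <;>
        exact measure_mono (jumpSet_mono (Metric.ball_subset_ball (by linarith)) _)
    _ = (∫⁻ w in Metric.ball (0 : V) 1, J w) + ∫⁻ w in Metric.ball (0 : V) 1, J (z - w) :=
        lintegral_add_left hJm _
    _ ≤ (∫⁻ w in Metric.ball 0 2, J w) + ∫⁻ w in Metric.ball 0 2, J w := by
        gcongr ?_ + ?_
        · exact lintegral_mono_set (Metric.ball_subset_ball (by norm_num))
        · rw [← lintegral_indicator measurableSet_ball, ← lintegral_indicator measurableSet_ball,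
            ← lintegral_sub_left_eq_self (fun w => (Metric.ball 0 2).indicator J w) z]
          refine lintegral_mono fun w => ?_
          by_cases hw : w ∈ Metric.ball (0 : V) 1
          · have hw' : ‖w‖ < 1 := by simpa using hw
            have : z - w ∈ Metric.ball (0 : V) 2 := by
              have := norm_sub_le z w
              simp only [Metric.mem_ball, dist_zero_right]; linarith
            simp [Set.indicator_of_mem hw, Set.indicator_of_mem this]
          · simp [Set.indicator_of_notMem hw]
    _ ≤ _ := by rw [two_mul]; gcongr

/-- The energy of a minimizer in a ball of radius `r` grows at most like `r ^ (n - 1)`, also for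
the interaction with an additional integrable kernel. -/
theorem exists_energy_bound {k k₂ : V → ℝ≥0∞} (hk : Measurable k) (hk₂ : Measurable k₂)
    (he : ∀ z, k (-z) = k z) (h1 : ∀ z, z ≠ 0 → ‖z‖ < 2 → 1 ≤ k z)
    (hd : 1 ≤ Module.finrank ℝ V) (hI : ∫⁻ z, k z * ENNReal.ofReal ‖z‖ ≠ ∞)
    {ρ : ℝ} (hρ : 0 ≤ ρ) (hk₂s : ∀ z, ρ < ‖z‖ → k₂ z = 0) (hI₂ : ∫⁻ z, k₂ z ≠ ∞) :
    ∃ C : ℝ≥0∞, C ≠ ∞ ∧ ∀ R : ℝ, ∀ E : Set V,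
      PairMinimizer (pairMeasure k) (Metric.ball 0 R) E →
      (4 ≤ R → pairMeasure (k + k₂) (sepPairs (Metric.ball 0 3) E) ≤ C) ∧
      ∀ r : ℝ, 1 ≤ r → r + ρ + 1 < R → pairMeasure (k + k₂) (sepPairs (Metric.ball 0 r) E) ≤
        C * ENNReal.ofReal (r ^ (Module.finrank ℝ V - 1)) := by
  have : Nontrivial V := Module.nontrivial_of_finrank_pos (R := ℝ) (by omega)
  set d := Module.finrank ℝ V with hdd
  set ω := volume (Metric.ball (0 : V) 1) with hω
  have hω0 : ω ≠ 0 := (Metric.measure_ball_pos _ _ one_pos).ne'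
  have hωt : ω ≠ ∞ := measure_ball_lt_top.ne
  set I := ∫⁻ z, k z * ENNReal.ofReal ‖z‖ with hIdef
  set I₂ := ∫⁻ z, k₂ z with hI₂def
  set C₁ : ℝ≥0∞ := 2 * (d * ω * I) with hC₁
  have hC₁t : C₁ ≠ ∞ := by
    simp only [hC₁, ne_eq]
    exact ENNReal.mul_ne_top (by simp) (ENNReal.mul_ne_top (ENNReal.mul_ne_top (by simp) hωt) hI)
  -- A translation in the support of `k₂` has length at most `ρ`; it is cut into `N` steps of length
  -- at most `1`, to which the averaging estimate applies.
  set N : ℕ := ⌈ρ⌉₊ + 1 with hN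
  have hNρ : ρ ≤ N := (Nat.le_ceil ρ).trans (by rw [hN]; push_cast; linarith)
  have hN0 : (0 : ℝ) < N := by rw [hN]; positivity
  set C₂ : ℝ≥0∞ := N * (2 * (C₁ * ENNReal.ofReal ((ρ + 2) ^ (d - 1))) / ω) with hC₂
  have hC₂t : C₂ ≠ ∞ := by
    simp only [hC₂, ne_eq]
    refine ENNReal.mul_ne_top (by simp) (ENNReal.div_ne_top ?_ hω0)
    exact ENNReal.mul_ne_top (by simp) (ENNReal.mul_ne_top hC₁t (by simp))
  have key : ∀ R : ℝ, ∀ E : Set V, PairMinimizer (pairMeasure k) (Metric.ball 0 R) E →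
      ∀ r, 1 ≤ r → r ≤ R → pairMeasure k (sepPairs (Metric.ball 0 r) E) ≤
        C₁ * ENNReal.ofReal (r ^ (d - 1)) := by
    intro R E hE r hr hrR
    refine (hE.sepPairs_le hk he measurableSet_ball (Metric.ball_subset_ball hrR)).trans ?_
    rw [hC₁, mul_assoc]
    gcongr
    refine (pairMeasure_ball_compl_le hk hd (by linarith)).trans (le_of_eq ?_)
    rw [ENNReal.ofReal_mul (by positivity), ENNReal.ofReal_natCast]
    ring
  have split : ∀ A E : Set V, MeasurableSet A → MeasurableSet E →
      pairMeasure (k + k₂) (sepPairs A E) =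
        pairMeasure k (sepPairs A E) + ∫⁻ z, k₂ z * volume (jumpSet A E z) := by
    intro A E hA hE
    rw [pairMeasure_sepPairs (hk.add hk₂) hA hE, pairMeasure_sepPairs hk hA hE,
      ← lintegral_add_left (by exact hk.mul (measurable_volume_jumpSet hA hE))]
    simp only [Pi.add_apply, add_mul]
  -- The first two terms serve the crude bound in `B_3`, which only needs `R ≥ 4` because the jump
  -- sets for `k₂` are bounded by the volume of the ball. The last two serve the bound with growth,
  -- which needs room `ρ + 1` around `B_r`.
  refine ⟨C₁ * ENNReal.ofReal (3 ^ (d - 1)) + I₂ * volume (Metric.ball (0 : V) 3) +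
    (C₁ + I₂ * C₂), ?_, fun R E hE => ⟨fun hR => ?_, fun r hr hrR => ?_⟩⟩
  · refine ENNReal.add_ne_top.2 ⟨ENNReal.add_ne_top.2 ⟨ENNReal.mul_ne_top hC₁t (by simp),
      ENNReal.mul_ne_top hI₂ measure_ball_lt_top.ne⟩,
      ENNReal.add_ne_top.2 ⟨hC₁t, ENNReal.mul_ne_top hI₂ hC₂t⟩⟩
  · rw [split _ _ measurableSet_ball hE.meas]
    refine le_trans (add_le_add (key R E hE 3 (by norm_num) (by linarith)) ?_) le_self_add
    rw [hI₂def, ← lintegral_mul_const _ hk₂]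
    refine lintegral_mono fun z => mul_le_mul_right (measure_mono fun x hx => hx.1) _
  · rw [split _ _ measurableSet_ball hE.meas]
    refine le_trans ?_ (mul_le_mul_left le_add_self _)
    rw [add_mul]
    refine add_le_add (key R E hE r hr (by linarith)) ?_
    rw [hI₂def, ← lintegral_mul_const _ hk₂, ← lintegral_mul_const _ (hk₂.mul_const _)]
    refine lintegral_mono fun z => ?_
    rcases lt_or_ge ρ ‖z‖ with hz | hz
    · simp [hk₂s z hz]
    rw [mul_assoc]
    gcongr
    set a : V := (N : ℝ)⁻¹ • z with ha
    have hza : z = N • a := by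
      rw [ha, ← Nat.cast_smul_eq_nsmul ℝ, smul_smul, mul_inv_cancel₀ hN0.ne', one_smul]
    have hna : N * ‖a‖ = ‖z‖ := by
      rw [ha, norm_smul, norm_inv, Real.norm_natCast, ← mul_assoc, mul_inv_cancel₀ hN0.ne', one_mul]
    have ha1 : ‖a‖ ≤ 1 := by
      have : N * ‖a‖ ≤ N * 1 := by rw [hna]; linarith
      exact le_of_mul_le_mul_left this hN0
    calc volume (jumpSet (Metric.ball 0 r) E z)
        ≤ N * volume (jumpSet (Metric.ball 0 (r + N * ‖a‖)) E a) := by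
          rw [hza]
          exact volume_jumpSet_nsmul_le E r a N
      _ ≤ N * volume (jumpSet (Metric.ball 0 (r + ρ)) E a) := by
          gcongr
          exact jumpSet_mono (Metric.ball_subset_ball (by linarith)) a
      _ ≤ N * ((2 * (C₁ * ENNReal.ofReal ((r + ρ + 1) ^ (d - 1)))) / ω) := by
          gcongr
          rw [ENNReal.le_div_iff_mul_le (Or.inl hω0) (Or.inl hωt)]
          refine (volume_jumpSet_mul_le hk h1 hE.meas _ ha1).trans ?_
          gcongr
          exact key R E hE _ (by linarith) hrR.le
      -- As `r ≥ 1`, the enlarged radius satisfies `r + ρ + 1 ≤ (ρ + 2) r`.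
      _ ≤ N * ((2 * (C₁ * (ENNReal.ofReal ((ρ + 2) ^ (d - 1)) *
            ENNReal.ofReal (r ^ (d - 1))))) / ω) := by
          gcongr
          rw [← ENNReal.ofReal_mul (by positivity), ← mul_pow]
          gcongr
          nlinarith
      _ = C₂ * ENNReal.ofReal (r ^ (d - 1)) := by
          rw [hC₂]; simp only [div_eq_mul_inv]; ring

end Energy

/-! ### Second differences of the kernel -/

section Kernel

/-- Two applications of the mean value inequality, first to the derivative along the line and then
to the function minus its linear part. This needs no continuity of the second derivative, at the
price of `M` instead of `M / 2`. -/
theorem abs_sub_sub_le_of_second_deriv {V : Type*} [NormedAddCommGroup V] [NormedSpace ℝ V]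
    {K : V → ℝ} {z e : V} {τ M : ℝ}
    (h1 : ∀ σ : ℝ, |σ| ≤ |τ| → DifferentiableAt ℝ K (z + σ • e))
    (h2 : ∀ σ : ℝ, |σ| ≤ |τ| → DifferentiableAt ℝ (fderiv ℝ K) (z + σ • e))
    (hM : ∀ σ : ℝ, |σ| ≤ |τ| → |fderiv ℝ (fderiv ℝ K) (z + σ • e) e e| ≤ M) :
    |K (z + τ • e) - K z - τ * fderiv ℝ K z e| ≤ M * τ ^ 2 := by
  set S : Set ℝ := Set.Icc (-|τ|) |τ| with hS
  have hSm : ∀ σ ∈ S, |σ| ≤ |τ| := fun σ hσ => abs_le.2 hσ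
  have hconv : Convex ℝ S := convex_Icc _ _
  have h0 : (0 : ℝ) ∈ S := ⟨by simp, by simp⟩
  have hline : ∀ σ : ℝ, HasDerivAt (fun σ : ℝ => z + σ • e) e σ := fun σ => by
    simpa using ((hasDerivAt_id σ).smul_const e).const_add z
  have d1 : ∀ σ ∈ S, HasDerivAt (fun σ : ℝ => K (z + σ • e)) (fderiv ℝ K (z + σ • e) e) σ :=
    fun σ hσ => (h1 σ (hSm σ hσ)).hasFDerivAt.comp_hasDerivAt σ (hline σ)
  have d2 : ∀ σ ∈ S, HasDerivAt (fun σ : ℝ => fderiv ℝ K (z + σ • e) e)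
      (fderiv ℝ (fderiv ℝ K) (z + σ • e) e e) σ := fun σ hσ => by
    have := (h2 σ (hSm σ hσ)).hasFDerivAt.comp_hasDerivAt σ (hline σ)
    simpa using this.clm_apply (hasDerivAt_const σ e)
  have b1 : ∀ σ ∈ S, |fderiv ℝ K (z + σ • e) e - fderiv ℝ K z e| ≤ M * |τ| := fun σ hσ => by
    have := hconv.norm_image_sub_le_of_norm_hasDerivWithin_le
      (fun x hx => (d2 x hx).hasDerivWithinAt) (fun x hx => hM x (hSm x hx)) h0 hσ
    simp only [Real.norm_eq_abs, sub_zero, zero_smul, add_zero] at this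
    have hM0 : 0 ≤ M := (abs_nonneg _).trans (hM 0 (by simp))
    exact this.trans (mul_le_mul_of_nonneg_left (hSm σ hσ) hM0)
  have hτ : τ ∈ S := ⟨neg_abs_le τ, le_abs_self τ⟩
  have := hconv.norm_image_sub_le_of_norm_hasDerivWithin_le
    (f := fun σ => K (z + σ • e) - σ * fderiv ℝ K z e)
    (f' := fun σ => fderiv ℝ K (z + σ • e) e - fderiv ℝ K z e)
    (fun x hx => by
      have := (d1 x hx).sub ((hasDerivAt_id' x).mul_const (fderiv ℝ K z e))
      rw [one_mul] at this
      exact this.hasDerivWithinAt) b1 h0 hτ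
  simp only [Real.norm_eq_abs, sub_zero, zero_smul, add_zero, zero_mul] at this
  calc |K (z + τ • e) - K z - τ * fderiv ℝ K z e|
      = |K (z + τ • e) - τ * fderiv ℝ K z e - K z| := by ring_nf
    _ ≤ M * |τ| * |τ| := this
    _ = M * τ ^ 2 := by rw [mul_assoc, ← sq, sq_abs]

variable {n : ℕ} {K Kstar : EuclideanSpace ℝ (Fin n) → ℝ}

/-- A displacement of at most half the distance to the origin keeps the segment away from the
singularity and inside the ball on which the second derivative is bounded by `Kstar z / ‖z‖ ^ 2`. -/
theorem DerivBound.abs_taylor_le (h : DerivBound K Kstar) {z e : EuclideanSpace ℝ (Fin n)}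
    (hz : z ≠ 0) (he : ‖e‖ = 1) {τ : ℝ} (hτ : |τ| ≤ ‖z‖ / 2) :
    |K (z + τ • e) - K z - τ * fderiv ℝ K z e| ≤ Kstar z / ‖z‖ ^ 2 * τ ^ 2 := by
  have hz' : 0 < ‖z‖ := norm_pos_iff.2 hz
  have hn : ∀ σ : ℝ, |σ| ≤ |τ| → ‖z + σ • e - z‖ ≤ ‖z‖ / 2 := fun σ hσ => by
    rw [add_sub_cancel_left, norm_smul, he, mul_one, Real.norm_eq_abs]; exact hσ.trans hτ
  have hne : ∀ σ : ℝ, |σ| ≤ |τ| → z + σ • e ≠ 0 := fun σ hσ h0 => by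
    have := hn σ hσ
    rw [h0, zero_sub, norm_neg] at this; linarith
  refine abs_sub_sub_le_of_second_deriv (fun σ hσ => h.diff _ (hne σ hσ))
    (fun σ hσ => h.diff_two _ (hne σ hσ)) fun σ hσ => ?_
  rw [le_div_iff₀ (by positivity), mul_comm]
  exact h.bound_two z hz e he _ (hn σ hσ)

/-- The second difference of the kernel, weighted by Jacobians. -/
theorem DerivBound.weighted_second_difference_le (h : DerivBound K Kstar)
    {z e : EuclideanSpace ℝ (Fin n)} (hz : z ≠ 0) (he : ‖e‖ = 1) (hK : 0 ≤ K z)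
    {t s a b δ : ℝ} (ht : 0 ≤ t) (ha : |a| ≤ s) (hb : |b| ≤ s) (hδ : |δ| ≤ s * ‖z‖)
    (hts : t * s ≤ 1 / 2) :
    (1 + t * a) * (1 + t * b) * K (z + (t * δ) • e) +
      (1 - t * a) * (1 - t * b) * K (z - (t * δ) • e) ≤
      2 * K z + t ^ 2 * s ^ 2 * (2 * K z + 10 * Kstar z) := by
  have hz' : 0 < ‖z‖ := norm_pos_iff.2 hz
  have hs : 0 ≤ s := (abs_nonneg a).trans ha
  have hstar : 0 ≤ Kstar z := le_trans (by positivity) (h.bound_one z hz e he)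
  have htδ : |t * δ| ≤ t * s * ‖z‖ := by
    rw [abs_mul, abs_of_nonneg ht, mul_assoc]; gcongr
  have hτ : |t * δ| ≤ ‖z‖ / 2 := htδ.trans (by nlinarith)
  set τ := t * δ
  have hsq : Kstar z / ‖z‖ ^ 2 * τ ^ 2 ≤ t ^ 2 * s ^ 2 * Kstar z := by
    have : τ ^ 2 ≤ (t * s * ‖z‖) ^ 2 := by rw [← sq_abs τ]; gcongr
    calc Kstar z / ‖z‖ ^ 2 * τ ^ 2 ≤ Kstar z / ‖z‖ ^ 2 * (t * s * ‖z‖) ^ 2 := by gcongr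
      _ = _ := by field_simp
  have e1 := (h.abs_taylor_le hz he hτ).trans hsq
  have e2 := h.abs_taylor_le hz he (τ := -τ) (by rwa [abs_neg])
  rw [neg_smul, ← sub_eq_add_neg, neg_sq, neg_mul, sub_neg_eq_add] at e2
  replace e2 := e2.trans hsq
  have e3 : |τ * fderiv ℝ K z e| ≤ t * s * Kstar z := by
    have := h.bound_one z hz e he
    calc |τ * fderiv ℝ K z e| = |τ| * |fderiv ℝ K z e| := abs_mul _ _
      _ ≤ t * s * ‖z‖ * |fderiv ℝ K z e| := by gcongr
      _ = t * s * (‖z‖ * |fderiv ℝ K z e|) := by ring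
      _ ≤ _ := by gcongr
  set x := K (z + τ • e)
  set y := K (z - τ • e)
  set D := τ * fderiv ℝ K z e
  set k := K z
  set q := Kstar z
  set w := t * s with hw
  have hw0 : 0 ≤ w := by positivity
  have hq : t ^ 2 * s ^ 2 * q = w ^ 2 * q := by rw [hw]; ring
  rw [hq] at e1 e2
  -- The left side equals `(1 + t²ab)(x + y) + t(a + b)(x - y)`. Here `x + y` is `2k` up to `O(w²
  -- q)`, and the odd part is a product of two quantities of order `w`. No first-order term
  -- survives.
  have hxy : x + y ≤ 2 * k + 2 * (w ^ 2 * q) := by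
    have := abs_le.1 e1; have := abs_le.1 e2; linarith
  have hxy' : |x - y| ≤ 3 * (w * q) := by
    have h1 := abs_le.1 e1; have h2 := abs_le.1 e2; have h3 := abs_le.1 e3
    have h4 : w ^ 2 * q ≤ 1 / 2 * (w * q) := by
      have : 0 ≤ w * q := by positivity
      nlinarith
    rw [abs_le]; constructor <;> linarith
  have hab : |t * a * (t * b)| ≤ w ^ 2 := by
    rw [abs_mul, abs_mul, abs_mul, abs_of_nonneg ht, sq]
    gcongr
    · exact mul_le_mul_of_nonneg_left ha ht
    · exact mul_le_mul_of_nonneg_left hb ht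
  have hab' : |t * a + t * b| ≤ 2 * w := by
    rw [← mul_add, abs_mul, abs_of_nonneg ht, hw]
    have := abs_add_le a b
    nlinarith
  have hw2 : w ^ 2 ≤ 1 / 4 := by nlinarith
  have p1 : (t * a + t * b) * (x - y) ≤ 2 * w * (3 * (w * q)) :=
    (le_abs_self _).trans (by rw [abs_mul]; gcongr)
  have p2 : (1 + t * a * (t * b)) * (x + y) ≤
      (1 + t * a * (t * b)) * (2 * k + 2 * (w ^ 2 * q)) := by
    have := abs_le.1 hab
    gcongr
    linarith
  have p3 : (t * a * (t * b)) * (2 * k + 2 * (w ^ 2 * q)) ≤ w ^ 2 * (2 * k + 2 * (w ^ 2 * q)) := by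
    have := abs_le.1 hab
    gcongr
    exact this.2
  have p4 : w ^ 2 * (w ^ 2 * q) ≤ 1 / 4 * (w ^ 2 * q) := by gcongr
  have p5 : 0 ≤ w ^ 2 * q := by positivity
  have e4 : t ^ 2 * s ^ 2 * (2 * k + 10 * q) = 2 * (w ^ 2 * k) + 10 * (w ^ 2 * q) := by
    rw [hw]; ring
  rw [e4]
  nlinarith

theorem AdmissibleKernel.measurable (hK : AdmissibleKernel K) : Measurable K := by
  obtain ⟨Ks, -, hd⟩ := hK.deriv_bound
  refine measurable_of_continuousOn_compl_singleton 0 fun z hz => ?_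
  exact (hd.diff z hz).continuousAt.continuousWithinAt

theorem exists_forall_norm_gt_eq_zero (hc : HasCompactSupport K) :
    ∃ ρ : ℝ, 1 ≤ ρ ∧ ∀ z, ρ < ‖z‖ → K z = 0 := by
  obtain ⟨ρ, hρ⟩ := hc.isCompact.isBounded.subset_closedBall 0
  refine ⟨max ρ 1, le_max_right _ _, fun z hz => ?_⟩
  by_contra h
  have := hρ (subset_tsupport K h)
  rw [mem_closedBall_zero_iff] at this
  exact absurd ((le_max_left _ _).trans_lt hz) (not_lt.2 this)

/-- On the support of `K`, contained in a ball of radius `ρ ≥ 1`, one has `‖z‖ ≤ ρ min 1 ‖z‖`. This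
first moment is what makes the energy of a ball finite. -/
theorem AdmissibleKernel.lintegral_mul_norm_ne_top (hK : AdmissibleKernel K)
    (hc : HasCompactSupport K) :
    ∫⁻ z, ENNReal.ofReal (K z) * ENNReal.ofReal ‖z‖ ≠ ∞ := by
  obtain ⟨ρ, hρ, hz⟩ := exists_forall_norm_gt_eq_zero hc
  have h1 : ∫⁻ z, ENNReal.ofReal (K z * min 1 ‖z‖) ≠ ∞ := hK.integrable.lintegral_lt_top.ne
  have h2 : ∫⁻ z, ENNReal.ofReal ρ * ENNReal.ofReal (K z * min 1 ‖z‖) ≠ ∞ := by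
    rw [lintegral_const_mul' _ _ ENNReal.ofReal_ne_top]
    exact ENNReal.mul_ne_top ENNReal.ofReal_ne_top h1
  refine ne_top_of_le_ne_top h2 (lintegral_mono fun z => ?_)
  rcases lt_or_ge ρ ‖z‖ with h | h
  · simp [hz z h]
  rcases eq_or_ne z 0 with rfl | h0
  · simp
  have hKz := hK.nonneg z h0
  rw [← ENNReal.ofReal_mul hKz, ← ENNReal.ofReal_mul (by linarith)]
  refine ENNReal.ofReal_le_ofReal ?_
  have : ‖z‖ ≤ ρ * min 1 ‖z‖ := by
    rcases le_total 1 ‖z‖ with h' | h'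
    · rw [min_eq_left h']; linarith
    · rw [min_eq_right h']; nlinarith [norm_nonneg z]
  nlinarith

/-- The three forms of the majorant are unified as a multiple of `K` plus a locally integrable `f`:
zero, an indicator, or a measurable representative of `Kstar`. The last choice is why the bound is
only almost everywhere. -/
theorem AdmissibleMajorant.exists_le (hK : AdmissibleKernel K) (hd : DerivBound K Kstar)
    (h : AdmissibleMajorant K Kstar) (ρ : ℝ) :
    ∃ (c : ℝ) (f : EuclideanSpace ℝ (Fin n) → ℝ≥0∞), 0 ≤ c ∧ Measurable f ∧
      ∫⁻ z in Metric.closedBall 0 ρ, f z ≠ ∞ ∧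
      ∀ᵐ z, z ≠ 0 → ENNReal.ofReal (2 * K z + 10 * Kstar z) ≤
        ENNReal.ofReal c * (ENNReal.ofReal (K z) + f z) := by
  rcases h with ⟨C₁, h⟩ | ⟨C₁, R₀, -, h⟩ | h
  · refine ⟨2 + 10 * |C₁|, 0, by positivity, measurable_zero, by simp, .of_forall fun z hz => ?_⟩
    have hKz := hK.nonneg z hz
    rw [Pi.zero_apply, add_zero, ← ENNReal.ofReal_mul (by positivity), h]
    refine ENNReal.ofReal_le_ofReal ?_
    nlinarith [le_abs_self C₁]
  · refine ⟨2 + 10 * |C₁|, fun z => ENNReal.ofReal ((Metric.ball 0 R₀).indicator (fun _ => 1) z),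
      by positivity, (measurable_const.indicator measurableSet_ball).ennreal_ofReal, ?_,
      .of_forall fun z hz => ?_⟩
    · have : ∫⁻ _ in Metric.closedBall (0 : EuclideanSpace ℝ (Fin n)) ρ, (1 : ℝ≥0∞) ≠ ∞ := by
        rw [setLIntegral_const, one_mul]; exact measure_closedBall_lt_top.ne
      refine ne_top_of_le_ne_top this (lintegral_mono fun z => ?_)
      by_cases hz : z ∈ Metric.ball (0 : EuclideanSpace ℝ (Fin n)) R₀ <;> simp [Set.indicator, hz]
    · have hKz := hK.nonneg z hz
      have hi : 0 ≤ (Metric.ball (0 : EuclideanSpace ℝ (Fin n)) R₀).indicator (fun _ => (1 : ℝ)) z :=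
        Set.indicator_nonneg (fun _ _ => zero_le_one) z
      simp only
      rw [← ENNReal.ofReal_add hKz hi, ← ENNReal.ofReal_mul (by positivity), h]
      refine ENNReal.ofReal_le_ofReal ?_
      have := mul_le_mul_of_nonneg_right (le_abs_self C₁) (add_nonneg hKz hi)
      nlinarith
  · refine ⟨10, fun z => ENNReal.ofReal (h.1.mk Kstar z), by norm_num,
      h.1.stronglyMeasurable_mk.measurable.ennreal_ofReal, ?_, ?_⟩
    · refine (lt_of_le_of_lt (setLIntegral_le_lintegral _ _)
        (h.congr h.1.ae_eq_mk).lintegral_lt_top).ne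
    · filter_upwards [h.1.ae_eq_mk] with z hz hz0
      have hKz := hK.nonneg z hz0
      rw [← hz, ← ENNReal.ofReal_add hKz, ← ENNReal.ofReal_mul (by norm_num)]
      · exact ENNReal.ofReal_le_ofReal (by linarith)
      · by_contra hneg
        push Not at hneg
        rcases isEmpty_or_nonempty (Fin n) with hn | ⟨⟨i⟩⟩
        · exact hz0 (Subsingleton.elim _ _)
        · have := hd.bound_one z hz0 (EuclideanSpace.single i 1) (by simp)
          have h3 : 0 ≤ ‖z‖ * |fderiv ℝ K z (EuclideanSpace.single i 1)| := by positivity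
          linarith

/-- The majorant of the weighted second differences of the kernel: up to a constant it is the
kernel plus an integrable kernel of bounded support. -/
theorem AdmissibleKernel.exists_majorant (hK : AdmissibleKernel K) (hc : HasCompactSupport K) :
    ∃ (ρ c : ℝ) (k₂ : EuclideanSpace ℝ (Fin n) → ℝ≥0∞), 0 ≤ ρ ∧ 0 ≤ c ∧ Measurable k₂ ∧
      (∀ z, k₂ (-z) = k₂ z) ∧ (∀ z, ρ < ‖z‖ → k₂ z = 0) ∧ ∫⁻ z, k₂ z ≠ ∞ ∧
      ∀ᵐ z, z ≠ 0 → ∀ e, ‖e‖ = 1 → ∀ t s a b δ : ℝ, 0 ≤ t → |a| ≤ s → |b| ≤ s → |δ| ≤ s * ‖z‖ →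
        t * s ≤ 1 / 2 →
        ENNReal.ofReal ((1 + t * a) * (1 + t * b)) * ENNReal.ofReal (K (z + (t * δ) • e)) +
          ENNReal.ofReal ((1 - t * a) * (1 - t * b)) * ENNReal.ofReal (K (z - (t * δ) • e)) ≤
          2 * ENNReal.ofReal (K z) +
            ENNReal.ofReal (c * t ^ 2 * s ^ 2) * (ENNReal.ofReal (K z) + k₂ z) := by
  obtain ⟨ρ, hρ, hKρ⟩ := exists_forall_norm_gt_eq_zero hc
  obtain ⟨Ks, hmaj, hd⟩ := hK.deriv_bound
  obtain ⟨c, f, hc0, hf, hfi, hfm⟩ := hmaj.exists_le hK hd (2 * ρ)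
  -- Shifts move `z` by at most `‖z‖ / 2`, so for `‖z‖ > 2ρ` both shifted values of `K` vanish and
  -- the majorant can be truncated.
  set g := (Metric.closedBall 0 (2 * ρ)).indicator f with hg
  have hgm : Measurable g := hf.indicator measurableSet_closedBall
  have hgi : ∫⁻ z, g z ≠ ∞ := by rwa [hg, lintegral_indicator measurableSet_closedBall]
  have hg0 : ∀ z, 2 * ρ < ‖z‖ → g z = 0 := fun z hz =>
    Set.indicator_of_notMem (by simpa using hz) _
  -- Adding the reflection makes the additional kernel even, which the later exchange of the two
  -- points requires.
  refine ⟨2 * ρ, c, fun z => g z + g (-z), by linarith, hc0, hgm.add (hgm.comp measurable_neg),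
    fun z => by simp only [neg_neg, add_comm], fun z hz => by simp [hg0 z hz, hg0 (-z) (by simpa using hz)],
    ?_, ?_⟩
  · rw [lintegral_add_left hgm, lintegral_neg_eq_self]
    exact ENNReal.add_ne_top.2 ⟨hgi, hgi⟩
  filter_upwards [hfm] with z hfz hz e he t s a b δ ht ha hb hδ hts
  have hz' : 0 < ‖z‖ := norm_pos_iff.2 hz
  have hs : 0 ≤ s := (abs_nonneg a).trans ha
  have htδ : |t * δ| ≤ ‖z‖ / 2 := by
    rw [abs_mul, abs_of_nonneg ht]
    calc t * |δ| ≤ t * (s * ‖z‖) := by gcongr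
      _ = t * s * ‖z‖ := by ring
      _ ≤ 1 / 2 * ‖z‖ := by gcongr
      _ = _ := by ring
  have hn : ‖(t * δ) • e‖ ≤ ‖z‖ / 2 := by rwa [norm_smul, he, mul_one]
  have hp : ‖z‖ / 2 ≤ ‖z + (t * δ) • e‖ := by
    have := norm_sub_le (z + (t * δ) • e) ((t * δ) • e)
    rw [add_sub_cancel_right] at this; linarith
  have hm : ‖z‖ / 2 ≤ ‖z - (t * δ) • e‖ := by
    have := norm_add_le (z - (t * δ) • e) ((t * δ) • e)
    rw [sub_add_cancel] at this; linarith
  rcases lt_or_ge (2 * ρ) ‖z‖ with hlt | hge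
  · rw [hKρ _ (by linarith : ρ < ‖z + (t * δ) • e‖), hKρ _ (by linarith : ρ < ‖z - (t * δ) • e‖)]
    simp
  have hKp := hK.nonneg (z + (t * δ) • e) (norm_pos_iff.1 (by linarith))
  have hKm := hK.nonneg (z - (t * δ) • e) (norm_pos_iff.1 (by linarith))
  have hKz := hK.nonneg z hz
  have hta : |t * a| ≤ 1 / 2 := by
    rw [abs_mul, abs_of_nonneg ht]; exact (mul_le_mul_of_nonneg_left ha ht).trans hts
  have htb : |t * b| ≤ 1 / 2 := by
    rw [abs_mul, abs_of_nonneg ht]; exact (mul_le_mul_of_nonneg_left hb ht).trans hts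
  have hta' := abs_le.1 hta
  have htb' := abs_le.1 htb
  have hstar : 0 ≤ Ks z := le_trans (by positivity) (hd.bound_one z hz e he)
  have i1 : 0 ≤ (1 + t * a) * (1 + t * b) := mul_nonneg (by linarith) (by linarith)
  have i2 : 0 ≤ (1 - t * a) * (1 - t * b) := mul_nonneg (by linarith) (by linarith)
  have hgz : g z = f z := Set.indicator_of_mem (by simpa using hge) _
  rw [← ENNReal.ofReal_mul i1, ← ENNReal.ofReal_mul i2,
    ← ENNReal.ofReal_add (mul_nonneg i1 hKp) (mul_nonneg i2 hKm)]
  refine (ENNReal.ofReal_le_ofReal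
    (hd.weighted_second_difference_le hz he hKz ht ha hb hδ hts)).trans ?_
  rw [ENNReal.ofReal_add (by positivity) (by positivity), ENNReal.ofReal_mul zero_le_two,
    ENNReal.ofReal_ofNat]
  refine add_le_add le_rfl ?_
  have hq : c * t ^ 2 * s ^ 2 = t ^ 2 * s ^ 2 * c := by ring
  have h0 : 0 ≤ t ^ 2 * s ^ 2 := by positivity
  rw [hq, ENNReal.ofReal_mul h0, ENNReal.ofReal_mul h0, mul_assoc]
  refine mul_le_mul_right ((hfz hz).trans ?_) _
  rw [← hgz]
  gcongr
  exact le_self_add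

end Kernel

/-! ### Deformations and the second variation -/

section Deform

variable {V : Type*} [NormedAddCommGroup V] [InnerProductSpace ℝ V] [FiniteDimensional ℝ V]
  [MeasurableSpace V] [BorelSpace V]

/-- The deformation moving points in direction `e` by the amount `t φ`. -/
def deform (φ : V → ℝ) (e : V) (t : ℝ) (x : V) : V := x + (t * φ x) • e

variable {φ : V → ℝ} {e : V} {t σ₀ : ℝ}

theorem deform_sub_deform (x y : V) :
    deform φ e t x - deform φ e t y = (x - y) + (t * (φ x - φ y)) • e := by
  simp only [deform]
  module

/-- The displacement is Lipschitz with constant at most `1/2`, so it cannot cancel `x - y` unless `x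
= y`. -/
theorem deform_injective (he : ‖e‖ = 1) (hL : ∀ x y, |φ x - φ y| ≤ σ₀ * ‖x - y‖)
    (ht : |t| * σ₀ ≤ 1 / 2) : Function.Injective (deform φ e t) := by
  intro x y hxy
  rw [← sub_eq_zero, deform_sub_deform] at hxy
  have h1 : x - y = -((t * (φ x - φ y)) • e) := eq_neg_of_add_eq_zero_left hxy
  have h2 : ‖x - y‖ ≤ 1 / 2 * ‖x - y‖ := by
    calc ‖x - y‖ = |t| * |φ x - φ y| := by
          conv_lhs => rw [h1, norm_neg, norm_smul, he, mul_one, Real.norm_eq_abs, abs_mul]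
      _ ≤ |t| * (σ₀ * ‖x - y‖) := by gcongr; exact hL x y
      _ = |t| * σ₀ * ‖x - y‖ := by ring
      _ ≤ _ := by gcongr
  exact sub_eq_zero.1 (norm_eq_zero.1 (by linarith [norm_nonneg (x - y)]))

/-- Each line in direction `e` is preserved. A preimage `y - τ e` solves `τ = t φ(y - τ e)`, and
boundedness of `φ` gives a sign change for the intermediate value theorem. -/
theorem deform_surjective (hφ : Continuous φ) (hb : ∀ x, |φ x| ≤ 1) :
    Function.Surjective (deform φ e t) := by
  intro y
  have hc : Continuous fun τ : ℝ => τ - t * φ (y - τ • e) := by fun_prop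
  have hb' : ∀ τ : ℝ, |t * φ (y - τ • e)| ≤ |t| := fun τ => by
    rw [abs_mul]; exact mul_le_of_le_one_right (abs_nonneg t) (hb _)
  have h0 : (0 : ℝ) ∈ Set.Icc ((fun τ : ℝ => τ - t * φ (y - τ • e)) (-|t|))
      ((fun τ : ℝ => τ - t * φ (y - τ • e)) |t|) := by
    constructor
    · have := abs_le.1 (hb' (-|t|)); simp only; linarith
    · have := abs_le.1 (hb' |t|); simp only; linarith
  obtain ⟨τ, -, hτ⟩ := intermediate_value_Icc (neg_le_self (abs_nonneg t)) hc.continuousOn h0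
  refine ⟨y - τ • e, ?_⟩
  simp only [sub_eq_zero] at hτ
  rw [deform, ← hτ, sub_add_cancel]

theorem hasFDerivAt_deform (hφ : ContDiff ℝ 1 φ) (x : V) :
    HasFDerivAt (deform φ e t)
      (ContinuousLinearMap.id ℝ V + (t • fderiv ℝ φ x).smulRight e) x := by
  have h := (hφ.differentiable one_ne_zero x).hasFDerivAt
  exact (hasFDerivAt_id x).add ((h.const_mul t).smul_const e)

theorem det_id_add_smulRight (f : V →L[ℝ] ℝ) (e : V) :
    (ContinuousLinearMap.id ℝ V + f.smulRight e).det = 1 + f e :=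
  LinearMap.transvection.det (f : V →ₗ[ℝ] ℝ) e

theorem abs_fderiv_apply_le (he : ‖e‖ = 1) (hσ₀ : 0 ≤ σ₀) (hL : ∀ x y, |φ x - φ y| ≤ σ₀ * ‖x - y‖)
    (x : V) : |fderiv ℝ φ x e| ≤ σ₀ := by
  have hl : LipschitzWith ⟨σ₀, hσ₀⟩ φ := LipschitzWith.of_dist_le_mul fun x y => by
    rw [Real.dist_eq, dist_eq_norm]; exact hL x y
  have h := norm_fderiv_le_of_lipschitz ℝ hl (x₀ := x)
  have h2 := (fderiv ℝ φ x).le_opNorm e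
  rw [he, mul_one] at h2
  exact h2.trans h

/-- The derivative is a rank-one perturbation of the identity, with determinant `1 + t ∂ₑφ`,
positive for the allowed `t`. -/
theorem lintegral_deform (he : ‖e‖ = 1) (hσ₀ : 0 ≤ σ₀) (hφ : ContDiff ℝ 1 φ)
    (hL : ∀ x y, |φ x - φ y| ≤ σ₀ * ‖x - y‖) (hb : ∀ x, |φ x| ≤ 1) (ht : |t| * σ₀ ≤ 1 / 2)
    (g : V → ℝ≥0∞) :
    ∫⁻ y, g y = ∫⁻ x, ENNReal.ofReal (1 + t * fderiv ℝ φ x e) * g (deform φ e t x) := by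
  have h := lintegral_image_eq_lintegral_abs_det_fderiv_mul (volume : Measure V) MeasurableSet.univ
    (fun x _ => (hasFDerivAt_deform (t := t) (e := e) hφ x).hasFDerivWithinAt)
    (deform_injective he hL ht).injOn g
  rw [Set.image_univ, (deform_surjective hφ.continuous hb).range_eq, Measure.restrict_univ] at h
  rw [h]
  refine lintegral_congr fun x => ?_
  congr 2
  rw [det_id_add_smulRight, smul_apply, smul_eq_mul, abs_of_nonneg]
  have h1 := abs_fderiv_apply_le he hσ₀ hL x
  have h2 : |t * fderiv ℝ φ x e| ≤ 1 / 2 := by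
    rw [abs_mul]; exact (mul_le_mul_of_nonneg_left h1 (abs_nonneg t)).trans ht
  linarith [(abs_le.1 h2).1]

theorem deform_image_diff {Ω : Set V} (he : ‖e‖ = 1)
    (hL : ∀ x y, |φ x - φ y| ≤ σ₀ * ‖x - y‖) (ht : |t| * σ₀ ≤ 1 / 2) (hΩ : ∀ x ∉ Ω, φ x = 0)
    (E : Set V) : deform φ e t '' E \ Ω = E \ Ω := by
  have hfix : ∀ x ∉ Ω, deform φ e t x = x := fun x hx => by simp [deform, hΩ x hx]
  ext x
  refine and_congr_left fun hx => ?_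
  rw [← (deform_injective he hL ht).mem_set_image (s := E) (a := x), hfix x hx]

/-- The deformation is bijective and fixes every point outside `Ω`, hence preserves `Ω`. Cut pairs
thus correspond to cut pairs, and changing both variables transfers the deformation to the kernel
and two Jacobians. -/
theorem pairMeasure_cutPairs_deform {k : V → ℝ≥0∞} (hk : Measurable k) {Ω E : Set V}
    (hΩm : MeasurableSet Ω) (hE : MeasurableSet E) (he : ‖e‖ = 1) (hσ₀ : 0 ≤ σ₀)
    (hφ : ContDiff ℝ 1 φ) (hL : ∀ x y, |φ x - φ y| ≤ σ₀ * ‖x - y‖) (hb : ∀ x, |φ x| ≤ 1)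
    (ht : |t| * σ₀ ≤ 1 / 2) (hΩ : ∀ x ∉ Ω, φ x = 0) :
    MeasurableSet (deform φ e t '' E) ∧
    pairMeasure k (cutPairs Ω (deform φ e t '' E)) =
      ∫⁻ x, ∫⁻ y, (cutPairs Ω E).indicator 1 (x, y) *
        (ENNReal.ofReal ((1 + t * fderiv ℝ φ x e) * (1 + t * fderiv ℝ φ y e)) *
          k ((x - y) + (t * (φ x - φ y)) • e)) := by
  have hinj := deform_injective he hL ht
  have hcont : Continuous (deform φ e t) := by
    have := hφ.continuous
    unfold deform; fun_prop
  have hmE : MeasurableSet (deform φ e t '' E) :=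
    hE.image_of_continuousOn_injOn hcont.continuousOn hinj.injOn
  refine ⟨hmE, ?_⟩
  rw [pairMeasure_eq_lintegral hk (measurableSet_cutPairs hΩm hmE),
    lintegral_deform he hσ₀ hφ hL hb ht]
  refine lintegral_congr fun x => ?_
  rw [lintegral_deform he hσ₀ hφ hL hb ht, ← lintegral_const_mul' _ _ ENNReal.ofReal_ne_top]
  refine lintegral_congr fun y => ?_
  have hmemE : ∀ x, deform φ e t x ∈ deform φ e t '' E ↔ x ∈ E := fun x => hinj.mem_set_image
  have hmemΩ : ∀ x, deform φ e t x ∈ Ω ↔ x ∈ Ω := fun x => by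
    have hfix : ∀ x ∉ Ω, deform φ e t x = x := fun x hx => by simp [deform, hΩ x hx]
    constructor
    · intro h; by_contra hx; rw [hfix x hx] at h; exact hx h
    · intro h; by_contra hx
      have := hinj (hfix _ hx)
      rw [this] at hx; exact hx h
  have hind : (cutPairs Ω (deform φ e t '' E)).indicator (1 : V × V → ℝ≥0∞)
      (deform φ e t x, deform φ e t y) = (cutPairs Ω E).indicator 1 (x, y) := by
    have : (deform φ e t x, deform φ e t y) ∈ cutPairs Ω (deform φ e t '' E) ↔
        (x, y) ∈ cutPairs Ω E := by
      simp only [cutPairs, Set.mem_ofPred_eq, hmemE, hmemΩ]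
    by_cases h : (x, y) ∈ cutPairs Ω E
    · rw [Set.indicator_of_mem h, Set.indicator_of_mem (this.2 h)]; rfl
    · rw [Set.indicator_of_notMem h, Set.indicator_of_notMem (fun h' => h (this.1 h'))]
  have h1 := abs_fderiv_apply_le he hσ₀ hL x
  have h2 : |t * fderiv ℝ φ x e| ≤ 1 / 2 := by
    rw [abs_mul]; exact (mul_le_mul_of_nonneg_left h1 (abs_nonneg t)).trans ht
  rw [hind, deform_sub_deform, ENNReal.ofReal_mul (by linarith [(abs_le.1 h2).1])]
  ring

/-- The kernel inequality behind the second variation. -/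
def SecondDifferenceBound (k G : V → ℝ≥0∞) (c : ℝ) : Prop :=
  ∀ᵐ z, z ≠ 0 → ∀ e : V, ‖e‖ = 1 → ∀ t s a b δ : ℝ, 0 ≤ t → |a| ≤ s → |b| ≤ s →
    |δ| ≤ s * ‖z‖ → t * s ≤ 1 / 2 →
    ENNReal.ofReal ((1 + t * a) * (1 + t * b)) * k (z + (t * δ) • e) +
      ENNReal.ofReal ((1 - t * a) * (1 - t * b)) * k (z - (t * δ) • e) ≤
      2 * k z + ENNReal.ofReal (c * t ^ 2 * s ^ 2) * G z

/-- The density of the interaction energy across the boundary of `E`. -/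
noncomputable def sepDensity (G : V → ℝ≥0∞) (E : Set V) (x : V) : ℝ≥0∞ :=
  ∫⁻ y, (sepPairs Set.univ E).indicator 1 (x, y) * G (x - y)

theorem measurable_sepDensity {G : V → ℝ≥0∞} (hG : Measurable G) {E : Set V}
    (hE : MeasurableSet E) : Measurable (sepDensity G E) := by
  have : Measurable fun p : V × V => (sepPairs Set.univ E).indicator (1 : V × V → ℝ≥0∞) p *
      G (p.1 - p.2) :=
    (measurable_one.indicator (measurableSet_sepPairs .univ hE)).mul (by fun_prop)
  exact this.lintegral_prod_right'

theorem setLIntegral_sepDensity {G : V → ℝ≥0∞} (hG : Measurable G) {A E : Set V}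
    (hA : MeasurableSet A) (hE : MeasurableSet E) :
    ∫⁻ x in A, sepDensity G E x = pairMeasure G (sepPairs A E) := by
  rw [pairMeasure_eq_lintegral hG (measurableSet_sepPairs hA hE), ← lintegral_indicator hA]
  refine lintegral_congr fun x => ?_
  by_cases hx : x ∈ A
  · rw [Set.indicator_of_mem hx, sepDensity]
    refine lintegral_congr fun y => ?_
    congr 1
    by_cases h : x ∈ E <;> by_cases h' : y ∈ E <;> simp [Set.indicator, sepPairs, hx, h, h']
  · rw [Set.indicator_of_notMem hx]
    simp [Set.indicator, sepPairs, hx]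

/-- After pulling both deformed energies back to the cut pairs of `E`, the kernel inequality applies
pair by pair with `s = σ x + σ y`. Then `(σ x + σ y)² ≤ 2(σ x² + σ y²)` separates the variables.
Keeping `σ` as a function, rather than a global bound, is what lets the logarithmic cutoff help. -/
theorem second_variation_le {k G : V → ℝ≥0∞} (hk : Measurable k) (hG : Measurable G)
    (hGe : ∀ z, G (-z) = G z) {c : ℝ} (hc : 0 ≤ c) (hkG : SecondDifferenceBound k G c)
    {Ω E : Set V} (hΩm : MeasurableSet Ω) (hE : MeasurableSet E) (he : ‖e‖ = 1) (hσ₀ : 0 ≤ σ₀)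
    (hφ : ContDiff ℝ 1 φ) (hL : ∀ x y, |φ x - φ y| ≤ σ₀ * ‖x - y‖) (hb : ∀ x, |φ x| ≤ 1)
    (ht0 : 0 ≤ t) (ht : t * σ₀ ≤ 1 / 2) (hΩ : ∀ x ∉ Ω, φ x = 0) {σ : V → ℝ} (hσm : Measurable σ)
    (hσ : ∀ x, 0 ≤ σ x) (hσt : ∀ x y, t * (σ x + σ y) ≤ 1 / 2)
    (hσL : ∀ x y, |φ x - φ y| ≤ (σ x + σ y) * ‖x - y‖) (hσd : ∀ x, |fderiv ℝ φ x e| ≤ σ x) :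
    pairMeasure k (cutPairs Ω (deform φ e t '' E)) +
        pairMeasure k (cutPairs Ω (deform φ e (-t) '' E)) ≤
      2 * pairMeasure k (cutPairs Ω E) +
        ENNReal.ofReal (2 * c * t ^ 2) * ∫⁻ x, ENNReal.ofReal (σ x ^ 2) * sepDensity G E x := by
  have ht' : |t| * σ₀ ≤ 1 / 2 := by rwa [abs_of_nonneg ht0]
  have ht'' : |-t| * σ₀ ≤ 1 / 2 := by rwa [abs_neg]
  rw [(pairMeasure_cutPairs_deform hk hΩm hE he hσ₀ hφ hL hb ht' hΩ).2,
    (pairMeasure_cutPairs_deform hk hΩm hE he hσ₀ hφ hL hb ht'' hΩ).2,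
    pairMeasure_eq_lintegral hk (measurableSet_cutPairs hΩm hE)]
  have mc := measurableSet_cutPairs hΩm hE
  have mI : Measurable ((cutPairs Ω E).indicator (1 : V × V → ℝ≥0∞)) := measurable_one.indicator mc
  have mφ : Measurable φ := hφ.continuous.measurable
  have mdφ : Measurable fun x => fderiv ℝ φ x e :=
    (((hφ.continuous_fderiv one_ne_zero).clm_apply continuous_const)).measurable
  set T : V × V → ℝ≥0∞ := fun p => (cutPairs Ω E).indicator 1 p *
    (ENNReal.ofReal ((1 + t * fderiv ℝ φ p.1 e) * (1 + t * fderiv ℝ φ p.2 e)) *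
      k ((p.1 - p.2) + (t * (φ p.1 - φ p.2)) • e)) with hT
  have mT : Measurable T := by
    have m1 : Measurable fun p : V × V => (p.1 - p.2) + (t * (φ p.1 - φ p.2)) • e := by fun_prop
    have m2 : Measurable fun p : V × V =>
        (1 + t * fderiv ℝ φ p.1 e) * (1 + t * fderiv ℝ φ p.2 e) :=
      ((measurable_const.add ((mdφ.comp measurable_fst).const_mul t))).mul
        (measurable_const.add ((mdφ.comp measurable_snd).const_mul t))
    exact mI.mul (m2.ennreal_ofReal.mul (hk.comp m1))
  set Q : V × V → ℝ≥0∞ := fun p => (cutPairs Ω E).indicator 1 p * k (p.1 - p.2) with hQ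
  have mQ : Measurable Q := mI.mul (by fun_prop)
  set W : V × V → ℝ≥0∞ := fun p => (cutPairs Ω E).indicator 1 p *
    (ENNReal.ofReal (σ p.1 ^ 2) * G (p.1 - p.2)) with hW
  set W' : V × V → ℝ≥0∞ := fun p => (cutPairs Ω E).indicator 1 p *
    (ENNReal.ofReal (σ p.2 ^ 2) * G (p.1 - p.2)) with hW'
  have mW : Measurable W :=
    mI.mul (((hσm.comp measurable_fst).pow_const 2).ennreal_ofReal.mul (by fun_prop))
  have mW' : Measurable W' :=
    mI.mul (((hσm.comp measurable_snd).pow_const 2).ennreal_ofReal.mul (by fun_prop))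
  have point : ∀ x, ∀ᵐ y, T (x, y) + (cutPairs Ω E).indicator 1 (x, y) *
        (ENNReal.ofReal ((1 + -t * fderiv ℝ φ x e) * (1 + -t * fderiv ℝ φ y e)) *
          k ((x - y) + (-t * (φ x - φ y)) • e)) ≤
      2 * Q (x, y) + ENNReal.ofReal (2 * c * t ^ 2) * (W (x, y) + W' (x, y)) := by
    intro x
    have hae := (quasiMeasurePreserving_sub_left (volume : Measure V) x).ae hkG
    filter_upwards [hae] with y hy
    by_cases hxy : (x, y) ∈ cutPairs Ω E
    swap
    · simp [hT, Set.indicator_of_notMem hxy]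
    have hne : x - y ≠ 0 := fun h0 => by
      rw [sub_eq_zero.1 h0] at hxy
      exact hxy.2.1 hxy.1
    have h1 := hy hne e he t (σ x + σ y) (fderiv ℝ φ x e) (fderiv ℝ φ y e) (φ x - φ y) ht0
      ((hσd x).trans (by linarith [hσ y])) ((hσd y).trans (by linarith [hσ x])) (hσL x y) (hσt x y)
    simp only [hT, hQ, hW, hW', Set.indicator_of_mem hxy, Pi.one_apply, one_mul]
    simp only [neg_mul, neg_smul, ← sub_eq_add_neg]
    refine h1.trans (add_le_add le_rfl ?_)
    rw [← add_mul, ← mul_assoc, ← ENNReal.ofReal_add (by positivity) (by positivity),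
      ← ENNReal.ofReal_mul (by positivity)]
    refine mul_le_mul_left (ENNReal.ofReal_le_ofReal ?_) _
    have := sq_nonneg (σ x - σ y)
    have h0 : 0 ≤ c * t ^ 2 := by positivity
    nlinarith
  have hsum : ∫⁻ x, ∫⁻ y, (W (x, y) + W' (x, y)) ≤
      ∫⁻ x, ENNReal.ofReal (σ x ^ 2) * sepDensity G E x := by
    -- Exchange the points in the second term so that both weights sit at `x`. At most one of `(x,
    -- y)` and `(y, x)` is a cut pair, and then `E` separates the two points, so `sepDensity` bounds
    -- the sum without doubling.
    have e1 : ∫⁻ x, ∫⁻ y, (W (x, y) + W' (x, y)) =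
        ∫⁻ x, ∫⁻ y, (W (x, y) + W' (y, x)) := by
      have a1 : ∀ x, ∫⁻ y, (W (x, y) + W' (x, y)) = (∫⁻ y, W (x, y)) + ∫⁻ y, W' (x, y) :=
        fun x => lintegral_add_left (mW.comp measurable_prodMk_left) _
      have a2 : ∀ x, ∫⁻ y, (W (x, y) + W' (y, x)) = (∫⁻ y, W (x, y)) + ∫⁻ y, W' (y, x) :=
        fun x => lintegral_add_left (mW.comp measurable_prodMk_left) _
      simp_rw [a1, a2]
      rw [lintegral_add_left mW.lintegral_prod_right', lintegral_add_left mW.lintegral_prod_right']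
      congr 1
      exact lintegral_lintegral_swap mW'.aemeasurable
    rw [e1]
    refine lintegral_mono fun x => ?_
    rw [sepDensity, ← lintegral_const_mul' _ _ ENNReal.ofReal_ne_top]
    refine lintegral_mono fun y => ?_
    simp only [hW, hW']
    rw [← hGe (y - x), neg_sub, ← add_mul, mul_left_comm]
    gcongr
    by_cases a1 : x ∈ E <;> by_cases a2 : y ∈ E <;> by_cases a3 : x ∈ Ω <;> by_cases a4 : y ∈ Ω <;>
      simp [cutPairs, sepPairs, Set.indicator, a1, a2, a3, a4]
  calc _ = ∫⁻ x, ((∫⁻ y, T (x, y)) + ∫⁻ y, (cutPairs Ω E).indicator 1 (x, y) *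
        (ENNReal.ofReal ((1 + -t * fderiv ℝ φ x e) * (1 + -t * fderiv ℝ φ y e)) *
          k ((x - y) + (-t * (φ x - φ y)) • e))) :=
        (lintegral_add_left mT.lintegral_prod_right' _).symm
    _ = ∫⁻ x, ∫⁻ y, (T (x, y) + (cutPairs Ω E).indicator 1 (x, y) *
        (ENNReal.ofReal ((1 + -t * fderiv ℝ φ x e) * (1 + -t * fderiv ℝ φ y e)) *
          k ((x - y) + (-t * (φ x - φ y)) • e))) :=
        lintegral_congr fun x => (lintegral_add_left (mT.comp measurable_prodMk_left) _).symm
    _ ≤ ∫⁻ x, ∫⁻ y, (2 * Q (x, y) + ENNReal.ofReal (2 * c * t ^ 2) * (W (x, y) + W' (x, y))) :=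
        lintegral_mono fun x => lintegral_mono_ae (point x)
    _ = ∫⁻ x, (2 * (∫⁻ y, Q (x, y)) +
          ENNReal.ofReal (2 * c * t ^ 2) * ∫⁻ y, (W (x, y) + W' (x, y))) := by
        refine lintegral_congr fun x => ?_
        rw [lintegral_add_left (by exact (mQ.comp measurable_prodMk_left).const_mul 2),
          lintegral_const_mul' _ _ (by simp), lintegral_const_mul' _ _ ENNReal.ofReal_ne_top]
    _ = 2 * (∫⁻ x, ∫⁻ y, Q (x, y)) +
          ENNReal.ofReal (2 * c * t ^ 2) * ∫⁻ x, ∫⁻ y, (W (x, y) + W' (x, y)) := by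
        rw [lintegral_add_left (mQ.lintegral_prod_right'.const_mul 2),
          lintegral_const_mul' _ _ (by simp), lintegral_const_mul' _ _ ENNReal.ofReal_ne_top]
    _ ≤ _ := by gcongr

/-- A kernel bounded below by one near the origin controls products of volumes in the unit ball. -/
theorem volume_mul_volume_le_pairMeasure {k : V → ℝ≥0∞} (h1 : ∀ z, z ≠ 0 → ‖z‖ < 2 → 1 ≤ k z)
    {A B : Set V} (hA : MeasurableSet A) (hB : MeasurableSet B) (hAB : Disjoint A B) :
    volume (A ∩ Metric.ball 0 1) * volume (B ∩ Metric.ball 0 1) ≤ pairMeasure k (A ×ˢ B) := by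
  have mA := hA.inter (measurableSet_ball (x := (0 : V)) (ε := 1))
  have mB := hB.inter (measurableSet_ball (x := (0 : V)) (ε := 1))
  refine le_trans ?_ (measure_mono (Set.prod_mono (Set.inter_subset_left (t := Metric.ball 0 1))
    (Set.inter_subset_left (t := Metric.ball 0 1))))
  rw [pairMeasure, withDensity_apply _ (mA.prod mB), ← Measure.prod_prod, ← setLIntegral_one]
  refine setLIntegral_mono' (mA.prod mB) ?_
  rintro ⟨x, y⟩ ⟨⟨hx, hx'⟩, ⟨hy, hy'⟩⟩
  refine h1 _ (fun h0 => ?_) ?_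
  · rw [sub_eq_zero] at h0
    simp only at h0 hx hy
    exact Set.disjoint_left.1 hAB hx (h0 ▸ hy)
  · have := norm_sub_le x y
    simp only [mem_ball_zero_iff] at hx' hy'
    simp only
    linarith

/-- Stability gives a bound for the product of the volumes gained and lost in a translation. -/
theorem PairMinimizer.volume_mul_volume_le {k G : V → ℝ≥0∞} (hk : Measurable k) (hG : Measurable G)
    (h1 : ∀ z, z ≠ 0 → ‖z‖ < 2 → 1 ≤ k z)
    (hGe : ∀ z, G (-z) = G z) {c : ℝ} (hc : 0 ≤ c) (hkG : SecondDifferenceBound k G c)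
    {Ω E : Set V} (hE : PairMinimizer (pairMeasure k) Ω E) (he : ‖e‖ = 1) (hσ₀ : 0 ≤ σ₀)
    (hφ : ContDiff ℝ 1 φ) (hL : ∀ x y, |φ x - φ y| ≤ σ₀ * ‖x - y‖) (hb : ∀ x, |φ x| ≤ 1)
    (ht0 : 0 ≤ t) (ht1 : t ≤ 1) (ht : t * σ₀ ≤ 1 / 2) (hΩ : ∀ x ∉ Ω, φ x = 0)
    (hφ1 : ∀ x, ‖x‖ ≤ 2 → φ x = 1) {σ : V → ℝ} (hσm : Measurable σ)
    (hσ : ∀ x, 0 ≤ σ x) (hσt : ∀ x y, t * (σ x + σ y) ≤ 1 / 2)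
    (hσL : ∀ x y, |φ x - φ y| ≤ (σ x + σ y) * ‖x - y‖) (hσd : ∀ x, |fderiv ℝ φ x e| ≤ σ x) :
    volume {x : V | ‖x‖ < 1 ∧ x ∉ E ∧ x - t • e ∈ E} *
        volume {x : V | ‖x‖ < 1 ∧ x ∈ E ∧ x - t • e ∉ E} ≤
      ENNReal.ofReal (2 * c * t ^ 2) * ∫⁻ x, ENNReal.ofReal (σ x ^ 2) * sepDensity G E x := by
  have ht' : |t| * σ₀ ≤ 1 / 2 := by rwa [abs_of_nonneg ht0]
  have ht'' : |-t| * σ₀ ≤ 1 / 2 := by rwa [abs_neg]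
  have mF := (pairMeasure_cutPairs_deform hk hE.measΩ hE.meas he hσ₀ hφ hL hb ht' hΩ).1
  have mF' := (pairMeasure_cutPairs_deform hk hE.measΩ hE.meas he hσ₀ hφ hL hb ht'' hΩ).1
  have gain := hE.gain_le mF mF' (deform_image_diff he hL ht' hΩ E)
    (deform_image_diff he hL ht'' hΩ E)
    (second_variation_le hk hG hGe hc hkG hE.measΩ hE.meas he hσ₀ hφ hL hb ht0 ht hΩ hσm hσ hσt
      hσL hσd)
  refine le_trans ?_ gain
  refine le_trans ?_ (volume_mul_volume_le_pairMeasure h1 (mF.diff hE.meas) (hE.meas.diff mF)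
    (Set.disjoint_left.2 fun x hx hx' => hx.2 hx'.1))
  -- Since `t ≤ 1`, the point `x - t e` lies in `B_2`, where `φ = 1`; inside the unit ball the
  -- deformed set is just the translate of `E`.
  have hmem : ∀ x : V, ‖x‖ < 1 → (x ∈ deform φ e t '' E ↔ x - t • e ∈ E) := fun x hx => by
    have hn : ‖x - t • e‖ ≤ 2 := by
      have := norm_sub_le x (t • e)
      rw [norm_smul, he, mul_one, Real.norm_of_nonneg ht0] at this
      linarith
    have hx' : deform φ e t (x - t • e) = x := by simp [deform, hφ1 _ hn]
    conv_lhs => rw [← hx']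
    exact (deform_injective he hL ht').mem_set_image
  gcongr
  · rintro x ⟨h1, h2, h3⟩
    exact ⟨⟨(hmem x h1).2 h3, h2⟩, by simpa using h1⟩
  · rintro x ⟨h1, h2, h3⟩
    exact ⟨⟨h2, fun h => h3 ((hmem x h1).1 h)⟩, by simpa using h1⟩

end Deform

/-! ### Averaged cutoffs at several scales -/

section Cutoff

variable {V : Type*} [NormedAddCommGroup V] [InnerProductSpace ℝ V] [FiniteDimensional ℝ V]
  [MeasurableSpace V] [BorelSpace V]

/-- The margin between `5/2` and `3` ensures that a cutoff rescaled by `r` vanishes in a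
neighbourhood of every point with `‖x‖ ≥ 3r`, so its derivative vanishes there too. -/
theorem exists_cutoff (V : Type*) [NormedAddCommGroup V] [InnerProductSpace ℝ V]
    [FiniteDimensional ℝ V] : ∃ (ψ : V → ℝ) (c₀ : ℝ), 1 ≤ c₀ ∧ ContDiff ℝ 1 ψ ∧ (∀ x, 0 ≤ ψ x) ∧
      (∀ x, ψ x ≤ 1) ∧ (∀ x, ‖x‖ ≤ 2 → ψ x = 1) ∧ (∀ x, 5 / 2 ≤ ‖x‖ → ψ x = 0) ∧
      (∀ x y, |ψ x - ψ y| ≤ c₀ * ‖x - y‖) := by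
  let f : ContDiffBump (0 : V) := ⟨2, 5 / 2, by norm_num, by norm_num⟩
  have hf : ContDiff ℝ 1 (f : V → ℝ) := f.contDiff
  obtain ⟨C, hC⟩ := hf.lipschitzWith_of_hasCompactSupport f.hasCompactSupport one_ne_zero
  refine ⟨f, max C 1, le_max_right _ _, hf, fun x => f.nonneg, fun x => f.le_one, fun x hx => ?_,
    fun x hx => ?_, fun x y => ?_⟩
  · exact f.one_of_mem_closedBall (by simpa [f] using hx)
  · exact f.zero_of_le_dist (by simpa [f] using hx)
  · have := hC.dist_le_mul x y
    rw [Real.dist_eq, dist_eq_norm] at this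
    exact this.trans (mul_le_mul_of_nonneg_right (le_max_left _ _) (norm_nonneg _))

/-- The product bound obtained from an average of cutoffs at several scales. -/
theorem exists_product_le_sum (V : Type*) [NormedAddCommGroup V] [InnerProductSpace ℝ V]
    [FiniteDimensional ℝ V] [MeasurableSpace V] [BorelSpace V] : ∃ c₀ : ℝ, 1 ≤ c₀ ∧
    ∀ (k G : V → ℝ≥0∞), Measurable k → Measurable G →
    (∀ z, z ≠ 0 → ‖z‖ < 2 → 1 ≤ k z) → (∀ z, G (-z) = G z) → ∀ c : ℝ, 0 ≤ c →
    SecondDifferenceBound k G c → ∀ (R : ℝ) (E : Set V),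
    PairMinimizer (pairMeasure k) (Metric.ball 0 R) E →
    ∀ (N : ℕ) (r : ℕ → ℝ), 0 < N → (∀ i, i < N → 1 ≤ r i ∧ 3 * r i ≤ R) →
    ∀ (e : V), ‖e‖ = 1 → ∀ t : ℝ, 0 ≤ t → t ≤ 1 / (4 * c₀) →
    volume {x : V | ‖x‖ < 1 ∧ x ∉ E ∧ x - t • e ∈ E} *
        volume {x : V | ‖x‖ < 1 ∧ x ∈ E ∧ x - t • e ∉ E} ≤
      ENNReal.ofReal (2 * c * t ^ 2) * ∑ i ∈ Finset.range N, ∑ j ∈ Finset.range N,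
        ENNReal.ofReal (c₀ ^ 2 / (N ^ 2 * (r i * r j))) *
          pairMeasure G (sepPairs (Metric.ball 0 (3 * min (r i) (r j))) E) := by
  obtain ⟨ψ, c₀, hc₀, hψ, hψ0, hψ1, hψ2, hψ3, hψL⟩ := exists_cutoff V
  refine ⟨c₀, hc₀, fun k G hk hG h1 hGe c hc hkG R E hE N r hN hr e he t ht0 ht => ?_⟩
  have hN' : (0 : ℝ) < N := by exact_mod_cast hN
  have hr0 : ∀ i ∈ Finset.range N, 0 < r i := fun i hi =>
    by linarith [(hr i (Finset.mem_range.1 hi)).1]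
  set χ : ℕ → V → ℝ := fun i => (Metric.ball (0 : V) (3 * r i)).indicator fun _ => 1 with hχ
  have hχ0 : ∀ i x, 0 ≤ χ i x := fun i x => Set.indicator_nonneg (fun _ _ => zero_le_one) x
  have hχ1 : ∀ i x, χ i x ≤ 1 := fun i x => Set.indicator_le_self' (f := fun _ => (1 : ℝ))
    (fun _ _ => zero_le_one) x
  set ψr : ℕ → V → ℝ := fun i x => ψ ((r i)⁻¹ • x) with hψr
  -- The average of the rescaled cutoffs; `σ` averages their Lipschitz constants `c₀ / r i`, each
  -- restricted to the corresponding ball of radius `3 r i`.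
  set φ : V → ℝ := fun x => (N : ℝ)⁻¹ * ∑ i ∈ Finset.range N, ψr i x with hφ
  set σ : V → ℝ := fun x => (N : ℝ)⁻¹ * ∑ i ∈ Finset.range N, c₀ / r i * χ i x with hσ
  have hψrC : ∀ i, ContDiff ℝ 1 (ψr i) := fun i => hψ.comp (contDiff_const_smul _)
  have hφC : ContDiff ℝ 1 φ := contDiff_const.mul (ContDiff.sum fun i _ => hψrC i)
  have hχm : ∀ i, Measurable (χ i) := fun i => measurable_const.indicator measurableSet_ball
  have hσm : Measurable σ :=
    (Finset.measurable_fun_sum _ fun i _ => (hχm i).const_mul _).const_mul _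
  have hσ0 : ∀ x, 0 ≤ σ x := fun x => mul_nonneg (by positivity)
    (Finset.sum_nonneg fun i hi => mul_nonneg (div_nonneg (by linarith) (hr0 i hi).le) (hχ0 i x))
  have hσc : ∀ x, σ x ≤ c₀ := fun x => by
    have : ∑ i ∈ Finset.range N, c₀ / r i * χ i x ≤ ∑ i ∈ Finset.range N, c₀ := by
      refine Finset.sum_le_sum fun i hi => ?_
      have h2 : c₀ / r i ≤ c₀ := div_le_self (by linarith) (hr i (Finset.mem_range.1 hi)).1
      have h3 : 0 ≤ c₀ / r i := div_nonneg (by linarith) (hr0 i hi).le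
      nlinarith [hχ1 i x, hχ0 i x]
    rw [Finset.sum_const, Finset.card_range, nsmul_eq_mul] at this
    calc σ x ≤ (N : ℝ)⁻¹ * (N * c₀) := by simp only [hσ]; gcongr
      _ = c₀ := by field_simp
  have hscale : ∀ i ∈ Finset.range N, ∀ x : V, 3 * r i ≤ ‖x‖ → 3 ≤ ‖(r i)⁻¹ • x‖ :=
      fun i hi x hx => by
    rw [norm_smul, norm_inv, Real.norm_of_nonneg (hr0 i hi).le, ← div_eq_inv_mul,
      le_div_iff₀ (hr0 i hi)]
    exact hx
  have hψrL : ∀ i ∈ Finset.range N, ∀ x y, |ψr i x - ψr i y| ≤ c₀ / r i * ‖x - y‖ :=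
      fun i hi x y => by
    refine (hψL _ _).trans (le_of_eq ?_)
    rw [← smul_sub, norm_smul, norm_inv, Real.norm_of_nonneg (hr0 i hi).le]
    ring
  have hψrL' : ∀ i ∈ Finset.range N, ∀ x y,
      |ψr i x - ψr i y| ≤ c₀ / r i * (χ i x + χ i y) * ‖x - y‖ := fun i hi x y => by
    have hpos : 0 ≤ c₀ / r i * ‖x - y‖ :=
      mul_nonneg (div_nonneg (by linarith) (hr0 i hi).le) (norm_nonneg _)
    by_cases hx : x ∈ Metric.ball (0 : V) (3 * r i)
    · have : χ i x = 1 := Set.indicator_of_mem hx _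
      rw [this]
      nlinarith [hψrL i hi x y, hχ0 i y]
    by_cases hy : y ∈ Metric.ball (0 : V) (3 * r i)
    · have : χ i y = 1 := Set.indicator_of_mem hy _
      rw [this]
      nlinarith [hψrL i hi x y, hχ0 i x]
    · have e1 : ψr i x = 0 := hψ3 _ (by have := hscale i hi x (by simpa using hx); linarith)
      have e2 : ψr i y = 0 := hψ3 _ (by have := hscale i hi y (by simpa using hy); linarith)
      rw [e1, e2, sub_zero, abs_zero]
      have := hχ0 i x; have := hχ0 i y
      nlinarith
  have hφsub : ∀ x y, |φ x - φ y| ≤ (N : ℝ)⁻¹ * ∑ i ∈ Finset.range N, |ψr i x - ψr i y| :=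
      fun x y => by
    simp only [hφ]
    rw [← mul_sub, ← Finset.sum_sub_distrib, abs_mul, abs_of_nonneg (by positivity)]
    gcongr
    exact Finset.abs_sum_le_sum_abs _ _
  have hσL : ∀ x y, |φ x - φ y| ≤ (σ x + σ y) * ‖x - y‖ := fun x y => by
    refine (hφsub x y).trans ?_
    have : (σ x + σ y) * ‖x - y‖ =
        (N : ℝ)⁻¹ * ∑ i ∈ Finset.range N, c₀ / r i * (χ i x + χ i y) * ‖x - y‖ := by
      simp only [hσ, mul_add, add_mul, Finset.sum_add_distrib, Finset.sum_mul, mul_assoc]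
    rw [this]
    gcongr with i hi
    exact hψrL' i hi x y
  have hL : ∀ x y, |φ x - φ y| ≤ c₀ * ‖x - y‖ := fun x y => by
    refine (hφsub x y).trans ?_
    have : ∑ i ∈ Finset.range N, |ψr i x - ψr i y| ≤ ∑ i ∈ Finset.range N, c₀ * ‖x - y‖ := by
      refine Finset.sum_le_sum fun i hi => (hψrL i hi x y).trans ?_
      gcongr
      exact div_le_self (by linarith) (hr i (Finset.mem_range.1 hi)).1
    rw [Finset.sum_const, Finset.card_range, nsmul_eq_mul] at this
    calc _ ≤ (N : ℝ)⁻¹ * (N * (c₀ * ‖x - y‖)) := by gcongr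
      _ = _ := by field_simp
  have hφ0 : ∀ x, 0 ≤ φ x := fun x =>
    mul_nonneg (by positivity) (Finset.sum_nonneg fun i _ => hψ0 _)
  have hφ1 : ∀ x, φ x ≤ 1 := fun x => by
    have : ∑ i ∈ Finset.range N, ψr i x ≤ ∑ i ∈ Finset.range N, (1 : ℝ) :=
      Finset.sum_le_sum fun i _ => hψ1 _
    rw [Finset.sum_const, Finset.card_range, nsmul_eq_mul, mul_one] at this
    calc φ x ≤ (N : ℝ)⁻¹ * N := by simp only [hφ]; gcongr
      _ = 1 := by field_simp
  have hσd : ∀ x, |fderiv ℝ φ x e| ≤ σ x := fun x => by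
    have e1 : fderiv ℝ φ x e = (N : ℝ)⁻¹ * ∑ i ∈ Finset.range N, fderiv ℝ (ψr i) x e := by
      have hd : ∀ i ∈ Finset.range N, HasFDerivAt (ψr i) (fderiv ℝ (ψr i) x) x :=
        fun i _ => ((hψrC i).differentiable one_ne_zero x).hasFDerivAt
      have := (HasFDerivAt.fun_sum hd).const_mul (N : ℝ)⁻¹
      rw [this.fderiv]
      simp
    rw [e1, abs_mul, abs_of_nonneg (by positivity)]
    simp only [hσ]
    gcongr
    refine (Finset.abs_sum_le_sum_abs _ _).trans (Finset.sum_le_sum fun i hi => ?_)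
    have hnn : 0 ≤ c₀ / r i := div_nonneg (by linarith) (hr0 i hi).le
    by_cases hx : x ∈ Metric.ball (0 : V) (3 * r i)
    · have : χ i x = 1 := Set.indicator_of_mem hx _
      rw [this, mul_one]
      exact abs_fderiv_apply_le he hnn (hψrL i hi) x
    · have : χ i x = 0 := Set.indicator_of_notMem hx _
      rw [this, mul_zero]
      have hz : ψr i =ᶠ[nhds x] fun _ => 0 := by
        have hcont : Continuous fun y : V => ‖(r i)⁻¹ • y‖ := by fun_prop
        have : ∀ᶠ y in nhds x, 5 / 2 < ‖(r i)⁻¹ • y‖ := by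
          refine hcont.continuousAt.eventually_const_lt ?_
          have := hscale i hi x (by simpa using hx); linarith
        filter_upwards [this] with y hy
        exact hψ3 _ hy.le
      rw [hz.fderiv_eq]
      simp
  -- As `σ ≤ c₀`, this gives the smallness `t (σ x + σ y) ≤ 1/2` needed for the kernel inequality.
  have htc : t * c₀ ≤ 1 / 4 := by
    rw [le_div_iff₀ (by positivity)] at ht; linarith
  have main := hE.volume_mul_volume_le hk hG h1 hGe hc hkG he (by linarith : 0 ≤ c₀) hφC hL
    (fun x => abs_le.2 ⟨by linarith [hφ0 x], hφ1 x⟩) ht0 (by nlinarith) (by linarith)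
    (fun x hx => by
      have hx' : R ≤ ‖x‖ := by simpa using hx
      simp only [hφ]
      rw [Finset.sum_eq_zero, mul_zero]
      intro i hi
      exact hψ3 _ (by
        have := hscale i hi x (by linarith [(hr i (Finset.mem_range.1 hi)).2]); linarith))
    (fun x hx => by
      have : ∑ i ∈ Finset.range N, ψr i x = ∑ i ∈ Finset.range N, (1 : ℝ) := by
        refine Finset.sum_congr rfl fun i hi => hψ2 _ ?_
        rw [norm_smul, norm_inv, Real.norm_of_nonneg (hr0 i hi).le]
        have := inv_le_one_of_one_le₀ (hr i (Finset.mem_range.1 hi)).1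
        nlinarith [norm_nonneg x]
      simp only [hφ]
      rw [this]
      simp [hN'.ne'])
    hσm hσ0 (fun x y => by nlinarith [hσc x, hσc y]) hσL hσd
  refine main.trans (mul_le_mul_right (le_of_eq ?_) _)
  -- Expanding the square pairs the scales; the product of the indicators of two concentric balls is
  -- the indicator of the smaller one.
  have hsq : ∀ x, ENNReal.ofReal (σ x ^ 2) = ∑ i ∈ Finset.range N, ∑ j ∈ Finset.range N,
      ENNReal.ofReal (c₀ ^ 2 / (N ^ 2 * (r i * r j))) *
        (Metric.ball (0 : V) (3 * min (r i) (r j))).indicator 1 x := fun x => by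
    have e1 : σ x ^ 2 = ∑ i ∈ Finset.range N, ∑ j ∈ Finset.range N,
        c₀ ^ 2 / (N ^ 2 * (r i * r j)) * (χ i x * χ j x) := by
      simp only [hσ]
      rw [sq, mul_mul_mul_comm, Finset.sum_mul_sum, Finset.mul_sum]
      refine Finset.sum_congr rfl fun i hi => ?_
      rw [Finset.mul_sum]
      refine Finset.sum_congr rfl fun j hj => ?_
      have := (hr0 i hi).ne'; have := (hr0 j hj).ne'
      field_simp
    have hnn : ∀ i ∈ Finset.range N, ∀ j ∈ Finset.range N,
        0 ≤ c₀ ^ 2 / (N ^ 2 * (r i * r j)) := fun i hi j hj => by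
      have := (hr0 i hi); have := (hr0 j hj)
      positivity
    rw [e1, ENNReal.ofReal_sum_of_nonneg]
    swap
    · exact fun i hi => Finset.sum_nonneg fun j hj =>
        mul_nonneg (hnn i hi j hj) (mul_nonneg (hχ0 i x) (hχ0 j x))
    refine Finset.sum_congr rfl fun i hi => ?_
    rw [ENNReal.ofReal_sum_of_nonneg fun j hj =>
        mul_nonneg (hnn i hi j hj) (mul_nonneg (hχ0 i x) (hχ0 j x))]
    refine Finset.sum_congr rfl fun j hj => ?_
    rw [ENNReal.ofReal_mul (hnn i hi j hj)]
    congr 1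
    have hmem : x ∈ Metric.ball (0 : V) (3 * min (r i) (r j)) ↔
        x ∈ Metric.ball (0 : V) (3 * r i) ∧ x ∈ Metric.ball (0 : V) (3 * r j) := by
      simp only [mem_ball_zero_iff]
      rw [mul_min_of_nonneg _ _ (by norm_num), lt_min_iff]
    by_cases h1 : x ∈ Metric.ball (0 : V) (3 * r i)
    · by_cases h2 : x ∈ Metric.ball (0 : V) (3 * r j)
      · rw [Set.indicator_of_mem (hmem.2 ⟨h1, h2⟩)]
        simp only [hχ, Set.indicator_of_mem h1, Set.indicator_of_mem h2]
        simp
      · rw [Set.indicator_of_notMem fun h => h2 (hmem.1 h).2]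
        simp only [hχ, Set.indicator_of_notMem h2]
        simp
    · rw [Set.indicator_of_notMem fun h => h1 (hmem.1 h).1]
      simp only [hχ, Set.indicator_of_notMem h1]
      simp
  have hmS := measurable_sepDensity hG hE.meas
  have hmi : ∀ i j, Measurable fun x : V => ENNReal.ofReal (c₀ ^ 2 / (N ^ 2 * (r i * r j))) *
      (Metric.ball (0 : V) (3 * min (r i) (r j))).indicator 1 x * sepDensity G E x := fun i j =>
    ((measurable_one.indicator measurableSet_ball).const_mul _).mul hmS
  simp_rw [hsq, Finset.sum_mul]
  rw [lintegral_finsetSum _ fun i _ => Finset.measurable_fun_sum _ fun j _ => hmi i j]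
  refine Finset.sum_congr rfl fun i _ => ?_
  rw [lintegral_finsetSum _ fun j _ => hmi i j]
  refine Finset.sum_congr rfl fun j _ => ?_
  rw [← setLIntegral_sepDensity hG measurableSet_ball hE.meas, ← lintegral_indicator
    measurableSet_ball, ← lintegral_const_mul' _ _ ENNReal.ofReal_ne_top]
  refine lintegral_congr fun x => ?_
  by_cases h : x ∈ Metric.ball (0 : V) (3 * min (r i) (r j))
  · simp only [Set.indicator_of_mem h, Pi.one_apply, mul_one]
  · simp only [Set.indicator_of_notMem h, mul_zero, zero_mul]

end Cutoff

/-! ### Choice of scales and the flatness rate -/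

section Rate

/-- Each summand is the smaller scale divided by the larger, that is `2 ^ (-|i - j|)`. Off-diagonal
interactions are summable, and the double sum is linear in `N`, not quadratic. -/
theorem sum_sum_dyadic_min_le (N : ℕ) :
    ∑ i ∈ Finset.range N, ∑ j ∈ Finset.range N,
      min ((2 : ℝ) ^ i) (2 ^ j) ^ 2 / (2 ^ i * 2 ^ j) ≤ 4 * (N : ℝ) := by
  set f : ℕ → ℕ → ℝ := fun i j => if j ≤ i then (2 : ℝ) ^ j / 2 ^ i else 0 with hf
  have h1 : ∀ i j : ℕ, min ((2 : ℝ) ^ i) (2 ^ j) ^ 2 / (2 ^ i * 2 ^ j) ≤ f i j + f j i := by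
    intro i j
    have hi : (0 : ℝ) < 2 ^ i := by positivity
    have hj : (0 : ℝ) < 2 ^ j := by positivity
    have hnn : ∀ i j : ℕ, 0 ≤ f i j := fun i j => by
      simp only [hf]; split_ifs <;> positivity
    rcases le_total i j with h | h
    · have h2 : (2 : ℝ) ^ i ≤ 2 ^ j := pow_le_pow_right₀ (by norm_num) h
      have : f j i = 2 ^ i / 2 ^ j := if_pos h
      rw [min_eq_left h2, sq, mul_div_mul_left _ _ hi.ne', this]
      linarith [hnn i j]
    · have h2 : (2 : ℝ) ^ j ≤ 2 ^ i := pow_le_pow_right₀ (by norm_num) h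
      have : f i j = 2 ^ j / 2 ^ i := if_pos h
      rw [min_eq_right h2, sq, mul_div_mul_right _ _ hj.ne', this]
      linarith [hnn j i]
  have h2 : ∀ i, ∑ j ∈ Finset.range N, f i j ≤ 2 := by
    intro i
    have hi : (0 : ℝ) < 2 ^ i := by positivity
    have e1 : ∑ j ∈ Finset.range N, f i j ≤ ∑ j ∈ Finset.range (i + 1), (2 : ℝ) ^ j / 2 ^ i := by
      simp only [hf]
      rw [← Finset.sum_filter]
      refine Finset.sum_le_sum_of_subset_of_nonneg (fun j hj => ?_) fun _ _ _ => by positivity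
      rw [Finset.mem_filter] at hj
      exact Finset.mem_range.2 (by omega)
    refine e1.trans ?_
    rw [← Finset.sum_div, geom_sum_eq (by norm_num), div_le_iff₀ hi, pow_succ]
    norm_num
    linarith
  calc _ ≤ ∑ i ∈ Finset.range N, ∑ j ∈ Finset.range N, (f i j + f j i) :=
        Finset.sum_le_sum fun i _ => Finset.sum_le_sum fun j _ => h1 i j
    _ = ∑ i ∈ Finset.range N, ∑ j ∈ Finset.range N, f i j +
          ∑ i ∈ Finset.range N, ∑ j ∈ Finset.range N, f i j := by
        simp only [Finset.sum_add_distrib]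
        congr 1
        exact Finset.sum_comm
    _ ≤ ∑ i ∈ Finset.range N, (2 : ℝ) + ∑ i ∈ Finset.range N, (2 : ℝ) :=
        add_le_add (Finset.sum_le_sum fun i _ => h2 i) (Finset.sum_le_sum fun i _ => h2 i)
    _ = 4 * N := by simp; ring

/-- The square of the flatness rate. -/
noncomputable def rateSq (n : ℕ) (R : ℝ) : ℝ := if n = 2 then R⁻¹ else (Real.log R)⁻¹

theorem flatnessRate_sq {n : ℕ} {A R : ℝ} (hR : 4 ≤ R) :
    flatnessRate n A R ^ 2 = A ^ 2 * rateSq n R := by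
  unfold flatnessRate rateSq
  split_ifs with h
  · rw [mul_pow, ← Real.rpow_natCast, ← Real.rpow_natCast (R ^ _), ← Real.rpow_mul (by linarith)]
    norm_num
    left
    exact Real.rpow_neg_one R
  · rw [div_pow, Real.sq_sqrt (Real.log_nonneg (by linarith)), div_eq_mul_inv]

/-- The scales used for the cutoffs in dimension two and three. -/
theorem exists_scales {m : ℕ} (hm : m + 1 = 2 ∨ m + 1 = 3) {c₀ C ρ : ℝ}
    (hC : 0 ≤ C) (hρ : 0 ≤ ρ) : ∃ B : ℝ, 0 ≤ B ∧ ∀ R : ℝ, 4 ≤ R →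
      c₀ ^ 2 * C ≤ B * rateSq (m + 1) R ∨ ∃ (N : ℕ) (r : ℕ → ℝ), 0 < N ∧
        (∀ i, i < N → 1 ≤ r i ∧ 3 * r i ≤ R ∧ 3 * r i + ρ + 1 < R) ∧
        ∑ i ∈ Finset.range N, ∑ j ∈ Finset.range N,
          c₀ ^ 2 / (N ^ 2 * (r i * r j)) * (C * (3 * min (r i) (r j)) ^ m) ≤
          B * rateSq (m + 1) R := by
  -- Beyond `R₁` the scale `R / 6` leaves room `ρ + 1` inside `B_R`, and `log (R / 6) ≥ (log R) / 2`
  -- because `R ≥ 36`. For `R ≤ R₁` the rate is bounded below and a constant estimate suffices.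
  set R₁ : ℝ := 36 + 2 * (ρ + 1) with hR₁
  have hD : 0 ≤ c₀ ^ 2 * C := by positivity
  rcases hm with hm | hm
  · obtain rfl : m = 1 := by omega
    refine ⟨c₀ ^ 2 * C * (18 + R₁), by positivity, fun R hR => ?_⟩
    simp only [rateSq, if_true, Nat.reduceAdd]
    have hR0 : 0 < R := by linarith
    rcases le_or_gt R R₁ with h | h
    · left
      rw [← div_eq_mul_inv, le_div_iff₀ hR0]
      nlinarith
    · right
      -- In the plane one cutoff suffices: squared gradient `R⁻²` against energy `R` leaves `R⁻¹`.
      refine ⟨1, fun _ => R / 6, one_pos, fun i _ => ⟨by linarith, by linarith, by linarith⟩, ?_⟩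
      simp only [Finset.range_one, Finset.sum_singleton, min_self, Nat.cast_one, pow_one]
      rw [← div_eq_mul_inv, le_div_iff₀ hR0]
      have : c₀ ^ 2 / (1 ^ 2 * (R / 6 * (R / 6))) * (C * (3 * (R / 6))) * R = c₀ ^ 2 * C * 18 := by
        field_simp
        ring
      rw [this]
      nlinarith
  · obtain rfl : m = 2 := by omega
    have hlR₁ : 0 < Real.log R₁ := Real.log_pos (by linarith)
    refine ⟨c₀ ^ 2 * C * (72 + Real.log R₁), by positivity, fun R hR => ?_⟩
    have hq : rateSq (2 + 1) R = (Real.log R)⁻¹ := by simp [rateSq]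
    rw [hq]
    have hR0 : 0 < R := by linarith
    have hlR : 0 < Real.log R := Real.log_pos (by linarith)
    rcases le_or_gt R R₁ with h | h
    · left
      rw [← div_eq_mul_inv, le_div_iff₀ hlR]
      have : Real.log R ≤ Real.log R₁ := Real.log_le_log hR0 h
      nlinarith
    · right
      have hR36 : 36 < R := by linarith
      -- The scales are `2 ^ i`, and `2 ^ i ≤ exp i ≤ R / 6` for `i < N`. The double sum over scales
      -- is at most `4N`, so dividing by `N²` leaves `O(1 / N) = O(1 / log R)`.
      set N : ℕ := ⌊Real.log (R / 6)⌋₊ + 1 with hN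
      have hl6 : 0 ≤ Real.log (R / 6) := Real.log_nonneg (by linarith)
      have hr : ∀ i, i < N → (2 : ℝ) ^ i ≤ R / 6 := fun i hi => by
        have h1 : (i : ℝ) ≤ Real.log (R / 6) := by
          refine le_trans ?_ (Nat.floor_le hl6)
          exact_mod_cast Nat.lt_succ_iff.1 hi
        calc (2 : ℝ) ^ i ≤ Real.exp 1 ^ i := by
              gcongr
              linarith [Real.add_one_le_exp 1]
          _ = Real.exp i := by rw [← Real.exp_nat_mul, mul_one]
          _ ≤ Real.exp (Real.log (R / 6)) := Real.exp_le_exp.2 h1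
          _ = R / 6 := Real.exp_log (by linarith)
      have hNl : Real.log R / 2 ≤ N := by
        have h1 : Real.log (R / 6) ≤ N := by
          rw [hN]; push_cast; exact (Nat.lt_floor_add_one _).le
        rw [Real.log_div hR0.ne' (by norm_num)] at h1
        have h2 : Real.log 36 ≤ Real.log R := Real.log_le_log (by norm_num) hR36.le
        have h3 : Real.log 36 = 2 * Real.log 6 := by
          rw [show (36 : ℝ) = 6 ^ 2 by norm_num, Real.log_pow]; norm_num
        linarith
      have hN0 : (0 : ℝ) < N := by rw [hN]; positivity
      refine ⟨N, fun i => 2 ^ i, Nat.succ_pos _, fun i hi => ?_, ?_⟩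
      · have := hr i hi
        exact ⟨one_le_pow₀ (by norm_num), by linarith, by linarith⟩
      · have e1 : ∀ i j : ℕ, c₀ ^ 2 / (N ^ 2 * ((2 : ℝ) ^ i * 2 ^ j)) *
            (C * (3 * min ((2 : ℝ) ^ i) (2 ^ j)) ^ 2) =
            9 * (c₀ ^ 2 * C) / N ^ 2 * (min ((2 : ℝ) ^ i) (2 ^ j) ^ 2 / (2 ^ i * 2 ^ j)) := by
          intro i j
          field_simp
          ring
        simp_rw [e1, ← Finset.mul_sum]
        calc _ ≤ 9 * (c₀ ^ 2 * C) / N ^ 2 * (4 * N) := by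
              gcongr
              exact sum_sum_dyadic_min_le N
          _ = 36 * (c₀ ^ 2 * C) / N := by field_simp; ring
          _ ≤ 36 * (c₀ ^ 2 * C) / (Real.log R / 2) := by gcongr
          _ = c₀ ^ 2 * C * 72 * (Real.log R)⁻¹ := by field_simp; ring
          _ ≤ _ := by
              gcongr
              linarith

/-- The product of the volumes gained and lost by a translation of a minimizer. -/
theorem exists_product_bound {m : ℕ} (hm : m + 1 = 2 ∨ m + 1 = 3)
    {K : EuclideanSpace ℝ (Fin (m + 1)) → ℝ} (hK : AdmissibleKernel K) (hc : HasCompactSupport K) :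
    ∃ A t₀ : ℝ, 0 < A ∧ 0 < t₀ ∧ ∀ R : ℝ, 4 ≤ R → ∀ E : Set (EuclideanSpace ℝ (Fin (m + 1))),
      PairMinimizer (pairMeasure fun z => ENNReal.ofReal (K z)) (Metric.ball 0 R) E →
      ∀ e : EuclideanSpace ℝ (Fin (m + 1)), ‖e‖ = 1 → ∀ t : ℝ, 0 ≤ t → t ≤ t₀ →
        volume {x | ‖x‖ < 1 ∧ x ∉ E ∧ x - t • e ∈ E} *
          volume {x | ‖x‖ < 1 ∧ x ∈ E ∧ x - t • e ∉ E} ≤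
          ENNReal.ofReal ((flatnessRate (m + 1) A R * t) ^ 2) := by
  obtain ⟨ρ, c, k₂, hρ, hc0, hk₂m, hk₂e, hk₂s, hk₂i, hbound⟩ := hK.exists_majorant hc
  set k : EuclideanSpace ℝ (Fin (m + 1)) → ℝ≥0∞ := fun z => ENNReal.ofReal (K z) with hk
  have hkm : Measurable k := hK.measurable.ennreal_ofReal
  have hke : ∀ z, k (-z) = k z := fun z => by simp only [hk, hK.even]
  have hk1 : ∀ z, z ≠ 0 → ‖z‖ < 2 → 1 ≤ k z := fun z h0 h2 => by
    have := ENNReal.ofReal_le_ofReal (hK.one_le z h0 h2)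
    rwa [ENNReal.ofReal_one] at this
  have hfr : Module.finrank ℝ (EuclideanSpace ℝ (Fin (m + 1))) = m + 1 := by simp
  obtain ⟨C, hCt, hC⟩ := exists_energy_bound hkm hk₂m hke hk1 (by rw [hfr]; omega)
    (hK.lintegral_mul_norm_ne_top hc) hρ hk₂s hk₂i
  rw [hfr, Nat.add_sub_cancel] at hC
  obtain ⟨c₀, hc₀, hprod⟩ := exists_product_le_sum (EuclideanSpace ℝ (Fin (m + 1)))
  have hCr : C = ENNReal.ofReal C.toReal := (ENNReal.ofReal_toReal hCt).symm
  obtain ⟨B, hB0, hB⟩ := exists_scales hm (c₀ := c₀) (ENNReal.toReal_nonneg (a := C)) hρ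
  -- The summand `1` only makes the constant positive.
  refine ⟨√(2 * c * B + 1), 1 / (4 * c₀), by positivity, by positivity,
    fun R hR E hE e he t ht0 ht => ?_⟩
  have hq : 0 ≤ rateSq (m + 1) R := by
    unfold rateSq
    have := Real.log_nonneg (by linarith : 1 ≤ R)
    split_ifs <;> positivity
  have hGe : ∀ z, (k + k₂) (-z) = (k + k₂) z := fun z => by simp only [Pi.add_apply, hke, hk₂e]
  have key := hprod k (k + k₂) hkm (hkm.add hk₂m) hk1 hGe c hc0 hbound R E hE
  obtain ⟨hcrude, hfine⟩ := hC R E hE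
  have suff : volume {x | ‖x‖ < 1 ∧ x ∉ E ∧ x - t • e ∈ E} *
          volume {x | ‖x‖ < 1 ∧ x ∈ E ∧ x - t • e ∉ E} ≤
          ENNReal.ofReal (2 * c * t ^ 2) * ENNReal.ofReal (B * rateSq (m + 1) R) := by
    rcases hB R hR with h | ⟨N, r, hN, hr, hsum⟩
    -- For bounded `R`, one cutoff at scale `1` only involves the energy in `B_3`, for which the
    -- crude bound is available.
    · refine (key 1 (fun _ => 1) one_pos (fun _ _ => ⟨le_rfl, by linarith⟩) e he t ht0 ht).trans ?_
      simp only [Finset.range_one, Finset.sum_singleton, min_self, Nat.cast_one, mul_one, one_pow,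
        div_one]
      refine mul_le_mul_right (le_trans (mul_le_mul_right (hcrude hR) _) ?_) _
      rw [hCr, ← ENNReal.ofReal_mul (by positivity)]
      exact ENNReal.ofReal_le_ofReal h
    · refine (key N r hN (fun i hi => ⟨(hr i hi).1, (hr i hi).2.1⟩) e he t ht0 ht).trans ?_
      refine mul_le_mul_right (le_trans ?_ (ENNReal.ofReal_le_ofReal hsum)) _
      have hpos : ∀ i ∈ Finset.range N, 1 ≤ r i := fun i hi => (hr i (Finset.mem_range.1 hi)).1
      have hnn : ∀ i ∈ Finset.range N, ∀ j ∈ Finset.range N,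
          0 ≤ c₀ ^ 2 / (N ^ 2 * (r i * r j)) := fun i hi j hj => by
        have := hpos i hi; have := hpos j hj
        exact div_nonneg (by positivity) (by positivity)
      have hnn' : ∀ i ∈ Finset.range N, ∀ j ∈ Finset.range N,
          0 ≤ c₀ ^ 2 / (N ^ 2 * (r i * r j)) * (C.toReal * (3 * min (r i) (r j)) ^ m) :=
        fun i hi j hj => by
        have : 1 ≤ min (r i) (r j) := le_min (hpos i hi) (hpos j hj)
        exact mul_nonneg (hnn i hi j hj) (mul_nonneg ENNReal.toReal_nonneg (by positivity))
      rw [ENNReal.ofReal_sum_of_nonneg fun i hi => Finset.sum_nonneg fun j hj => hnn' i hi j hj]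
      refine Finset.sum_le_sum fun i hi => ?_
      rw [ENNReal.ofReal_sum_of_nonneg fun j hj => hnn' i hi j hj]
      refine Finset.sum_le_sum fun j hj => ?_
      rw [ENNReal.ofReal_mul (hnn i hi j hj), ENNReal.ofReal_mul ENNReal.toReal_nonneg, ← hCr]
      refine mul_le_mul_right (hfine _ ?_ ?_) _
      · have : 1 ≤ min (r i) (r j) := le_min (hpos i hi) (hpos j hj)
        linarith
      · have h1 := min_le_left (r i) (r j)
        have h2 := (hr i (Finset.mem_range.1 hi)).2.2
        linarith
  refine suff.trans ?_
  rw [← ENNReal.ofReal_mul (by positivity)]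
  refine ENNReal.ofReal_le_ofReal ?_
  rw [mul_pow, flatnessRate_sq hR, Real.sq_sqrt (by positivity)]
  have : 0 ≤ rateSq (m + 1) R * t ^ 2 := by positivity
  nlinarith

end Rate

/-! ### Smoothed volumes of translated sets -/

section Translate

variable {V : Type*} [NormedAddCommGroup V] [InnerProductSpace ℝ V] [FiniteDimensional ℝ V]
  [MeasurableSpace V] [BorelSpace V]

theorem hasDerivAt_setIntegral_translate {χ : V → ℝ} (hχ : ContDiff ℝ 1 χ)
    (hc : HasCompactSupport χ) (E : Set V) (v : V) :
    HasDerivAt (fun t : ℝ => ∫ x in E, χ (x + t • v)) (∫ x in E, fderiv ℝ χ x v) 0 := by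
  have hcd : Continuous fun x => fderiv ℝ χ x v :=
    (hχ.continuous_fderiv one_ne_zero).clm_apply continuous_const
  have hcs : HasCompactSupport fun x => fderiv ℝ χ x v := hc.fderiv_apply ℝ v
  obtain ⟨C, hC⟩ := hcs.exists_bound_of_continuous hcd
  obtain ⟨ρ, hρ⟩ := hcs.isCompact.isBounded.subset_closedBall 0
  have hint : ∀ t : ℝ, Integrable (fun x => χ (x + t • v)) (volume.restrict E) := fun t =>
    (((hχ.continuous.integrable_of_hasCompactSupport hc).comp_add_right (t • v))).integrableOn
  have hcont : ∀ t : ℝ, Continuous fun x => fderiv ℝ χ (x + t • v) v := fun t =>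
    hcd.comp (continuous_id.add continuous_const)
  have main := hasDerivAt_integral_of_dominated_loc_of_deriv_le (𝕜 := ℝ) (μ := volume.restrict E)
    (F := fun t x => χ (x + t • v)) (F' := fun t x => fderiv ℝ χ (x + t • v) v) (x₀ := 0)
    (s := Metric.ball 0 1)
    (bound := (Metric.closedBall (0 : V) (ρ + ‖v‖)).indicator fun _ => C)
    (Metric.ball_mem_nhds 0 one_pos)
    (.of_forall fun t => (hint t).1) (hint 0) (hcont 0).aestronglyMeasurable
    (.of_forall fun x t ht => ?_) ?_ (.of_forall fun x t _ => ?_)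
  · simpa using main.2
  · by_cases hx : x ∈ Metric.closedBall (0 : V) (ρ + ‖v‖)
    · rw [Set.indicator_of_mem hx]; exact hC _
    · rw [Set.indicator_of_notMem hx]
      refine le_of_eq (norm_eq_zero.2 ?_)
      by_contra h
      refine hx ?_
      have h1 := hρ (subset_tsupport _ h)
      have h2 := norm_sub_le (x + t • v) (t • v)
      rw [add_sub_cancel_right, norm_smul] at h2
      have h3 : ‖t‖ ≤ 1 := (mem_ball_zero_iff.1 ht).le
      simp only [mem_closedBall_zero_iff] at h1 ⊢
      nlinarith [norm_nonneg v]
  · exact ((integrableOn_const measure_closedBall_lt_top.ne).integrable_indicator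
      measurableSet_closedBall).integrableOn
  · have h1 := (hχ.differentiable one_ne_zero (x + t • v)).hasFDerivAt
    have h2 : HasDerivAt (fun t : ℝ => x + t • v) v t := by
      simpa using ((hasDerivAt_id t).smul_const v).const_add x
    exact h1.comp_hasDerivAt t h2

/-- The part common to `E` and its translate cancels, leaving the entering part minus the leaving
part. -/
theorem setIntegral_translate_sub {χ : V → ℝ} (hχ : Continuous χ) (hc : HasCompactSupport χ)
    {E : Set V} (hE : MeasurableSet E) (h : V) :
    (∫ x in E, χ (x + h)) - ∫ x in E, χ x =
      (∫ x in {x | x ∉ E ∧ x - h ∈ E}, χ x) - ∫ x in {x | x ∈ E ∧ x - h ∉ E}, χ x := by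
  have hi : Integrable χ := hχ.integrable_of_hasCompactSupport hc
  have hE' : MeasurableSet {x : V | x - h ∈ E} := measurableSet_preimage (measurable_sub_const h) hE
  have e1 : ∫ x in E, χ (x + h) = ∫ x in {x | x - h ∈ E}, χ x := by
    rw [← integral_indicator hE, ← integral_indicator hE', ← integral_sub_right_eq_self _ h]
    refine integral_congr_ae (.of_forall fun x => ?_)
    simp [Set.indicator]
  have e2 : ∫ x in {x | x - h ∈ E}, χ x = (∫ x in {x | x ∉ E ∧ x - h ∈ E}, χ x) +
      ∫ x in {x | x ∈ E ∧ x - h ∈ E}, χ x := by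
    have hs : {x : V | x - h ∈ E} = {x | x ∉ E ∧ x - h ∈ E} ∪ {x | x ∈ E ∧ x - h ∈ E} := by
      ext x; simp only [Set.mem_union, Set.mem_ofPred_eq]; tauto
    conv_lhs => rw [hs]
    exact setIntegral_union (Set.disjoint_left.2 fun x hx hx' => hx.1 hx'.1) (hE.inter hE')
      hi.integrableOn hi.integrableOn
  have e3 : ∫ x in E, χ x = (∫ x in {x | x ∈ E ∧ x - h ∉ E}, χ x) +
      ∫ x in {x | x ∈ E ∧ x - h ∈ E}, χ x := by
    have hs : E = {x | x ∈ E ∧ x - h ∉ E} ∪ {x | x ∈ E ∧ x - h ∈ E} := by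
      ext x; simp only [Set.mem_union, Set.mem_ofPred_eq]; tauto
    conv_lhs => rw [hs]
    exact setIntegral_union (Set.disjoint_left.2 fun x hx hx' => hx.2 hx'.2) (hE.inter hE')
      hi.integrableOn hi.integrableOn
  rw [e1, e2, e3]; ring

end Translate

/-! ### From products of gain and loss to one-sided bounds -/

section Direction

variable {V : Type*} [NormedAddCommGroup V] [InnerProductSpace ℝ V] [FiniteDimensional ℝ V]
  [MeasurableSpace V] [BorelSpace V]

/-- Points of `E` in the ball of radius `r` whose translate by `-h` is in the ball but not in
`E`. -/
def gainSet (E : Set V) (r : ℝ) (h : V) : Set V := {x | ‖x‖ < r ∧ ‖x - h‖ < r ∧ x ∈ E ∧ x - h ∉ E}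

/-- Points of `E` in the unit ball whose translate by `-h` is not in `E`. -/
def exitSet (E : Set V) (h : V) : Set V := {x | ‖x‖ < 1 ∧ x ∈ E ∧ x - h ∉ E}

theorem gainSet_subset_exitSet (E : Set V) {r : ℝ} (hr : r ≤ 1) (h : V) :
    gainSet E r h ⊆ exitSet E h := fun _ hx => ⟨hx.1.trans_le hr, hx.2.2⟩

theorem measurableSet_gainSet {E : Set V} (hE : MeasurableSet E) (r : ℝ) (h : V) :
    MeasurableSet (gainSet E r h) := by
  have h1 : MeasurableSet {x : V | ‖x‖ < r} := measurableSet_lt measurable_norm measurable_const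
  have h2 : MeasurableSet {x : V | ‖x - h‖ < r} :=
    measurableSet_lt (measurable_sub_const h).norm measurable_const
  exact h1.inter (h2.inter (hE.inter (measurableSet_preimage (measurable_sub_const h) hE).compl))

/-- Both endpoints lie in the ball, hence by convexity so does the intermediate point. Thus, unlike
for jump sets, subdivision does not enlarge the radius. -/
theorem volume_gainSet_nsmul_le (E : Set V) (r : ℝ) (a : V) (N : ℕ) :
    volume (gainSet E r (N • a)) ≤ N * volume (gainSet E r a) := by
  induction N with
  | zero => simp [gainSet]
  | succ N ih =>
    have hsub : gainSet E r ((N + 1) • a) ⊆ gainSet E r (N • a) ∪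
        (fun x => x + -(N • a)) ⁻¹' gainSet E r a := by
      rintro x ⟨h1, h2, h3, h4⟩
      have hmid : ‖x - N • a‖ < r := by
        have hx : x ∈ Metric.ball (0 : V) r := by simpa using h1
        have hx' : x - (N + 1) • a ∈ Metric.ball (0 : V) r := by simpa using h2
        have hN : (0 : ℝ) < N + 1 := by positivity
        have := (convex_ball (0 : V) r) hx hx' (show (0 : ℝ) ≤ 1 / (N + 1) by positivity)
          (show (0 : ℝ) ≤ N / (N + 1) by positivity) (by field_simp; ring)
        have e : (1 / ((N : ℝ) + 1)) • x + (N / ((N : ℝ) + 1)) • (x - (N + 1) • a) = x - N • a := by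
          rw [smul_sub, ← Nat.cast_smul_eq_nsmul ℝ (N + 1), smul_smul, ← Nat.cast_smul_eq_nsmul ℝ N,
            ← add_sub_assoc, ← add_smul]
          push_cast
          rw [div_mul_cancel₀ _ hN.ne', ← add_div, add_comm 1, div_self hN.ne', one_smul]
        rw [e] at this
        simpa using this
      have hlast : x - N • a - a = x - (N + 1) • a := by rw [succ_nsmul]; abel
      by_cases h5 : x - N • a ∈ E
      · right
        change x + -(N • a) ∈ gainSet E r a
        rw [← sub_eq_add_neg]
        exact ⟨hmid, by rwa [hlast], h5, by rwa [hlast]⟩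
      · left; exact ⟨h1, hmid, h3, h5⟩
    refine (measure_mono hsub).trans ((measure_union_le _ _).trans ?_)
    rw [measure_preimage_add_right]
    push_cast
    rw [add_mul, one_mul]
    exact add_le_add ih le_rfl

theorem measurableSet_exitSet {E : Set V} (hE : MeasurableSet E) (h : V) :
    MeasurableSet (exitSet E h) := by
  have h1 : MeasurableSet {x : V | ‖x‖ < 1} := measurableSet_lt measurable_norm measurable_const
  exact h1.inter (hE.inter (measurableSet_preimage (measurable_sub_const h) hE).compl)

theorem volume_exitSet_lt_top (E : Set V) (h : V) : volume (exitSet E h) < ∞ := by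
  refine lt_of_le_of_lt (measure_mono fun x hx => ?_) (measure_ball_lt_top (x := (0 : V)) (r := 1))
  simpa using hx.1

/-- The constant bounding the volume of the boundary layer of the unit ball. -/
noncomputable def shellConst (V : Type*) [NormedAddCommGroup V] [InnerProductSpace ℝ V]
    [FiniteDimensional ℝ V] [MeasurableSpace V] [BorelSpace V] : ℝ :=
  Module.finrank ℝ V * volume.real (Metric.ball (0 : V) 1)

theorem shellConst_nonneg : 0 ≤ shellConst V := by unfold shellConst; positivity

theorem volume_shell_le (hd : 1 ≤ Module.finrank ℝ V) (h : V) :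
    volume {x : V | ‖x‖ < 1 ∧ ¬ ‖x - h‖ < 1} ≤ ENNReal.ofReal (shellConst V * ‖h‖) := by
  have := volume_ball_diff_translate_le hd one_pos h
  simp only [mem_ball_zero_iff, one_pow, mul_one] at this
  refine this.trans (le_of_eq ?_)
  rw [shellConst, ENNReal.ofReal_mul (by positivity), ENNReal.ofReal_mul (by positivity),
    ENNReal.ofReal_mul (by positivity), Measure.real, ENNReal.ofReal_toReal measure_ball_lt_top.ne]
  ring

/-- Translation preserves volume, so `E` and its translate have volumes in the unit ball that differ
by at most that of the boundary shell. Subtracting the common part leaves the comparison of the two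
exit sets. -/
theorem volume_exitSet_le_add (hd : 1 ≤ Module.finrank ℝ V) {E : Set V} (hE : MeasurableSet E)
    (h : V) : volume (exitSet E h) ≤
      volume (exitSet Eᶜ h) + ENNReal.ofReal (shellConst V * ‖h‖) := by
  have hE' : MeasurableSet {x : V | x - h ∈ E} := measurableSet_preimage (measurable_sub_const h) hE
  have h1 : MeasurableSet {x : V | ‖x‖ < 1} := measurableSet_lt measurable_norm measurable_const
  set Y : Set V := {x | ‖x‖ < 1 ∧ x ∈ E ∧ x - h ∈ E} with hY
  have mY : MeasurableSet Y := h1.inter (hE.inter hE')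
  have hYt : volume Y ≠ ∞ := by
    refine ne_top_of_le_ne_top (measure_ball_lt_top (x := (0 : V)) (r := 1)).ne
      (measure_mono fun x hx => ?_)
    simpa using hx.1
  have e1 : {x : V | ‖x‖ < 1 ∧ x ∈ E} = exitSet E h ∪ Y := by
    ext x; simp only [exitSet, hY, Set.mem_union, Set.mem_ofPred_eq]; tauto
  have e2 : {x : V | ‖x‖ < 1 ∧ x - h ∈ E} = exitSet Eᶜ h ∪ Y := by
    ext x; simp only [exitSet, hY, Set.mem_union, Set.mem_ofPred_eq, Set.mem_compl_iff]; tauto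
  have d1 : Disjoint (exitSet E h) Y := Set.disjoint_left.2 fun x hx hx' => hx.2.2 hx'.2.2
  have d2 : Disjoint (exitSet Eᶜ h) Y := Set.disjoint_left.2 fun x hx hx' => hx.2.1 hx'.2.1
  have key : volume {x : V | ‖x‖ < 1 ∧ x ∈ E} ≤ volume {x : V | ‖x‖ < 1 ∧ x - h ∈ E} +
      ENNReal.ofReal (shellConst V * ‖h‖) := by
    have hs : {x : V | ‖x‖ < 1 ∧ x ∈ E} ⊆ ((fun x => x + h) ⁻¹' {x : V | ‖x‖ < 1 ∧ x - h ∈ E}) ∪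
        {x : V | ‖x‖ < 1 ∧ ¬ ‖x - -h‖ < 1} := by
      rintro x ⟨hx, hx'⟩
      by_cases hh : ‖x + h‖ < 1
      · left; exact ⟨hh, by rwa [add_sub_cancel_right]⟩
      · right; exact ⟨hx, by rwa [sub_neg_eq_add]⟩
    refine (measure_mono hs).trans ((measure_union_le _ _).trans ?_)
    rw [measure_preimage_add_right]
    refine add_le_add le_rfl ((volume_shell_le hd (-h)).trans ?_)
    rw [norm_neg]
  rw [e1, e2, measure_union d1 mY, measure_union d2 mY, add_right_comm] at key
  exact (ENNReal.add_le_add_iff_right hYt).1 key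

/-- The hypothesis on a set coming from stability: the product of the volumes gained and lost by
translations is quadratically small. -/
def ProductBound (E : Set V) (ε t₀ : ℝ) : Prop :=
  ∀ h : V, ‖h‖ ≤ t₀ → volume (exitSet Eᶜ h) * volume (exitSet E h) ≤
    ENNReal.ofReal ((ε * ‖h‖) ^ 2)

theorem ProductBound.compl {E : Set V} {ε t₀ : ℝ} (H : ProductBound E ε t₀) :
    ProductBound Eᶜ ε t₀ := fun h hh => by
  rw [compl_compl, mul_comm]; exact H h hh

theorem ProductBound.real {E : Set V} {ε t₀ : ℝ} (H : ProductBound E ε t₀) {h : V} (hh : ‖h‖ ≤ t₀) :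
    volume.real (exitSet Eᶜ h) * volume.real (exitSet E h) ≤ (ε * ‖h‖) ^ 2 := by
  rw [Measure.real, Measure.real, ← ENNReal.toReal_mul]
  exact ENNReal.toReal_le_of_le_ofReal (sq_nonneg _) (H h hh)

/-- The bound of the total variation. -/
theorem ProductBound.volume_add_le (hd : 1 ≤ Module.finrank ℝ V) {E : Set V} (hE : MeasurableSet E)
    {ε t₀ : ℝ} (hε : 0 ≤ ε) (H : ProductBound E ε t₀) {h : V} (hh : ‖h‖ ≤ t₀) :
    volume (exitSet E h) + volume (exitSet Eᶜ h) ≤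
      ENNReal.ofReal ((shellConst V + 2 * ε) * ‖h‖) := by
  have hS := shellConst_nonneg (V := V)
  have h0 := norm_nonneg h
  have r1 := H.real hh
  have r2 : volume.real (exitSet E h) ≤ volume.real (exitSet Eᶜ h) + shellConst V * ‖h‖ := by
    have := ENNReal.toReal_mono (ENNReal.add_ne_top.2 ⟨(volume_exitSet_lt_top _ h).ne,
      ENNReal.ofReal_ne_top⟩) (volume_exitSet_le_add hd hE h)
    rwa [ENNReal.toReal_add (volume_exitSet_lt_top _ h).ne ENNReal.ofReal_ne_top,
      ENNReal.toReal_ofReal (by positivity)] at this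
  have r3 : volume.real (exitSet Eᶜ h) ≤ volume.real (exitSet E h) + shellConst V * ‖h‖ := by
    have := ENNReal.toReal_mono (ENNReal.add_ne_top.2 ⟨(volume_exitSet_lt_top _ h).ne,
      ENNReal.ofReal_ne_top⟩) (volume_exitSet_le_add hd hE.compl h)
    rwa [ENNReal.toReal_add (volume_exitSet_lt_top _ h).ne ENNReal.ofReal_ne_top,
      ENNReal.toReal_ofReal (by positivity), compl_compl] at this
  rw [← ENNReal.ofReal_toReal (volume_exitSet_lt_top E h).ne,
    ← ENNReal.ofReal_toReal (volume_exitSet_lt_top Eᶜ h).ne,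
    ← ENNReal.ofReal_add ENNReal.toReal_nonneg ENNReal.toReal_nonneg]
  refine ENNReal.ofReal_le_ofReal ?_
  change volume.real (exitSet E h) + volume.real (exitSet Eᶜ h) ≤ _
  set a := volume.real (exitSet E h)
  set b := volume.real (exitSet Eᶜ h)
  -- From `(a + b)² = (a - b)² + 4ab`, with the difference bounded by the shell and the product by
  -- stability.
  refine abs_le_of_sq_le_sq' ?_ (by positivity) |>.2
  have h4 : (a - b) ^ 2 ≤ (shellConst V * ‖h‖) ^ 2 :=
    sq_le_sq' (by linarith) (by linarith)
  have h5 : 0 ≤ shellConst V * ‖h‖ * (ε * ‖h‖) := by positivity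
  nlinarith

/-- One-sided bounds from the sign of a linear functional. -/
theorem ProductBound.exists_functional {E : Set V} (hE : MeasurableSet E)
    {ε t₀ : ℝ} (hε : 0 ≤ ε) (ht₀ : 0 < t₀) (H : ProductBound E ε t₀) {r : ℝ} (hr0 : 0 < r)
    (hr : r < 1) :
    ∃ ℓ : V →L[ℝ] ℝ, ∀ v : V, ‖v‖ = 1 → ∀ s : ℝ, 0 ≤ s →
      (ℓ v ≤ 0 → volume (gainSet Eᶜ r (s • v)) ≤ ENNReal.ofReal (ε * s)) ∧
      (0 ≤ ℓ v → volume (gainSet E r (s • v)) ≤ ENNReal.ofReal (ε * s)) := by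
  obtain ⟨r', hr1, hr2⟩ := exists_between hr
  -- The bump is one on `B_r` and supported inside `B_1`, so its integrals over the crossing sets
  -- lie between the volumes of the gain set in `B_r` and the exit set in `B_1`.
  let f : ContDiffBump (0 : V) := ⟨r, r', hr0, hr1⟩
  have hf : ContDiff ℝ 1 (f : V → ℝ) := f.contDiff
  have hfc := f.hasCompactSupport
  have hfi : Integrable (f : V → ℝ) := hf.continuous.integrable_of_hasCompactSupport hfc
  have hdi : Integrable (fun x => fderiv ℝ (f : V → ℝ) x) :=
    (hf.continuous_fderiv one_ne_zero).integrable_of_hasCompactSupport (hfc.fderiv ℝ)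
  refine ⟨∫ x in E, fderiv ℝ (f : V → ℝ) x, fun v hv s hs => ?_⟩
  set L := ∫ x in E, fderiv ℝ (f : V → ℝ) x with hL
  have hLv : L v = ∫ x in E, fderiv ℝ (f : V → ℝ) x v :=
    ContinuousLinearMap.integral_apply hdi.integrableOn v
  have hder := hasDerivAt_setIntegral_translate hf hfc E v
  rw [← hLv] at hder
  have hm1 : ∀ (F : Set V) (hF : MeasurableSet F) (h : V), MeasurableSet {x | x ∈ F ∧ x - h ∉ F} :=
    fun F hF h => hF.inter (measurableSet_preimage (measurable_sub_const h) hF).compl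
  have upper : ∀ (F : Set V), MeasurableSet F → ∀ h : V,
      ∫ x in {x | x ∈ F ∧ x - h ∉ F}, f x ≤ volume.real (exitSet F h) := by
    intro F hF h
    rw [← integral_indicator (hm1 F hF h), ← integral_indicator_one (measurableSet_exitSet hF h)]
    refine integral_mono (hfi.indicator (hm1 F hF h)) ?_ fun x => ?_
    · exact (integrable_indicator_iff (measurableSet_exitSet hF h)).2
        (integrableOn_const (volume_exitSet_lt_top F h).ne)
    · by_cases hx : x ∈ {x | x ∈ F ∧ x - h ∉ F}
      · rw [Set.indicator_of_mem hx]
        by_cases hx1 : ‖x‖ < 1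
        · rw [Set.indicator_of_mem (show x ∈ exitSet F h from ⟨hx1, hx⟩)]
          exact f.le_one
        · rw [f.zero_of_le_dist (by simp [f]; linarith)]
          exact Set.indicator_nonneg (fun _ _ => zero_le_one) x
      · rw [Set.indicator_of_notMem hx]
        exact Set.indicator_nonneg (fun _ _ => zero_le_one) x
  have lower : ∀ (F : Set V), MeasurableSet F → ∀ h : V,
      volume (gainSet F r h) ≤ ENNReal.ofReal (∫ x in {x | x ∈ F ∧ x - h ∉ F}, f x) := by
    intro F hF h
    rw [ofReal_integral_eq_lintegral_ofReal hfi.integrableOn (.of_forall fun x => f.nonneg),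
      ← setLIntegral_one, ← lintegral_indicator (measurableSet_gainSet hF r h),
      ← lintegral_indicator (hm1 F hF h)]
    refine lintegral_mono fun x => ?_
    by_cases hx : x ∈ gainSet F r h
    · rw [Set.indicator_of_mem hx, Set.indicator_of_mem (show x ∈ {x | x ∈ F ∧ x - h ∉ F} from hx.2.2),
        f.one_of_mem_closedBall (by simpa [f] using hx.1.le), ENNReal.ofReal_one]
    · rw [Set.indicator_of_notMem hx]; exact zero_le
  -- If the smoothed gain `a` exceeds the smoothed loss `b` by at most `δ t`, then `a > (ε + δ) t`
  -- would force both to exceed `ε t`, contradicting the product bound.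
  have final : ∀ (F : Set V), MeasurableSet F → ProductBound F ε t₀ →
      (∀ δ : ℝ, 0 < δ → ∀ᶠ t in nhdsWithin (0 : ℝ) (Set.Ioi 0),
        (∫ x in {x | x ∈ F ∧ x - t • v ∉ F}, f x) -
          (∫ x in {x | x ∈ Fᶜ ∧ x - t • v ∉ Fᶜ}, f x) ≤ δ * t) →
      volume (gainSet F r (s • v)) ≤ ENNReal.ofReal (ε * s) := by
    intro F hF HF hlim
    rcases hs.eq_or_lt with rfl | hs
    · simp [gainSet]
    have step : ∀ δ : ℝ, 0 < δ → volume (gainSet F r (s • v)) ≤ ENNReal.ofReal ((ε + δ) * s) := by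
      intro δ hδ
      have hev : ∀ᶠ t in nhdsWithin (0 : ℝ) (Set.Ioi 0),
          volume (gainSet F r (t • v)) ≤ ENNReal.ofReal ((ε + δ) * t) := by
        have ht : ∀ᶠ t in nhdsWithin (0 : ℝ) (Set.Ioi 0), t < t₀ :=
          nhdsWithin_le_nhds (eventually_lt_nhds ht₀)
        filter_upwards [hlim δ hδ, ht, self_mem_nhdsWithin] with t h1 h2 h3
        have h3' : (0 : ℝ) < t := h3
        refine (lower F hF (t • v)).trans (ENNReal.ofReal_le_ofReal ?_)
        by_contra hcon
        push Not at hcon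
        have hn : ‖t • v‖ = t := by rw [norm_smul, hv, mul_one, Real.norm_of_nonneg h3'.le]
        have hp := HF.real (h := t • v) (by rw [hn]; exact h2.le)
        rw [hn] at hp
        have u1 := upper F hF (t • v)
        have u2 := upper Fᶜ hF.compl (t • v)
        set a := ∫ x in {x | x ∈ F ∧ x - t • v ∉ F}, f x
        set b := ∫ x in {x | x ∈ Fᶜ ∧ x - t • v ∉ Fᶜ}, f x
        have hb : ε * t < b := by nlinarith
        have hεt : 0 ≤ ε * t := by positivity
        have ha : ε * t < a := by nlinarith
        have : (ε * t) ^ 2 < volume.real (exitSet Fᶜ (t • v)) * volume.real (exitSet F (t • v)) := by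
          rw [sq]; exact mul_lt_mul'' (hb.trans_le u2) (ha.trans_le u1) hεt hεt
        linarith
      -- The infinitesimal bound reaches every length `s`: cut the translation into equal small
      -- steps and use subadditivity. Then `δ` tends to zero.
      have hseq : Filter.Tendsto (fun N : ℕ => s / ((N : ℝ) + 1)) Filter.atTop
          (nhdsWithin (0 : ℝ) (Set.Ioi 0)) := by
        refine tendsto_nhdsWithin_iff.2 ⟨?_, .of_forall fun N => ?_⟩
        · have := tendsto_one_div_add_atTop_nhds_zero_nat (𝕜 := ℝ).const_mul s
          simpa [div_eq_mul_inv] using this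
        · exact div_pos hs (by positivity)
      obtain ⟨N, hN⟩ := (hseq.eventually hev).exists
      have e : s • v = (N + 1) • ((s / ((N : ℝ) + 1)) • v) := by
        rw [← Nat.cast_smul_eq_nsmul ℝ, smul_smul]
        push_cast
        rw [mul_div_cancel₀ _ (by positivity)]
      rw [e]
      refine (volume_gainSet_nsmul_le F r _ (N + 1)).trans ((mul_le_mul_right hN _).trans
        (le_of_eq ?_))
      rw [← ENNReal.ofReal_natCast, ← ENNReal.ofReal_mul (by positivity)]
      congr 1
      push_cast
      field_simp
    have hcont : Filter.Tendsto (fun δ : ℝ => ENNReal.ofReal ((ε + δ) * s))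
        (nhdsWithin 0 (Set.Ioi 0)) (nhds (ENNReal.ofReal ((ε + 0) * s))) := by
      refine Filter.Tendsto.mono_left (Continuous.tendsto ?_ 0) nhdsWithin_le_nhds
      exact ENNReal.continuous_ofReal.comp (by fun_prop)
    rw [add_zero] at hcont
    refine ge_of_tendsto hcont ?_
    filter_upwards [self_mem_nhdsWithin] with δ hδ using step δ hδ
  -- By differentiability, loss minus gain equals `t L v` up to `δ t`; the sign of `L v` therefore
  -- selects the phase to which the one-sided bound applies.
  have hslope : ∀ δ : ℝ, 0 < δ → ∀ᶠ t in nhdsWithin (0 : ℝ) (Set.Ioi 0),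
      |(∫ x in {x | x ∈ Eᶜ ∧ x - t • v ∉ Eᶜ}, f x) - (∫ x in {x | x ∈ E ∧ x - t • v ∉ E}, f x) -
        t * L v| ≤ δ * t := by
    intro δ hδ
    have h1 := hder.isLittleO.def hδ
    have h2 : ∀ᶠ t in nhdsWithin (0 : ℝ) (Set.Ioi 0), _ := nhdsWithin_le_nhds h1
    filter_upwards [h2, self_mem_nhdsWithin] with t ht ht0
    have ht0' : (0 : ℝ) < t := ht0
    simp only [zero_smul, add_zero, sub_zero, smul_eq_mul, Real.norm_eq_abs] at ht
    rw [abs_of_pos ht0', setIntegral_translate_sub hf.continuous hfc hE (t • v)] at ht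
    simpa only [Set.mem_compl_iff, not_not] using ht
  constructor
  · intro hle
    refine final Eᶜ hE.compl H.compl fun δ hδ => ?_
    filter_upwards [hslope δ hδ, self_mem_nhdsWithin] with t h1 h2
    have h2' : (0 : ℝ) < t := h2
    rw [compl_compl]
    have := (abs_le.1 h1).2
    nlinarith
  · intro hge
    refine final E hE H fun δ hδ => ?_
    filter_upwards [hslope δ hδ, self_mem_nhdsWithin] with t h1 h2
    have h2' : (0 : ℝ) < t := h2
    have := (abs_le.1 h1).1
    nlinarith

end Direction

/-! ### The selected direction in the whole unit ball -/

section Limit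

variable {V : Type*} [NormedAddCommGroup V] [InnerProductSpace ℝ V] [FiniteDimensional ℝ V]
  [MeasurableSpace V] [BorelSpace V]

/-- The direction is that of the vector representing the functional. Orthogonally to it the
functional vanishes and both one-sided bounds hold; along it the value is nonnegative and one holds.
If the functional is zero, any unit vector works. -/
theorem ProductBound.exists_direction_of_lt_one [Nontrivial V] {E : Set V} (hE : MeasurableSet E)
    {ε t₀ : ℝ} (hε : 0 ≤ ε) (ht₀ : 0 < t₀) (H : ProductBound E ε t₀) {r : ℝ} (hr0 : 0 < r)
    (hr : r < 1) : ∃ e : V, ‖e‖ = 1 ∧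
      (∀ h : V, inner ℝ h e = 0 → volume (gainSet E r h) ≤ ENNReal.ofReal (ε * ‖h‖) ∧
        volume (gainSet Eᶜ r h) ≤ ENNReal.ofReal (ε * ‖h‖)) ∧
      ∀ s : ℝ, 0 ≤ s → volume (gainSet E r (s • e)) ≤ ENNReal.ofReal (ε * s) := by
  obtain ⟨ℓ, hℓ⟩ := H.exists_functional hE hε ht₀ hr0 hr
  obtain ⟨w, hw⟩ : ∃ w : V, ∀ v, ℓ v = inner ℝ v w :=
    ⟨(InnerProductSpace.toDual ℝ V).symm ℓ, fun v => by
      rw [real_inner_comm, InnerProductSpace.toDual_symm_apply]⟩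
  obtain ⟨e, he, hwe⟩ : ∃ e : V, ‖e‖ = 1 ∧ w = ‖w‖ • e := by
    rcases eq_or_ne w 0 with rfl | hw0
    · obtain ⟨e, he⟩ := exists_norm_eq V zero_le_one
      exact ⟨e, he, by simp⟩
    · have hn : ‖w‖ ≠ 0 := norm_ne_zero_iff.2 hw0
      exact ⟨‖w‖⁻¹ • w, by rw [norm_smul, norm_inv, norm_norm, inv_mul_cancel₀ hn],
        by rw [smul_smul, mul_inv_cancel₀ hn, one_smul]⟩
  refine ⟨e, he, fun h hh => ?_, fun s hs => (hℓ e he s hs).2 ?_⟩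
  · rcases eq_or_ne h 0 with rfl | h0
    · simp [gainSet]
    have hn : ‖h‖ ≠ 0 := norm_ne_zero_iff.2 h0
    have hu : ‖(‖h‖⁻¹ • h : V)‖ = 1 := by rw [norm_smul, norm_inv, norm_norm, inv_mul_cancel₀ hn]
    have hz : ℓ (‖h‖⁻¹ • h) = 0 := by
      rw [hw, hwe, inner_smul_left, inner_smul_right, hh, mul_zero, mul_zero]
    have := hℓ _ hu ‖h‖ (norm_nonneg h)
    rw [smul_smul, mul_inv_cancel₀ hn, one_smul] at this
    exact ⟨this.2 hz.ge, this.1 hz.le⟩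
  · rw [hw, hwe, inner_smul_right, real_inner_self_eq_norm_sq, he]
    positivity

theorem volume_gainSet_one_le {E : Set V} {h : V} {b : ℝ≥0∞}
    (H : ∀ r : ℝ, 0 < r → r < 1 → volume (gainSet E r h) ≤ b) : volume (gainSet E 1 h) ≤ b := by
  set r : ℕ → ℝ := fun i => 1 - 1 / ((i : ℝ) + 2) with hr
  have hr1 : ∀ i, r i < 1 := fun i => by
    have : (0 : ℝ) < 1 / ((i : ℝ) + 2) := by positivity
    simp only [hr]; linarith
  have hr0 : ∀ i, 0 < r i := fun i => by
    have : 1 / ((i : ℝ) + 2) < 1 := by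
      rw [div_lt_one (by positivity)]
      have : (0 : ℝ) ≤ i := by positivity
      linarith
    simp only [hr]; linarith
  have hmono : Monotone r := fun i j hij => by
    simp only [hr]
    have : 1 / ((j : ℝ) + 2) ≤ 1 / ((i : ℝ) + 2) := by gcongr
    linarith
  have hlim : Filter.Tendsto r Filter.atTop (nhds 1) := by
    have h1 := (tendsto_one_div_add_atTop_nhds_zero_nat (𝕜 := ℝ)).comp (Filter.tendsto_add_atTop_nat 1)
    have h2 := h1.const_sub 1
    rw [sub_zero] at h2
    refine h2.congr fun i => ?_
    simp only [hr, Function.comp]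
    push_cast
    ring_nf
  have hU : gainSet E 1 h = ⋃ i, gainSet E (r i) h := by
    ext x
    simp only [Set.mem_iUnion]
    constructor
    · rintro ⟨h1, h2, h3⟩
      obtain ⟨i, hi, hi'⟩ := ((hlim.eventually_const_lt h1).and (hlim.eventually_const_lt h2)).exists
      exact ⟨i, hi, hi', h3⟩
    · rintro ⟨i, h1, h2, h3⟩
      exact ⟨h1.trans (hr1 i), h2.trans (hr1 i), h3⟩
  have hmonoS : Monotone fun i => gainSet E (r i) h := fun i j hij x hx =>
    ⟨hx.1.trans_le (hmono hij), hx.2.1.trans_le (hmono hij), hx.2.2⟩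
  rw [hU, hmonoS.measure_iUnion]
  exact iSup_le fun i => H _ (hr0 i) (hr1 i)

/-- The bounds pass to the limit in the radius and the translation. -/
theorem volume_gainSet_le_of_tendsto {E : Set V} {ε D t₀ : ℝ} (ht₀ : 0 < t₀)
    (hD : ∀ h : V, ‖h‖ ≤ t₀ → volume (exitSet Eᶜ h) ≤ ENNReal.ofReal (D * ‖h‖))
    {rj cj : ℕ → ℝ} {hj : ℕ → V} {h : V} {c : ℝ} (hr : Filter.Tendsto rj Filter.atTop (nhds 1))
    (hh : Filter.Tendsto hj Filter.atTop (nhds h)) (hc : Filter.Tendsto cj Filter.atTop (nhds c))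
    (H : ∀ j, volume (gainSet E (rj j) (hj j)) ≤ ENNReal.ofReal (ε * cj j)) :
    volume (gainSet E 1 h) ≤ ENNReal.ofReal (ε * c) := by
  refine volume_gainSet_one_le fun r hr0 hr1 => ?_
  have hdiff : Filter.Tendsto (fun j => ‖hj j - h‖) Filter.atTop (nhds 0) := by
    have := (hh.sub_const h).norm
    rwa [sub_self, norm_zero] at this
  have hlim : Filter.Tendsto
      (fun j => ENNReal.ofReal (ε * cj j) + ENNReal.ofReal (D * ‖hj j - h‖)) Filter.atTop
      (nhds (ENNReal.ofReal (ε * c) + ENNReal.ofReal (D * 0))) :=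
    (ENNReal.tendsto_ofReal (hc.const_mul ε)).add (ENNReal.tendsto_ofReal (hdiff.const_mul D))
  rw [mul_zero, ENNReal.ofReal_zero, add_zero] at hlim
  refine ge_of_tendsto hlim ?_
  have e1 : ∀ᶠ j in Filter.atTop, ‖hj j - h‖ < t₀ := hdiff.eventually_lt_const ht₀
  have e2 : ∀ᶠ j in Filter.atTop, 0 < rj j - r - ‖hj j - h‖ := by
    have := ((hr.sub_const r).sub hdiff)
    exact this.eventually_const_lt (by linarith)
  filter_upwards [e1, e2] with j h1 h2
  -- A crossing along `h` is either a crossing along `hj j`, in the slightly larger ball, or a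
  -- crossing along the short vector `hj j - h`, which the linear bound `hD` makes negligible.
  have hsub : gainSet E r h ⊆ gainSet E (rj j) (hj j) ∪
      (fun x => x + -h) ⁻¹' exitSet Eᶜ (hj j - h) := by
    rintro x ⟨a1, a2, a3, a4⟩
    have hn := norm_nonneg (hj j - h)
    have a5 : x - hj j = x - h - (hj j - h) := by abel
    by_cases a6 : x - hj j ∈ E
    · right
      change x + -h ∈ exitSet Eᶜ (hj j - h)
      rw [← sub_eq_add_neg]
      exact ⟨a2.trans hr1, a4, by rw [← a5]; exact fun h => h a6⟩
    · left
      refine ⟨by linarith, ?_, a3, a6⟩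
      have := norm_sub_le (x - h) (hj j - h)
      rw [a5]; linarith
  refine (measure_mono hsub).trans ((measure_union_le _ _).trans (add_le_add (H j) ?_))
  rw [measure_preimage_add_right]
  exact hD _ h1.le

/-- Stability selects a direction `e`: the set varies little in the directions orthogonal to `e`,
and is almost monotone in the direction `e`. -/
theorem ProductBound.exists_direction [Nontrivial V] {E : Set V} (hE : MeasurableSet E)
    {ε t₀ : ℝ} (hε : 0 ≤ ε) (ht₀ : 0 < t₀) (H : ProductBound E ε t₀) : ∃ e : V, ‖e‖ = 1 ∧
      (∀ h : V, inner ℝ h e = 0 → volume (gainSet E 1 h) ≤ ENNReal.ofReal (ε * ‖h‖) ∧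
        volume (gainSet Eᶜ 1 h) ≤ ENNReal.ofReal (ε * ‖h‖)) ∧
      ∀ s : ℝ, 0 ≤ s → volume (gainSet E 1 (s • e)) ≤ ENNReal.ofReal (ε * s) := by
  have hd : 1 ≤ Module.finrank ℝ V := Module.finrank_pos
  have hD : ∀ F : Set V, MeasurableSet F → ProductBound F ε t₀ → ∀ h : V, ‖h‖ ≤ t₀ →
      volume (exitSet Fᶜ h) ≤ ENNReal.ofReal ((shellConst V + 2 * ε) * ‖h‖) :=
    fun F hF HF h hh => le_add_self.trans (HF.volume_add_le hd hF hε hh)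
  set r : ℕ → ℝ := fun i => 1 - 1 / ((i : ℝ) + 2) with hr
  have hr1 : ∀ i, r i < 1 := fun i => by
    have : (0 : ℝ) < 1 / ((i : ℝ) + 2) := by positivity
    simp only [hr]; linarith
  have hr0 : ∀ i, 0 < r i := fun i => by
    have : 1 / ((i : ℝ) + 2) < 1 := by
      rw [div_lt_one (by positivity)]
      have : (0 : ℝ) ≤ i := by positivity
      linarith
    simp only [hr]; linarith
  have hlim : Filter.Tendsto r Filter.atTop (nhds 1) := by
    have h1 := (tendsto_one_div_add_atTop_nhds_zero_nat (𝕜 := ℝ)).comp (Filter.tendsto_add_atTop_nat 1)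
    have h2 := h1.const_sub 1
    rw [sub_zero] at h2
    refine h2.congr fun i => ?_
    simp only [hr, Function.comp]
    push_cast
    ring_nf
  -- The direction depends on the radius; compactness of the sphere gives a limiting direction as
  -- the radius tends to one.
  choose e he hperp hvert using fun i => H.exists_direction_of_lt_one hE hε ht₀ (hr0 i) (hr1 i)
  obtain ⟨a, ha, φ, hφ, hlima⟩ := (isCompact_sphere (0 : V) 1).tendsto_subseq
    (x := e) fun i => by simpa using he i
  have hlimr : Filter.Tendsto (fun i => r (φ i)) Filter.atTop (nhds 1) :=
    hlim.comp hφ.tendsto_atTop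
  refine ⟨a, by simpa using ha, fun h hh => ?_, fun s hs => ?_⟩
  -- Project `h` orthogonally to the approximating directions, so that their two-sided bounds apply
  -- before the limit.
  · set hj : ℕ → V := fun j => h - (inner ℝ h (e (φ j)) : ℝ) • e (φ j) with hhj
    have hort : ∀ j, inner ℝ (hj j) (e (φ j)) = 0 := fun j => by
      simp only [hhj]
      rw [inner_sub_left, inner_smul_left, real_inner_self_eq_norm_sq, he]
      simp
    have hhlim : Filter.Tendsto hj Filter.atTop (nhds h) := by
      have h1 : Filter.Tendsto (fun j => e (φ j)) Filter.atTop (nhds a) := hlima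
      have h2 := (tendsto_const_nhds (x := h)).inner h1 (𝕜 := ℝ)
      have h3 := (tendsto_const_nhds (x := h)).sub (h2.smul h1)
      rwa [hh, zero_smul, sub_zero] at h3
    constructor
    · refine volume_gainSet_le_of_tendsto ht₀ (hD E hE H) hlimr hhlim hhlim.norm fun j =>
        (hperp (φ j) (hj j) (hort j)).1
    · refine volume_gainSet_le_of_tendsto ht₀ (hD Eᶜ hE.compl H.compl) hlimr hhlim hhlim.norm
        fun j => (hperp (φ j) (hj j) (hort j)).2
  · have h1 : Filter.Tendsto (fun j => s • e (φ j)) Filter.atTop (nhds (s • a)) :=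
      hlima.const_smul s
    exact volume_gainSet_le_of_tendsto ht₀ (hD E hE H) hlimr h1 (tendsto_const_nhds (x := s))
      fun j => hvert (φ j) s hs

end Limit

/-! ### Sets on a line with rare upward crossings -/

section Line

/-- The points of `A` in `(-ρ, ρ)` whose translate by `-t` is in the interval but not in `A`. -/
def lineGain (A : Set ℝ) (ρ t : ℝ) : Set ℝ := {s | |s| < ρ ∧ |s - t| < ρ ∧ s ∈ A ∧ s - t ∉ A}

theorem exists_switch {A : Set ℝ} {s t : ℝ} {N : ℕ} (h0 : s ∉ A) (hN : s + N * t ∈ A) :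
    ∃ i < N, s + i * t ∉ A ∧ s + (i + 1) * t ∈ A := by
  induction N with
  | zero => simp at hN; exact absurd hN h0
  | succ N ih =>
    by_cases h : s + N * t ∈ A
    · obtain ⟨i, hi, h'⟩ := ih h
      exact ⟨i, hi.trans (Nat.lt_succ_self N), h'⟩
    · exact ⟨N, Nat.lt_succ_self N, h, by push_cast at hN; exact hN⟩

/-- Each chain `s, s + t, …, s + N t` that begins outside `A` and ends in `A` makes an upward step.
The landing points of the `i`-th steps lie in pairwise disjoint windows, so counting starting points
by their first found step loses no measure. -/
theorem volume_switch_le_lineGain {A : Set ℝ} (hA : MeasurableSet A) {p q ρ t : ℝ} {N : ℕ}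
    (hp : -ρ < p) (ht : 0 < t) (hN : p + N * t ≤ q) (hq : q + t < ρ) :
    volume {s | s ∈ Set.Ico p (p + t) ∧ s ∉ A ∧ s + N * t ∈ A} ≤ volume (lineGain A ρ t) := by
  set U : ℕ → Set ℝ := fun i => {x | x ∈ Set.Ico (p + (i + 1) * t) (p + (i + 2) * t) ∧ x ∈ A ∧
    x - t ∉ A} with hU
  have mU : ∀ i, MeasurableSet (U i) := fun i =>
    measurableSet_Ico.inter (hA.inter (measurableSet_preimage (measurable_sub_const t) hA).compl)
  have hsub : {s | s ∈ Set.Ico p (p + t) ∧ s ∉ A ∧ s + N * t ∈ A} ⊆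
      ⋃ i ∈ Finset.range N, (fun s => s + (i + 1) * t) ⁻¹' U i := by
    rintro s ⟨hs, h0, h1⟩
    obtain ⟨i, hi, h2, h3⟩ := exists_switch h0 h1
    simp only [Set.mem_iUnion, Finset.mem_range]
    refine ⟨i, hi, ⟨by linarith [hs.1], by linarith [hs.2]⟩, h3, ?_⟩
    have : s + (i + 1) * t - t = s + i * t := by ring
    simp only [this]; exact h2
  have hdisj : ∀ i j : ℕ, i < j → Disjoint (U i) (U j) := fun i j hij => by
    refine Set.disjoint_left.2 fun x hx hx' => ?_
    have h1 := hx.1.2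
    have h2 := hx'.1.1
    have h3 : (i : ℝ) + 1 ≤ j := by exact_mod_cast hij
    nlinarith
  have hpair : Set.PairwiseDisjoint (Finset.range N : Set ℕ) U := fun i _ j _ hij => by
    rcases lt_or_gt_of_ne hij with h | h
    · exact hdisj i j h
    · exact (hdisj j i h).symm
  have hsub2 : (⋃ i ∈ Finset.range N, U i) ⊆ lineGain A ρ t := by
    intro x hx
    simp only [Set.mem_iUnion, Finset.mem_range] at hx
    obtain ⟨i, hi, ⟨h1, h2⟩, h3, h4⟩ := hx
    have h5 : (i : ℝ) + 1 ≤ N := by exact_mod_cast hi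
    have h6 : (0 : ℝ) ≤ i := by positivity
    refine ⟨abs_lt.2 ⟨by nlinarith, by nlinarith⟩, abs_lt.2 ⟨by nlinarith, by nlinarith⟩, h3, h4⟩
  calc _ ≤ ∑ i ∈ Finset.range N, volume ((fun s => s + ((i : ℝ) + 1) * t) ⁻¹' U i) :=
        (measure_mono hsub).trans (measure_biUnion_finset_le _ _)
    _ = ∑ i ∈ Finset.range N, volume (U i) :=
        Finset.sum_congr rfl fun i _ => measure_preimage_add_right _ _ _
    _ = volume (⋃ i ∈ Finset.range N, U i) :=
        (measure_biUnion_finset hpair fun i _ => mU i).symm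
    _ ≤ _ := measure_mono hsub2

open Filter in
-- Near the density-zero point `p` almost every start is outside `A`, and near the density-one point
-- `q > p` almost every end is in `A`. Hence almost all chains of step `t` from one to the other
-- contribute a crossing, for a total of nearly `t`.
theorem one_le_liminf_lineGain {A : Set ℝ} (hA : MeasurableSet A) {p q ρ : ℝ} (hp : -ρ < p)
    (hpq : p < q) (hq : q < ρ)
    (dp : Tendsto (fun r => volume (A ∩ Metric.closedBall p r) / volume (Metric.closedBall p r))
      (nhdsWithin 0 (Set.Ioi 0)) (nhds 0))
    (dq : Tendsto (fun r => volume (A ∩ Metric.closedBall q r) / volume (Metric.closedBall q r))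
      (nhdsWithin 0 (Set.Ioi 0)) (nhds 1)) {τ : ℕ → ℝ} (hτ : ∀ i, 0 < τ i)
    (hτl : Tendsto τ atTop (nhds 0)) :
    1 ≤ liminf (fun i => volume (lineGain A ρ (τ i)) / ENNReal.ofReal (τ i)) atTop := by
  have hτ' : Tendsto τ atTop (nhdsWithin 0 (Set.Ioi 0)) :=
    tendsto_nhdsWithin_iff.2 ⟨hτl, .of_forall hτ⟩
  refine le_of_forall_lt fun c hc => ?_
  obtain ⟨c', hc1, hc2⟩ := exists_between hc
  have hct : c' ≠ ∞ := (hc2.trans ENNReal.one_lt_top).ne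
  refine lt_of_lt_of_le hc1 (le_liminf_of_le (by isBoundedDefault) ?_)
  -- The exceptional starts and ends have measure at most `2δt` each, so the remaining fraction is
  -- exactly `c'`.
  set δ : ℝ := (1 - c'.toReal) / 4 with hδ
  have hc'1 : c'.toReal < 1 := by
    have := (ENNReal.toReal_lt_toReal hct ENNReal.one_ne_top).2 hc2; simpa using this
  have hδ0 : 0 < δ := by rw [hδ]; linarith
  have hδ1 : δ ≤ 1 / 4 := by rw [hδ]; linarith [ENNReal.toReal_nonneg (a := c')]
  have ev1 := hτ'.eventually (dp.eventually_lt_const (u := ENNReal.ofReal δ) (by simpa using hδ0))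
  have ev2 := hτ'.eventually (dq.eventually_const_lt (u := ENNReal.ofReal (1 - δ)) (by
    rw [← ENNReal.ofReal_one]; exact (ENNReal.ofReal_lt_ofReal_iff one_pos).2 (by linarith)))
  have ev3 : ∀ᶠ i in atTop, τ i < ρ - q := hτl.eventually_lt_const (by linarith)
  filter_upwards [ev1, ev2, ev3] with i h1 h2 h3
  have ht := hτ i
  set t := τ i
  -- This makes `q - t < p + N t ≤ q`, so chains starting in `[p, p + t)` end within distance `t` of
  -- `q`.
  set N := ⌊(q - p) / t⌋₊ with hN
  have hNle : p + N * t ≤ q := by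
    have := Nat.floor_le (div_nonneg (by linarith : 0 ≤ q - p) ht.le)
    rw [le_div_iff₀ ht] at this; linarith
  have hNgt : q < p + N * t + t := by
    have := Nat.lt_floor_add_one ((q - p) / t)
    rw [div_lt_iff₀ ht] at this; linarith
  have hvol : ∀ x : ℝ, volume (Metric.closedBall x t) = ENNReal.ofReal (2 * t) :=
    fun x => Real.volume_closedBall x t
  rw [hvol] at h1 h2
  have h2t : ENNReal.ofReal (2 * t) ≠ 0 := by simp [ht]
  rw [ENNReal.div_lt_iff (Or.inl h2t) (Or.inl ENNReal.ofReal_ne_top),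
    ← ENNReal.ofReal_mul hδ0.le] at h1
  rw [ENNReal.lt_div_iff_mul_lt (Or.inl h2t) (Or.inl ENNReal.ofReal_ne_top),
    ← ENNReal.ofReal_mul (by linarith)] at h2
  have h4 : volume (Metric.closedBall q t \ A) ≤ ENNReal.ofReal (δ * (2 * t)) := by
    have hsum := measure_inter_add_sdiff (μ := volume) (Metric.closedBall q t) hA
    rw [Set.inter_comm, hvol] at hsum
    have hfin : volume (A ∩ Metric.closedBall q t) ≠ ∞ :=
      ne_top_of_le_ne_top ENNReal.ofReal_ne_top ((measure_mono Set.inter_subset_right).trans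
        (hvol q).le)
    refine (ENNReal.add_le_add_iff_left hfin).1 ?_
    rw [hsum]
    refine le_trans ?_ (add_le_add_left h2.le _)
    rw [← ENNReal.ofReal_add (by nlinarith) (by positivity)]
    refine ENNReal.ofReal_le_ofReal (by nlinarith)
  set T := {s | s ∈ Set.Ico p (p + t) ∧ s ∉ A ∧ s + N * t ∈ A} with hT
  have hcover : Set.Ico p (p + t) ⊆ T ∪ (A ∩ Metric.closedBall p t) ∪
      (fun s => s + N * t) ⁻¹' (Metric.closedBall q t \ A) := by
    intro s hs
    by_cases a1 : s ∈ A
    · left; right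
      refine ⟨a1, ?_⟩
      rw [Metric.mem_closedBall, Real.dist_eq, abs_le]
      exact ⟨by linarith [hs.1], by linarith [hs.2]⟩
    by_cases a2 : s + N * t ∈ A
    · left; left; exact ⟨hs, a1, a2⟩
    · right
      refine ⟨?_, a2⟩
      rw [Metric.mem_closedBall, Real.dist_eq, abs_le]
      exact ⟨by linarith [hs.1], by linarith [hs.2]⟩
  have h5 : ENNReal.ofReal t ≤ volume T + ENNReal.ofReal (δ * (2 * t)) +
      ENNReal.ofReal (δ * (2 * t)) := by
    have := (measure_mono (μ := volume) hcover).trans ((measure_union_le _ _).trans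
      (add_le_add (measure_union_le _ _) le_rfl))
    rw [Real.volume_Ico, add_sub_cancel_left, measure_preimage_add_right] at this
    exact this.trans (add_le_add (add_le_add le_rfl h1.le) h4)
  have h6 := volume_switch_le_lineGain hA hp ht hNle (by linarith : q + t < ρ)
  rw [ENNReal.le_div_iff_mul_le (Or.inl (by simp [ht])) (Or.inl ENNReal.ofReal_ne_top),
    ← ENNReal.ofReal_toReal hct, ← ENNReal.ofReal_mul ENNReal.toReal_nonneg]
  have hfin : ENNReal.ofReal (δ * (2 * t)) + ENNReal.ofReal (δ * (2 * t)) ≠ ∞ := by simp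
  refine (ENNReal.add_le_add_iff_right hfin).1 ?_
  rw [← ENNReal.ofReal_add (by positivity) (by positivity), ← ENNReal.ofReal_add (by positivity)
    (by positivity)]
  have e : c'.toReal * t + (δ * (2 * t) + δ * (2 * t)) = t := by rw [hδ]; ring
  rw [e, ENNReal.ofReal_add (by positivity) (by positivity), ← add_assoc]
  exact h5.trans (by gcongr)

open Filter in
/-- A set in an interval whose upward crossings are rare is a.e. an initial segment. -/
theorem ae_mem_iff_le_of_liminf_lt_one {A : Set ℝ} (hA : MeasurableSet A) {ρ : ℝ} (hρ : 0 < ρ)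
    {τ : ℕ → ℝ} (hτ : ∀ i, 0 < τ i) (hτl : Tendsto τ atTop (nhds 0))
    (h : liminf (fun i => volume (lineGain A ρ (τ i)) / ENNReal.ofReal (τ i)) atTop < 1) :
    ∀ᵐ s, |s| < ρ → (s ∈ A ↔ s ≤ volume.real (A ∩ {s | |s| < ρ}) - ρ) := by
  set dens : ℝ → ℝ≥0∞ → Prop := fun x d =>
    Tendsto (fun r => volume (A ∩ Metric.closedBall x r) / volume (Metric.closedBall x r))
      (nhdsWithin 0 (Set.Ioi 0)) (nhds d) with hdens
  set Q : Set ℝ := {x | |x| < ρ ∧ x ∈ A ∧ dens x 1} with hQ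
  have hae := Besicovitch.ae_tendsto_measure_inter_div_of_measurableSet (volume : Measure ℝ) hA
  -- A density-one point above a density-zero point would force a crossing rate of at least one. By
  -- Lebesgue density almost every point is of one of these types, so `A` is almost everywhere below
  -- the supremum of `Q`.
  have key : ∀ p, |p| < ρ → p ∉ A → dens p 0 → ∀ q ∈ Q, q ≤ p := by
    intro p hp hpA hpd q hq
    by_contra hlt
    push Not at hlt
    exact absurd (one_le_liminf_lineGain hA (abs_lt.1 hp).1 hlt (abs_lt.1 hq.1).2 hpd hq.2.2 hτ hτl)
      (not_le.2 h)
  set S : Set ℝ := insert (-ρ) Q with hS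
  have hSb : BddAbove S := ⟨ρ, by
    rintro x (rfl | hx)
    · linarith
    · exact (abs_lt.1 hx.1).2.le⟩
  set g := sSup S with hg
  have hg1 : -ρ ≤ g := le_csSup hSb (Set.mem_insert _ _)
  have hg2 : g ≤ ρ := csSup_le ⟨-ρ, Set.mem_insert _ _⟩ (by
    rintro x (rfl | hx)
    · linarith
    · exact (abs_lt.1 hx.1).2.le)
  have hmain : ∀ᵐ s, |s| < ρ → (s ∈ A ↔ s ≤ g) := by
    have hne : ∀ᵐ s : ℝ, s ≠ g := by simp [ae_iff]
    filter_upwards [hae, hne] with s hs hsg hsρ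
    by_cases hsA : s ∈ A
    · rw [Set.indicator_of_mem hsA] at hs
      refine iff_of_true hsA (le_csSup hSb (Or.inr ⟨hsρ, hsA, hs⟩))
    · rw [Set.indicator_of_notMem hsA] at hs
      refine iff_of_false hsA fun hle => hsg (le_antisymm hle ?_)
      refine csSup_le ⟨-ρ, Set.mem_insert _ _⟩ ?_
      rintro x (rfl | hx)
      · exact (abs_lt.1 hsρ).1.le
      · exact key s hsρ hsA hs x hx
  -- The height is recovered from the length of the set. This formula, unlike the supremum, is
  -- visibly measurable when the line varies.
  have hvol : volume (A ∩ {s | |s| < ρ}) = ENNReal.ofReal (g + ρ) := by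
    have : (A ∩ {s | |s| < ρ} : Set ℝ) =ᵐ[volume] Set.Ioo (-ρ) g := by
      have hne : ∀ᵐ s : ℝ, s ≠ g := by simp [ae_iff]
      filter_upwards [hmain, hne] with s hs hsg
      refine propext ?_
      change s ∈ A ∧ |s| < ρ ↔ s ∈ Set.Ioo (-ρ) g
      constructor
      · rintro ⟨h1, h2⟩
        exact ⟨(abs_lt.1 h2).1, lt_of_le_of_ne ((hs h2).1 h1) hsg⟩
      · rintro ⟨h1, h2⟩
        have h3 : |s| < ρ := abs_lt.2 ⟨h1, h2.trans_le hg2⟩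
        exact ⟨(hs h3).2 h2.le, h3⟩
    rw [measure_congr this, Real.volume_Ioo, sub_neg_eq_add]
  have hreal : volume.real (A ∩ {s | |s| < ρ}) - ρ = g := by
    rw [Measure.real, hvol, ENNReal.toReal_ofReal (by linarith)]; ring
  rw [hreal]
  exact hmain

end Line

/-! ### Subgraphs outside a small cylinder -/

section Subgraph

variable {X : Type*} [NormedAddCommGroup X] [InnerProductSpace ℝ X] [FiniteDimensional ℝ X]
  [MeasurableSpace X] [BorelSpace X]

/-- The points of `A` in the unit ball of `X × ℝ` whose vertical translate by `-t` is in the unit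
ball but not in `A`. -/
def vertGain (A : Set (X × ℝ)) (t : ℝ) : Set (X × ℝ) :=
  {p | ‖p.1‖ ^ 2 + p.2 ^ 2 < 1 ∧ ‖p.1‖ ^ 2 + (p.2 - t) ^ 2 < 1 ∧ p ∈ A ∧ (p.1, p.2 - t) ∉ A}

theorem measurableSet_vertGain {A : Set (X × ℝ)} (hA : MeasurableSet A) (t : ℝ) :
    MeasurableSet (vertGain A t) := by
  have h1 : MeasurableSet {p : X × ℝ | ‖p.1‖ ^ 2 + p.2 ^ 2 < 1} :=
    measurableSet_lt (by fun_prop) measurable_const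
  have h2 : MeasurableSet {p : X × ℝ | ‖p.1‖ ^ 2 + (p.2 - t) ^ 2 < 1} :=
    measurableSet_lt (by fun_prop) measurable_const
  have h3 : Measurable fun p : X × ℝ => (p.1, p.2 - t) := by fun_prop
  exact h1.inter (h2.inter (hA.inter (h3 hA).compl))

theorem add_sq_lt_one_iff {a s : ℝ} : a ^ 2 + s ^ 2 < 1 ↔ |s| < √(1 - a ^ 2) := by
  rw [Real.lt_sqrt (abs_nonneg s), sq_abs]
  constructor <;> intro h <;> linarith

theorem mk_preimage_vertGain (A : Set (X × ℝ)) (t : ℝ) (y : X) :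
    Prod.mk y ⁻¹' vertGain A t = lineGain (Prod.mk y ⁻¹' A) √(1 - ‖y‖ ^ 2) t := by
  ext s
  simp only [vertGain, lineGain, Set.mem_preimage, Set.mem_ofPred_eq, add_sq_lt_one_iff]

open Filter in
/-- A set in the unit ball of `X × ℝ` whose upward crossings are rare is a subgraph outside a
cylinder over a small set. -/
theorem exists_subgraph {A : Set (X × ℝ)} (hA : MeasurableSet A) {ε : ℝ}
    (hV : ∀ t, 0 ≤ t → volume (vertGain A t) ≤ ENNReal.ofReal (ε * t)) :
    ∃ (B : Set X) (g : X → ℝ), MeasurableSet B ∧ B ⊆ Metric.ball 0 1 ∧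
      volume B ≤ ENNReal.ofReal ε ∧ Measurable g ∧ (∀ y, g y ∈ Set.Icc (-1 : ℝ) 1) ∧
      ∀ y, y ∉ B → ∀ᵐ s : ℝ, ‖y‖ ^ 2 + s ^ 2 < 1 → ((y, s) ∈ A ↔ s ≤ g y) := by
  set τ : ℕ → ℝ := fun j => 1 / ((j : ℝ) + 1) with hτ
  have hτ0 : ∀ j, 0 < τ j := fun j => by positivity
  have hτl : Tendsto τ atTop (nhds 0) := tendsto_one_div_add_atTop_nhds_zero_nat
  set D : ℕ → X → ℝ≥0∞ := fun j y =>
    volume (Prod.mk y ⁻¹' vertGain A (τ j)) / ENNReal.ofReal (τ j) with hD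
  have mD : ∀ j, Measurable (D j) := fun j =>
    (measurable_measure_prodMk_left (measurableSet_vertGain hA _)).div_const _
  set L : X → ℝ≥0∞ := fun y => liminf (fun j => D j y) atTop with hL
  have mL : Measurable L := Measurable.liminf mD
  have hDint : ∀ j, ∫⁻ y, D j y ≤ ENNReal.ofReal ε := fun j => by
    have h := hV (τ j) (hτ0 j).le
    rw [Measure.volume_eq_prod, Measure.prod_apply (measurableSet_vertGain hA _)] at h
    simp only [hD, div_eq_mul_inv]
    rw [lintegral_mul_const _ (measurable_measure_prodMk_left (measurableSet_vertGain hA _)),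
      ← div_eq_mul_inv]
    refine ENNReal.div_le_of_le_mul (h.trans_eq ?_)
    rw [ENNReal.ofReal_mul' (hτ0 j).le]
  -- Fatou's lemma; Markov's inequality at level one then bounds the bad set, formed by the lines
  -- whose crossing rate does not have lower limit below one.
  have hLint : ∫⁻ y, L y ≤ ENNReal.ofReal ε := by
    refine (lintegral_liminf_le mD).trans ?_
    refine liminf_le_of_frequently_le' (Frequently.of_forall hDint)
  set V : X → ℝ := fun y =>
    volume.real (Prod.mk y ⁻¹' (A ∩ {p : X × ℝ | ‖p.1‖ ^ 2 + p.2 ^ 2 < 1})) - √(1 - ‖y‖ ^ 2)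
    with hVdef
  have h1 : MeasurableSet {p : X × ℝ | ‖p.1‖ ^ 2 + p.2 ^ 2 < 1} :=
    measurableSet_lt (by fun_prop) measurable_const
  have mV : Measurable V :=
    ((measurable_measure_prodMk_left (hA.inter h1)).ennreal_toReal).sub (by fun_prop)
  -- Clamping the height to `[-1, 1]` changes nothing inside the ball, where `|s| < 1`.
  refine ⟨{y | 1 ≤ L y} ∩ Metric.ball 0 1, fun y => max (-1) (min 1 (V y)),
    (measurableSet_le measurable_const mL).inter Metric.isOpen_ball.measurableSet,
    Set.inter_subset_right, ?_, by fun_prop, fun y => ⟨le_max_left _ _,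
      max_le (by norm_num) (min_le_left _ _)⟩, ?_⟩
  · refine (measure_mono Set.inter_subset_left).trans (le_trans ?_ hLint)
    have := mul_meas_ge_le_lintegral (μ := volume) mL 1
    rwa [one_mul] at this
  · intro y hy
    by_cases hy1 : ‖y‖ < 1
    · have hρ : 0 < √(1 - ‖y‖ ^ 2) := Real.sqrt_pos.2 (by nlinarith [norm_nonneg y])
      have hρ1 : √(1 - ‖y‖ ^ 2) ≤ 1 := Real.sqrt_le_one.2 (by nlinarith [norm_nonneg y])
      have hlt : L y < 1 := by
        by_contra hcon
        exact hy ⟨not_lt.1 hcon, by simpa using hy1⟩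
      have hmain := ae_mem_iff_le_of_liminf_lt_one (A := Prod.mk y ⁻¹' A)
        (measurable_prodMk_left hA) hρ hτ0 hτl (by
          simpa only [hL, hD, mk_preimage_vertGain] using hlt)
      have hset : Prod.mk y ⁻¹' A ∩ {s | |s| < √(1 - ‖y‖ ^ 2)} =
          Prod.mk y ⁻¹' (A ∩ {p : X × ℝ | ‖p.1‖ ^ 2 + p.2 ^ 2 < 1}) := by
        ext s
        simp only [Set.mem_inter_iff, Set.mem_preimage, Set.mem_ofPred_eq, add_sq_lt_one_iff]
      rw [hset] at hmain
      filter_upwards [hmain] with s hs hs1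
      rw [add_sq_lt_one_iff] at hs1
      rw [show (y, s) ∈ A ↔ s ≤ V y from hs hs1]
      have h2 := abs_lt.1 hs1
      constructor
      · intro h
        exact le_max_of_le_right (le_min (by linarith) h)
      · intro h
        rcases le_max_iff.1 h with h | h
        · linarith
        · exact h.trans (min_le_right _ _)
    · refine Filter.Eventually.of_forall fun s hs => ?_
      nlinarith [sq_nonneg s]

end Subgraph

/-! ### Monotone majority phase of slices -/

section Threshold

/-- The volume of the slice at height `s` of a unit ball in dimension `m + 1`, if `ω` is the volume
of the unit ball in dimension `m`. -/
noncomputable def sliceVol (m : ℕ) (ω s : ℝ) : ℝ := ω * √(1 - s ^ 2) ^ m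

variable {m : ℕ} {ω : ℝ}

theorem continuous_sliceVol : Continuous (sliceVol m ω) := by unfold sliceVol; fun_prop

theorem sliceVol_nonneg (hω : 0 ≤ ω) (s : ℝ) : 0 ≤ sliceVol m ω s := by
  unfold sliceVol; positivity

theorem sliceVol_neg (s : ℝ) : sliceVol m ω (-s) = sliceVol m ω s := by simp [sliceVol]

theorem sliceVol_eq_zero (hm : m ≠ 0) {s : ℝ} (hs : 1 ≤ |s|) : sliceVol m ω s = 0 := by
  have : 1 - s ^ 2 ≤ 0 := by nlinarith [sq_abs s]
  simp [sliceVol, Real.sqrt_eq_zero_of_nonpos this, hm]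

theorem sliceVol_antitone (hω : 0 ≤ ω) {s s' : ℝ} (h : |s| ≤ |s'|) :
    sliceVol m ω s' ≤ sliceVol m ω s := by
  have : 1 - s' ^ 2 ≤ 1 - s ^ 2 := by linarith [sq_le_sq.2 h]
  unfold sliceVol
  gcongr

theorem sliceVol_le_four_pow_mul (hω : 0 ≤ ω) {s s' : ℝ} (h : 1 - s ^ 2 ≤ 16 * (1 - s' ^ 2)) :
    sliceVol m ω s ≤ 4 ^ m * sliceVol m ω s' := by
  have h1 : √(1 - s ^ 2) ≤ 4 * √(1 - s' ^ 2) := by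
    refine (Real.sqrt_le_sqrt h).trans_eq ?_
    rw [Real.sqrt_mul (by norm_num), show (16 : ℝ) = 4 ^ 2 by norm_num,
      Real.sqrt_sq (by norm_num)]
  unfold sliceVol
  calc ω * √(1 - s ^ 2) ^ m ≤ ω * (4 * √(1 - s' ^ 2)) ^ m := by gcongr
    _ = _ := by rw [mul_pow]; ring

/-- Above height `-1/2`, a higher slice of the ball is at most a bounded factor larger than a lower
one. -/
theorem sliceVol_le_of_le (hω : 0 ≤ ω) {s s' : ℝ} (hs : -(1 / 2) ≤ s) (h : s ≤ s') (h1 : s' < 1) :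
    sliceVol m ω s' ≤ 4 ^ m * sliceVol m ω s :=
  sliceVol_le_four_pow_mul hω (by nlinarith)

/-- Factor `1 - s²` as `(1 - s)(1 + s)`: above `-1/2` the second factors differ by at most four, and
by hypothesis so do the depths. -/
theorem sliceVol_le_of_depth (hω : 0 ≤ ω) {s s' : ℝ} (hs : -(1 / 2) ≤ s) (h : s ≤ s') (h1 : s' < 1)
    (hd : 1 - s ≤ 4 * (1 - s')) : sliceVol m ω s ≤ 4 ^ m * sliceVol m ω s' :=
  sliceVol_le_four_pow_mul hω (by nlinarith)

/-- A slice in which the minority phase has small relative volume. -/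
def GoodSlice (m : ℕ) (ω : ℝ) (p : ℝ → ℝ) (s : ℝ) : Prop :=
  |s| < 1 ∧ 4 * 4 ^ m * p s < sliceVol m ω s

/-- A slice bounding a cap of volume large compared with `Q`. -/
def ThickSlice (m : ℕ) (ω Q : ℝ) (s : ℝ) : Prop :=
  |s| < 1 ∧ 8 * (4 ^ m) ^ 2 * Q < (1 - |s|) * sliceVol m ω s

theorem mul_le_of_forall_le {p : ℝ → ℝ} {Q : ℝ} (hQ : 0 ≤ Q)
    (hp : ∫⁻ s, ENNReal.ofReal (p s) ≤ ENNReal.ofReal Q) {a b c : ℝ} (hc : 0 ≤ c)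
    (h : ∀ s, a < s → s < b → c ≤ p s) : (b - a) * c ≤ Q := by
  have h1 : ∫⁻ s in Set.Ioo a b, ENNReal.ofReal c ≤ ∫⁻ s, ENNReal.ofReal (p s) := by
    refine le_trans (setLIntegral_mono' measurableSet_Ioo fun s hs => ?_)
      (setLIntegral_le_lintegral (Set.Ioo a b) _)
    exact ENNReal.ofReal_le_ofReal (h s hs.1 hs.2)
  rw [setLIntegral_const, Real.volume_Ioo, ← ENNReal.ofReal_mul hc] at h1
  have := (ENNReal.ofReal_le_ofReal_iff hQ).1 (h1.trans hp)
  linarith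

/-- Two good slices of comparable volume exceeding `4Q` cannot be inverted, by `hF`. For general
heights, take the highest level `σ` approached by good empty slices below `f`. Either `f` has depth
comparable with that of `σ`, and a direct comparison applies, or every slice in the lower half of
the cap above `σ` is bad. The bad slices would then carry enough minority volume to contradict the
thickness of `f`. -/
theorem no_inversion_upper (hω : 0 ≤ ω) {p : ℝ → ℝ} (hp0 : ∀ s, 0 ≤ p s) {Q : ℝ} (hQ : 0 ≤ Q)
    (hp : ∫⁻ s, ENNReal.ofReal (p s) ≤ ENNReal.ofReal Q) {F : Set ℝ}
    (hF : ∀ e f, e < f → |e| < 1 → |f| < 1 → e ∉ F → f ∈ F →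
      min (sliceVol m ω e) (sliceVol m ω f) ≤ Q + p e + p f)
    {e f : ℝ} (he : -(1 / 2) ≤ e) (hef : e < f) (ge : GoodSlice m ω p e) (heF : e ∉ F)
    (gf : GoodSlice m ω p f) (tf : ThickSlice m ω Q f) (hfF : f ∈ F) : False := by
  set w := sliceVol m ω with hw
  set L : ℝ := 4 ^ m with hL
  have hL1 : 1 ≤ L := one_le_pow₀ (by norm_num)
  have hf1 : f < 1 := (abs_lt.1 gf.1).2
  set S : Set ℝ := {s | e ≤ s ∧ s < f ∧ GoodSlice m ω p s ∧ s ∉ F} with hS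
  have heS : e ∈ S := ⟨le_rfl, hef, ge, heF⟩
  have hSb : BddAbove S := ⟨f, fun x hx => hx.2.1.le⟩
  set σ := sSup S with hσ
  have hσe : e ≤ σ := le_csSup hSb heS
  have hσf : σ ≤ f := csSup_le ⟨e, heS⟩ fun x hx => hx.2.1.le
  -- This choice gives `1 - s₀ < 2(1 - σ)`, hence `1 - s₀ ≤ 4(1 - s)` for the slices `s` compared
  -- below.
  obtain ⟨s₀, hs₀, hlt⟩ := exists_lt_of_lt_csSup ⟨e, heS⟩ (show σ - (1 - σ) < sSup S by linarith)
  have hs₀σ : s₀ ≤ σ := le_csSup hSb hs₀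
  have hfw : 8 * L ^ 2 * Q < (1 - f) * w f :=
    tf.2.trans_le (mul_le_mul_of_nonneg_right (by linarith [le_abs_self f]) (sliceVol_nonneg hω _))
  have hwf : 8 * L ^ 2 * Q < w f := by
    refine tf.2.trans_le ?_
    have := abs_nonneg f
    have := sliceVol_nonneg (m := m) hω f
    nlinarith
  have hQ4 : ∀ x, w f ≤ L * x → 4 * Q < x := by
    intro x hx
    by_contra hcon
    push Not at hcon
    have h1 : L * x ≤ L * (4 * Q) := mul_le_mul_of_nonneg_left hcon (by positivity)
    have h2 : L * Q ≤ L ^ 2 * Q := mul_le_mul_of_nonneg_right (by nlinarith) hQ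
    nlinarith
  have pair : ∀ s, s₀ < s → s ≤ f → 1 - σ ≤ 2 * (1 - s) → GoodSlice m ω p s → s ∈ F → False := by
    intro s h1 h2 h3 gs hsF
    have hs1 : s < 1 := h2.trans_lt hf1
    have c1 : w s₀ ≤ L * w s :=
      sliceVol_le_of_depth hω (he.trans hs₀.1) h1.le hs1 (by linarith)
    have c2 : w s ≤ L * w s₀ := sliceVol_le_of_le hω (he.trans hs₀.1) h1.le hs1
    have q1 := hQ4 _ (sliceVol_le_of_le (m := m) hω (he.trans hs₀.1) hs₀.2.1.le hf1)
    have q2 := hQ4 _ (sliceVol_le_of_le (m := m) hω (by linarith [hs₀.1]) h2 hf1)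
    have i := hF s₀ s h1 hs₀.2.2.1.1 gs.1 hs₀.2.2.2 hsF
    have g1 : 4 * L * p s₀ < w s₀ := hs₀.2.2.1.2
    have g2 : 4 * L * p s < w s := gs.2
    have n1 := hp0 s₀
    have n2 := hp0 s
    have k1 : 4 * p s₀ < w s₀ := by nlinarith
    have k2 : 4 * p s < w s := by nlinarith
    have k3 : 4 * p s₀ < w s := by nlinarith
    have k4 : 4 * p s < w s₀ := by nlinarith
    rcases min_le_iff.1 i with h | h
    · change w s₀ ≤ _ at h
      have : 4 * Q < w s₀ := q1
      linarith
    · change w s ≤ _ at h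
      have : 4 * Q < w s := q2
      linarith
  rcases le_or_gt (1 - σ) (2 * (1 - f)) with hc | hc
  · exact pair f hs₀.2.1 le_rfl hc gf hfF
  · have := mul_le_of_forall_le hQ hp (a := σ) (b := σ + (1 - σ) / 2) (c := w f / (4 * L ^ 2))
      (by have := sliceVol_nonneg (m := m) hω f; positivity) (by
        intro s h1 h2
        have hng : ¬ GoodSlice m ω p s := by
          intro gs
          by_cases hsF : s ∈ F
          · exact pair s (hs₀σ.trans_lt h1) (by linarith) (by linarith) gs hsF
          · have : s ≤ σ := le_csSup hSb ⟨by linarith, by linarith, gs, hsF⟩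
            linarith
        have hs1 : |s| < 1 := abs_lt.2 ⟨by linarith, by linarith⟩
        have h3 : w s ≤ 4 * L * p s := by
          by_contra hcon
          exact hng ⟨hs1, not_le.1 hcon⟩
        have h4 : w f ≤ L * w s := sliceVol_le_of_le hω (by linarith) (by linarith) hf1
        rw [div_le_iff₀ (by positivity)]
        nlinarith)
    have h5 : (1 - f) * w f ≤ (1 - σ) * w f :=
      mul_le_mul_of_nonneg_right (by linarith) (sliceVol_nonneg hω _)
    have h6 : (1 - σ) * w f ≤ 8 * L ^ 2 * Q := by
      have e : (σ + (1 - σ) / 2 - σ) * (w f / (4 * L ^ 2)) = (1 - σ) * w f / (8 * L ^ 2) := by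
        field_simp; ring
      rw [e, div_le_iff₀ (by positivity)] at this
      linarith
    linarith

/-- The reflection `s ↦ -s` together with exchanging the phases preserves inversions, so this is the
upper case. -/
theorem no_inversion_lower (hω : 0 ≤ ω) {p : ℝ → ℝ} (hp0 : ∀ s, 0 ≤ p s) {Q : ℝ} (hQ : 0 ≤ Q)
    (hp : ∫⁻ s, ENNReal.ofReal (p s) ≤ ENNReal.ofReal Q) {F : Set ℝ}
    (hF : ∀ e f, e < f → |e| < 1 → |f| < 1 → e ∉ F → f ∈ F →
      min (sliceVol m ω e) (sliceVol m ω f) ≤ Q + p e + p f)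
    {e f : ℝ} (hf : f ≤ 1 / 2) (hef : e < f) (gf : GoodSlice m ω p f) (hfF : f ∈ F)
    (ge : GoodSlice m ω p e) (te : ThickSlice m ω Q e) (heF : e ∉ F) : False := by
  refine no_inversion_upper (m := m) hω (p := fun s => p (-s)) (fun s => hp0 _) hQ
    (F := {s | -s ∉ F}) ?_ ?_ (e := -f) (f := -e) (by linarith) (by linarith) ?_ ?_ ?_ ?_ ?_
  · rwa [lintegral_neg_eq_self (fun s => ENNReal.ofReal (p s))]
  · intro a b hab ha hb haF hbF
    have := hF (-b) (-a) (by linarith) (by rwa [abs_neg]) (by rwa [abs_neg]) hbF (not_not.1 haF)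
    rw [sliceVol_neg, sliceVol_neg, min_comm] at this
    linarith
  · exact ⟨by rw [abs_neg]; exact gf.1, by simp only [sliceVol_neg, neg_neg]; exact gf.2⟩
  · simpa using hfF
  · exact ⟨by rw [abs_neg]; exact ge.1, by simp only [sliceVol_neg, neg_neg]; exact ge.2⟩
  · exact ⟨by rw [abs_neg]; exact te.1, by rw [sliceVol_neg, abs_neg]; exact te.2⟩
  · simpa using heF

/-- All slices with `|s| < 1/2` are thick by `hbig`. If all were bad, the minority volume over this
unit interval would exceed `Q`. -/
theorem exists_good_thick_slice (hω : 0 ≤ ω) {p : ℝ → ℝ} {Q : ℝ} (hQ : 0 ≤ Q)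
    (hp : ∫⁻ s, ENNReal.ofReal (p s) ≤ ENNReal.ofReal Q)
    (hbig : 16 * (4 ^ m) ^ 2 * Q < sliceVol m ω (1 / 2)) :
    ∃ c, -(1 / 2) < c ∧ c < 1 / 2 ∧ GoodSlice m ω p c ∧ ThickSlice m ω Q c := by
  set L : ℝ := 4 ^ m with hL
  have hL1 : 1 ≤ L := one_le_pow₀ (by norm_num)
  have hw : ∀ s, -(1 / 2) < s → s < 1 / 2 → sliceVol m ω (1 / 2) ≤ sliceVol m ω s := by
    intro s h1 h2
    refine sliceVol_antitone hω ?_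
    rw [abs_of_pos (by norm_num : (0 : ℝ) < 1 / 2)]
    exact abs_le.2 ⟨by linarith, by linarith⟩
  by_contra hcon
  push Not at hcon
  have hw0 := sliceVol_nonneg (m := m) hω (1 / 2)
  have := mul_le_of_forall_le hQ hp (a := -(1 / 2)) (b := 1 / 2) (c := sliceVol m ω (1 / 2) / (4 * L))
    (by positivity) (by
      intro s h1 h2
      have hs := hw s h1 h2
      have hs2 : |s| < 1 / 2 := abs_lt.2 ⟨h1, h2⟩
      have ht : ThickSlice m ω Q s := ⟨by linarith, by nlinarith⟩
      by_contra hlt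
      push Not at hlt
      rw [lt_div_iff₀ (by positivity)] at hlt
      exact hcon s h1 h2 ⟨by linarith, by linarith⟩ ht)
  rw [show (1 / 2 - -(1 / 2) : ℝ) = 1 by norm_num, one_mul, div_le_iff₀ (by positivity)] at this
  nlinarith

/-- Let `σ` be the least radius at which slices are thin. All thin slices lie at `|s| ≥ σ`, where
the slice volume is at most that at `σ`, so their total volume is at most `2(1 - σ)` times the
latter. -/
theorem lintegral_thin_le (hm : m ≠ 0) (hω : 0 ≤ ω) {η : ℝ} (hη : 0 ≤ η) :
    ∫⁻ s in {s | (1 - |s|) * sliceVol m ω s ≤ η}, ENNReal.ofReal (sliceVol m ω s) ≤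
      ENNReal.ofReal (2 * η) := by
  set S : Set ℝ := {r | 0 ≤ r ∧ (1 - r) * sliceVol m ω r ≤ η} with hS
  have h1S : (1 : ℝ) ∈ S := ⟨zero_le_one, by simpa using hη⟩
  have hSb : BddBelow S := ⟨0, fun x hx => hx.1⟩
  have hScl : IsClosed S := isClosed_Ici.inter (isClosed_le
    ((continuous_const.sub continuous_id).mul continuous_sliceVol) continuous_const)
  have habs : ∀ s, sliceVol m ω |s| = sliceVol m ω s := fun s => by
    rcases abs_choice s with h | h <;> rw [h]
    rw [sliceVol_neg]
  obtain ⟨h0, hσ⟩ := hScl.csInf_mem ⟨1, h1S⟩ hSb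
  set σ := sInf S with hσdef
  have hσ1 : σ ≤ 1 := csInf_le hSb h1S
  have hmT : MeasurableSet {s | (1 - |s|) * sliceVol m ω s ≤ η} :=
    measurableSet_le ((continuous_const.sub continuous_abs).mul continuous_sliceVol).measurable
      measurable_const
  rw [← lintegral_indicator hmT]
  calc _ ≤ ∫⁻ s, (Set.Icc (-1) (-σ) ∪ Set.Icc σ 1).indicator
        (fun _ => ENNReal.ofReal (sliceVol m ω σ)) s := by
        refine lintegral_mono fun s => ?_
        by_cases hs : (1 - |s|) * sliceVol m ω s ≤ η
        · rw [Set.indicator_of_mem (by exact hs)]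
          rcases le_or_gt 1 |s| with h | h
          · rw [sliceVol_eq_zero hm h]; simp
          · have hle : σ ≤ |s| := csInf_le hSb ⟨abs_nonneg s, by rw [habs]; exact hs⟩
            rw [Set.indicator_of_mem]
            · exact ENNReal.ofReal_le_ofReal (sliceVol_antitone hω (by rwa [abs_of_nonneg h0]))
            · rcases le_abs.1 hle with h' | h'
              · right; exact ⟨h', (abs_lt.1 h).2.le⟩
              · left; exact ⟨(abs_lt.1 h).1.le, by linarith⟩
        · rw [Set.indicator_of_notMem (by exact hs)]; exact zero_le
    _ ≤ ENNReal.ofReal (sliceVol m ω σ) * (ENNReal.ofReal (1 - σ) + ENNReal.ofReal (1 - σ)) := by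
        rw [lintegral_indicator_const (measurableSet_Icc.union measurableSet_Icc)]
        gcongr
        refine (measure_union_le _ _).trans_eq ?_
        rw [Real.volume_Icc, Real.volume_Icc]
        congr 2; ring
    _ ≤ _ := by
        rw [← ENNReal.ofReal_add (by linarith) (by linarith),
          ← ENNReal.ofReal_mul (sliceVol_nonneg hω _)]
        exact ENNReal.ofReal_le_ofReal (by linarith)

/-- If the majority phase of horizontal slices can only change from full to empty, then up to a
controlled volume the full slices are the ones below a threshold. -/
theorem exists_threshold (hm : m ≠ 0) (hω : 0 ≤ ω) {p : ℝ → ℝ} (hp0 : ∀ s, 0 ≤ p s) {Q : ℝ}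
    (hQ : 0 ≤ Q) (hp : ∫⁻ s, ENNReal.ofReal (p s) ≤ ENNReal.ofReal Q) {F : Set ℝ}
    (hF : ∀ e f, e < f → |e| < 1 → |f| < 1 → e ∉ F → f ∈ F →
      min (sliceVol m ω e) (sliceVol m ω f) ≤ Q + p e + p f) :
    ∃ t ∈ Set.Icc (-1 : ℝ) 1, ∀ q : ℝ → ℝ≥0∞,
      (∀ s, q s ≤ ENNReal.ofReal (sliceVol m ω s)) →
      (∀ s, (s ∈ F ↔ s ≤ t) → q s ≤ ENNReal.ofReal (p s)) →
      ∫⁻ s, q s ≤ ENNReal.ofReal (32 * (4 ^ m) ^ 3 * Q) := by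
  set L : ℝ := 4 ^ m with hL
  have hL1 : 1 ≤ L := one_le_pow₀ (by norm_num)
  have hL2 : 1 ≤ L ^ 2 := one_le_pow₀ hL1
  have hL3 : L ≤ L ^ 2 := by nlinarith
  have hL4 : L ^ 2 ≤ L ^ 3 := by nlinarith
  rcases lt_or_ge (16 * L ^ 2 * Q) (sliceVol m ω (1 / 2)) with hbig | hsmall
  · obtain ⟨c, hc1, hc2, gc, tc⟩ := exists_good_thick_slice hω hQ hp hbig
    have noinv : ∀ e f, e < f → GoodSlice m ω p e → ThickSlice m ω Q e → e ∉ F →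
        GoodSlice m ω p f → ThickSlice m ω Q f → f ∈ F → False := by
      intro e f hef ge te heF gf tf hfF
      rcases le_or_gt (-(1 / 2)) e with h1 | h1
      · exact no_inversion_upper hω hp0 hQ hp hF h1 hef ge heF gf tf hfF
      rcases le_or_gt f (1 / 2) with h2 | h2
      · exact no_inversion_lower hω hp0 hQ hp hF h2 hef gf hfF ge te heF
      -- For `e` in the lower cap and `f` in the upper one, the good thick middle slice forms an
      -- inversion with `e` if it is full and with `f` if it is empty.
      by_cases hcF : c ∈ F
      · exact no_inversion_lower hω hp0 hQ hp hF hc2.le (by linarith) gc hcF ge te heF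
      · exact no_inversion_upper hω hp0 hQ hp hF hc1.le (by linarith) gc hcF gf tf hfF
    set S : Set ℝ := insert (-1) {s | GoodSlice m ω p s ∧ ThickSlice m ω Q s ∧ s ∈ F} with hS
    have hSb : BddAbove S := ⟨1, by
      rintro x (rfl | hx)
      · norm_num
      · exact (abs_lt.1 hx.1.1).2.le⟩
    refine ⟨sSup S, ⟨le_csSup hSb (Set.mem_insert _ _), csSup_le ⟨-1, Set.mem_insert _ _⟩ (by
      rintro x (rfl | hx)
      · norm_num
      · exact (abs_lt.1 hx.1.1).2.le)⟩, ?_⟩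
    intro q hq1 hq2
    have hη : 0 ≤ 8 * L ^ 2 * Q := by positivity
    have hmT : MeasurableSet {s | (1 - |s|) * sliceVol m ω s ≤ 8 * L ^ 2 * Q} :=
      measurableSet_le ((continuous_const.sub continuous_abs).mul continuous_sliceVol).measurable
        measurable_const
    have hne : ∀ᵐ s : ℝ, s ≠ sSup S := by simp [ae_iff]
    -- A slice on the wrong side of the threshold is thin or not good; in the second case its volume
    -- is at most `4L` times its minority volume.
    calc ∫⁻ s, q s ≤ ∫⁻ s, (ENNReal.ofReal (4 * L) * ENNReal.ofReal (p s) +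
          {s | (1 - |s|) * sliceVol m ω s ≤ 8 * L ^ 2 * Q}.indicator
            (fun s => ENNReal.ofReal (sliceVol m ω s)) s) := by
          refine lintegral_mono_ae ?_
          filter_upwards [hne] with s hs
          by_cases hiff : s ∈ F ↔ s ≤ sSup S
          · refine (hq2 s hiff).trans (le_add_right ?_)
            rw [← ENNReal.ofReal_mul (by positivity)]
            exact ENNReal.ofReal_le_ofReal (by nlinarith [hp0 s])
          rcases le_or_gt 1 |s| with h1 | h1
          · refine (hq1 s).trans ?_
            rw [sliceVol_eq_zero hm h1]; simp
          by_cases ht : (1 - |s|) * sliceVol m ω s ≤ 8 * L ^ 2 * Q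
          · rw [Set.indicator_of_mem (by exact ht)]
            exact (hq1 s).trans le_add_self
          by_cases hg : GoodSlice m ω p s
          · exfalso
            have hT : ThickSlice m ω Q s := ⟨h1, not_le.1 ht⟩
            apply hiff
            constructor
            · intro hsF
              exact le_csSup hSb (Or.inr ⟨hg, hT, hsF⟩)
            · intro hle
              by_contra hsF
              obtain ⟨x, hx, hlt⟩ := exists_lt_of_lt_csSup ⟨-1, Set.mem_insert _ _⟩
                (lt_of_le_of_ne hle hs)
              rcases hx with rfl | hx
              · exact absurd (abs_lt.1 h1).1 (not_lt.2 hlt.le)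
              · exact noinv s x hlt hg hT hsF hx.1 hx.2.1 hx.2.2
          · refine (hq1 s).trans (le_add_right ?_)
            rw [← ENNReal.ofReal_mul (by positivity)]
            refine ENNReal.ofReal_le_ofReal ?_
            by_contra hcon
            exact hg ⟨h1, not_le.1 hcon⟩
      _ ≤ ENNReal.ofReal (4 * L) * ENNReal.ofReal Q + ENNReal.ofReal (2 * (8 * L ^ 2 * Q)) := by
          rw [lintegral_add_right _ ((continuous_sliceVol.measurable.ennreal_ofReal).indicator hmT),
            lintegral_indicator hmT, lintegral_const_mul' _ _ ENNReal.ofReal_ne_top]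
          exact add_le_add (mul_le_mul' le_rfl hp) (lintegral_thin_le hm hω hη)
      _ ≤ _ := by
          rw [← ENNReal.ofReal_mul (by positivity), ← ENNReal.ofReal_add (by positivity)
            (by positivity)]
          refine ENNReal.ofReal_le_ofReal ?_
          have : 4 * L * Q + 2 * (8 * L ^ 2 * Q) = (4 * L + 16 * L ^ 2) * Q := by ring
          rw [this]
          exact mul_le_mul_of_nonneg_right (by nlinarith) hQ
  -- Here `Q` is not small, and the volume of the whole ball is already bounded by a multiple of it,
  -- so any height works.
  · refine ⟨0, by norm_num, fun q hq1 _ => ?_⟩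
    calc ∫⁻ s, q s ≤ ∫⁻ s, (Set.Icc (-1 : ℝ) 1).indicator
          (fun _ => ENNReal.ofReal (L * sliceVol m ω (1 / 2))) s := by
          refine lintegral_mono fun s => (hq1 s).trans ?_
          by_cases hs : s ∈ Set.Icc (-1 : ℝ) 1
          · rw [Set.indicator_of_mem hs]
            refine ENNReal.ofReal_le_ofReal (sliceVol_le_four_pow_mul hω ?_)
            nlinarith [sq_nonneg s]
          · rw [sliceVol_eq_zero hm, ENNReal.ofReal_zero]
            · exact zero_le
            · by_contra h
              exact hs (abs_le.1 (not_le.1 h).le)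
      _ = ENNReal.ofReal (L * sliceVol m ω (1 / 2) * 2) := by
          rw [lintegral_indicator_const measurableSet_Icc, Real.volume_Icc,
            ← ENNReal.ofReal_mul (mul_nonneg (by positivity) (sliceVol_nonneg hω _))]
          norm_num
      _ ≤ _ := ENNReal.ofReal_le_ofReal (by
          have : L * sliceVol m ω (1 / 2) ≤ L * (16 * L ^ 2 * Q) :=
            mul_le_mul_of_nonneg_left hsmall (by positivity)
          nlinarith)

end Threshold

/-! ### Poincaré inequality on slices and distance to a half-space -/

section Slices

variable {X : Type*} [NormedAddCommGroup X] [InnerProductSpace ℝ X] [FiniteDimensional ℝ X]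
  [MeasurableSpace X] [BorelSpace X]

/-- The points of `A` in the unit ball of `X × ℝ` whose horizontal translate by `-k` is in the unit
ball but not in `A`. -/
def horizGain (A : Set (X × ℝ)) (k : X) : Set (X × ℝ) :=
  {p | ‖p.1‖ ^ 2 + p.2 ^ 2 < 1 ∧ ‖p.1 - k‖ ^ 2 + p.2 ^ 2 < 1 ∧ p ∈ A ∧ (p.1 - k, p.2) ∉ A}

theorem measurableSet_horizGain {A : Set (X × ℝ)} (hA : MeasurableSet A) (k : X) :
    MeasurableSet (horizGain A k) := by
  have h1 : MeasurableSet {p : X × ℝ | ‖p.1‖ ^ 2 + p.2 ^ 2 < 1} :=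
    measurableSet_lt (by fun_prop) measurable_const
  have h2 : MeasurableSet {p : X × ℝ | ‖p.1 - k‖ ^ 2 + p.2 ^ 2 < 1} :=
    measurableSet_lt (by fun_prop) measurable_const
  have h3 : Measurable fun p : X × ℝ => (p.1 - k, p.2) := by fun_prop
  exact h1.inter (h2.inter (hA.inter (h3 hA).compl))

/-- The horizontal slice at height `s` of the part of `A` in the unit ball. -/
def ballSlice (A : Set (X × ℝ)) (s : ℝ) : Set X := {y | ‖y‖ ^ 2 + s ^ 2 < 1 ∧ (y, s) ∈ A}

theorem measurableSet_ballSlice {A : Set (X × ℝ)} (hA : MeasurableSet A) (s : ℝ) :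
    MeasurableSet (ballSlice A s) := by
  have h1 : MeasurableSet {y : X | ‖y‖ ^ 2 + s ^ 2 < 1} :=
    measurableSet_lt (by fun_prop) measurable_const
  exact h1.inter (measurable_prodMk_right hA)

theorem setOf_sq_add_lt_one (s : ℝ) :
    {y : X | ‖y‖ ^ 2 + s ^ 2 < 1} = Metric.ball 0 √(1 - s ^ 2) := by
  ext y
  rw [mem_ball_zero_iff, Set.mem_ofPred_eq, Real.lt_sqrt (norm_nonneg y)]
  constructor <;> intro h <;> linarith

variable (X) in
/-- The slice volume function of the unit ball of `X × ℝ`. -/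
noncomputable def discVol (s : ℝ) : ℝ :=
  sliceVol (Module.finrank ℝ X) (volume.real (Metric.ball (0 : X) 1)) s

variable [Nontrivial X]

theorem volume_disc (s : ℝ) :
    volume {y : X | ‖y‖ ^ 2 + s ^ 2 < 1} = ENNReal.ofReal (discVol X s) := by
  rw [setOf_sq_add_lt_one, Measure.addHaar_ball _ _ (Real.sqrt_nonneg _), discVol, sliceVol,
    mul_comm, ENNReal.ofReal_mul measureReal_nonneg, Measure.real,
    ENNReal.ofReal_toReal measure_ball_lt_top.ne]

theorem volume_ballSlice_le (A : Set (X × ℝ)) (s : ℝ) :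
    volume (ballSlice A s) ≤ ENNReal.ofReal (discVol X s) :=
  (measure_mono fun _ hy => hy.1).trans_eq (volume_disc s)

theorem volume_ballSlice_ne_top (A : Set (X × ℝ)) (s : ℝ) : volume (ballSlice A s) ≠ ∞ :=
  ne_top_of_le_ne_top ENNReal.ofReal_ne_top (volume_ballSlice_le A s)

theorem volume_ballSlice_add_compl {A : Set (X × ℝ)} (hA : MeasurableSet A) (s : ℝ) :
    volume (ballSlice A s) + volume (ballSlice Aᶜ s) = ENNReal.ofReal (discVol X s) := by
  rw [← volume_disc, ← measure_inter_add_sdiff {y : X | ‖y‖ ^ 2 + s ^ 2 < 1}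
    (measurable_prodMk_right (y := s) hA)]
  rfl

/-- The product counts pairs of points of opposite phase; sort them by their difference `k`. -/
theorem volume_ballSlice_mul_compl {A : Set (X × ℝ)} (hA : MeasurableSet A) (s : ℝ) :
    volume (ballSlice A s) * volume (ballSlice Aᶜ s) =
      ∫⁻ k, volume {y | (y, s) ∈ horizGain A k} := by
  set T : Set (X × X) := {q | q.2 ∈ ballSlice A s ∧ q.2 - q.1 ∈ ballSlice Aᶜ s} with hT
  have m1 := measurableSet_ballSlice hA s
  have m2 := measurableSet_ballSlice hA.compl s
  have mT : MeasurableSet T := (measurable_snd m1).inter ((measurable_snd.sub measurable_fst) m2)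
  have h1 := Measure.prod_apply (μ := (volume : Measure X)) (ν := (volume : Measure X)) mT
  rw [Measure.prod_apply_symm mT] at h1
  have h2 : ∀ k, Prod.mk k ⁻¹' T = {y | (y, s) ∈ horizGain A k} := fun k => by
    ext y
    simp only [hT, ballSlice, horizGain, Set.mem_preimage, Set.mem_ofPred_eq, Set.mem_compl_iff]
    tauto
  have h3 : ∀ y, volume ((fun k => (k, y)) ⁻¹' T) =
      (ballSlice A s).indicator (fun _ => volume (ballSlice Aᶜ s)) y := fun y => by
    by_cases hy : y ∈ ballSlice A s
    · rw [Set.indicator_of_mem hy]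
      have : (fun k => (k, y)) ⁻¹' T = (fun k => y - k) ⁻¹' ballSlice Aᶜ s := by
        ext k; simp [hT, hy]
      rw [this]
      exact (Measure.measurePreserving_sub_left volume y).measure_preimage m2.nullMeasurableSet
    · rw [Set.indicator_of_notMem hy]
      have : (fun k => (k, y)) ⁻¹' T = ∅ := by
        ext k; simp [hT, hy]
      rw [this, measure_empty]
  simp only [h2, h3] at h1
  rw [← h1, lintegral_indicator_const m1, mul_comm]

variable (X) in
/-- The kernel in the slicewise Poincaré inequality. -/
noncomputable def poincareKernel (k : X) : ℝ≥0∞ :=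
  (ENNReal.ofReal (volume.real (Metric.ball (0 : X) 1) * (‖k‖ / 2) ^ Module.finrank ℝ X))⁻¹

theorem measurable_poincareKernel : Measurable (poincareKernel X) := by
  unfold poincareKernel; fun_prop

theorem volume_ball_one_pos : 0 < volume.real (Metric.ball (0 : X) 1) :=
  ENNReal.toReal_pos (Metric.measure_ball_pos volume 0 one_pos).ne' measure_ball_lt_top.ne

/-- With `a + b = W` one has `W min(a, b) ≤ 2ab`, and `ab` is an integral over translations `k`. A
translation contributes only if the slice has radius at least `‖k‖ / 2`, so `1 / W` is bounded by a
kernel independent of the height. -/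
theorem min_volume_ballSlice_le {A : Set (X × ℝ)} (hA : MeasurableSet A) (s : ℝ) :
    min (volume (ballSlice A s)) (volume (ballSlice Aᶜ s)) ≤
      2 * ∫⁻ k, poincareKernel X k * volume {y | (y, s) ∈ horizGain A k} := by
  set a := volume (ballSlice A s) with ha
  set b := volume (ballSlice Aᶜ s) with hb
  set W := ENNReal.ofReal (discVol X s) with hW
  have hsum : a + b = W := volume_ballSlice_add_compl hA s
  by_cases hW0 : W = 0
  · have : a = 0 := by
      rw [hW0] at hsum
      exact (add_eq_zero.1 hsum).1
    rw [this]; exact (min_le_left _ _).trans zero_le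
  have hWt : W ≠ ∞ := ENNReal.ofReal_ne_top
  have h1 : W * min a b ≤ 2 * (a * b) := by
    rw [← hsum, add_mul, two_mul]
    refine add_le_add (mul_le_mul' le_rfl (min_le_right _ _)) ?_
    rw [mul_comm]
    exact mul_le_mul' (min_le_left _ _) le_rfl
  have h2 : W⁻¹ * (a * b) ≤ ∫⁻ k, poincareKernel X k * volume {y | (y, s) ∈ horizGain A k} := by
    rw [ha, hb, volume_ballSlice_mul_compl hA,
      ← lintegral_const_mul' _ _ (ENNReal.inv_ne_top.2 hW0)]
    refine lintegral_mono fun k => ?_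
    rcases Set.eq_empty_or_nonempty {y | (y, s) ∈ horizGain A k} with h | ⟨y, h1, h2, -⟩
    · simp [h]
    · refine mul_le_mul' (ENNReal.inv_le_inv.2 (ENNReal.ofReal_le_ofReal ?_)) le_rfl
      unfold discVol sliceVol
      gcongr
      have e1 : ‖y‖ < √(1 - s ^ 2) := by
        rw [Real.lt_sqrt (norm_nonneg _)]; linarith
      have e2 : ‖y - k‖ < √(1 - s ^ 2) := by
        rw [Real.lt_sqrt (norm_nonneg _)]; linarith
      have e3 : ‖k‖ ≤ ‖y‖ + ‖y - k‖ := by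
        simpa using norm_sub_le y (y - k)
      linarith
  calc min a b = W⁻¹ * (W * min a b) := by
        rw [← mul_assoc, ENNReal.inv_mul_cancel hW0 hWt, one_mul]
    _ ≤ W⁻¹ * (2 * (a * b)) := mul_le_mul' le_rfl h1
    _ = 2 * (W⁻¹ * (a * b)) := by ring
    _ ≤ _ := mul_le_mul' le_rfl h2

variable (X) in
/-- The constant in the slicewise Poincaré inequality. -/
noncomputable def poincareConst : ℝ≥0∞ :=
  2 * ∫⁻ k in Metric.ball (0 : X) 2, poincareKernel X k * ENNReal.ofReal ‖k‖

/-- In dimension `m` the kernel behaves like `‖k‖ ^ (-m)`. The extra factor `‖k‖` makes it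
integrable: in polar coordinates the integrand is constant. -/
theorem poincareConst_ne_top : poincareConst X ≠ ∞ := by
  refine ENNReal.mul_ne_top (by norm_num) ?_
  set ω := volume.real (Metric.ball (0 : X) 1) with hω
  have hω0 : 0 < ω := volume_ball_one_pos
  set m := Module.finrank ℝ X with hm
  have hm0 : 0 < m := Module.finrank_pos
  set f : ℝ → ℝ := (Set.Iio 2).indicator fun r => (ω * (r / 2) ^ m)⁻¹ * r with hf
  have hint : Integrable (fun x : X => f ‖x‖) := by
    rw [integrable_fun_norm_addHaar]
    have h1 : IntegrableOn (fun _ : ℝ => 2 ^ m / ω) (Set.Ioo 0 2) :=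
      integrableOn_const (by simp)
    have h2 : Set.EqOn (fun r : ℝ => r ^ (m - 1) • f r)
        ((Set.Ioo 0 2).indicator fun _ => 2 ^ m / ω) (Set.Ioi 0) := by
      intro r hr
      have hr0 : (0 : ℝ) < r := hr
      by_cases hr2 : r < 2
      · simp only [hf]
        rw [Set.indicator_of_mem (by exact hr2), Set.indicator_of_mem (by exact ⟨hr0, hr2⟩),
          smul_eq_mul, div_pow]
        have : r ^ m = r ^ (m - 1) * r := by
          rw [← pow_succ, Nat.sub_add_cancel hm0]
        rw [this]
        field_simp
      · simp only [hf]
        rw [Set.indicator_of_notMem (by exact hr2),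
          Set.indicator_of_notMem (fun h => hr2 h.2), smul_zero]
    refine IntegrableOn.congr_fun ?_ h2.symm measurableSet_Ioi
    exact (h1.integrable_indicator measurableSet_Ioo).integrableOn
  refine ne_top_of_le_ne_top hint.lintegral_lt_top.ne ?_
  rw [← lintegral_indicator Metric.isOpen_ball.measurableSet]
  refine lintegral_mono fun k => ?_
  by_cases hk : ‖k‖ < 2
  · rw [Set.indicator_of_mem (by simpa using hk)]
    simp only [hf]
    rw [Set.indicator_of_mem (by exact hk)]
    rcases eq_or_ne k 0 with rfl | hk0
    · simp
    · have : 0 < ‖k‖ := norm_pos_iff.2 hk0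
      rw [poincareKernel, ← ENNReal.ofReal_inv_of_pos (by positivity),
        ← ENNReal.ofReal_mul (by positivity)]
  · rw [Set.indicator_of_notMem (by simpa using hk)]; exact zero_le

/-- Integrated slicewise Poincaré inequality. -/
theorem lintegral_min_volume_ballSlice_le {A : Set (X × ℝ)} (hA : MeasurableSet A) {ε : ℝ}
    (hε : 0 ≤ ε) (hH : ∀ k, volume (horizGain A k) ≤ ENNReal.ofReal (ε * ‖k‖)) :
    ∫⁻ s, min (volume (ballSlice A s)) (volume (ballSlice Aᶜ s)) ≤
      poincareConst X * ENNReal.ofReal ε := by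
  have mG : MeasurableSet {q : (ℝ × X) × X | (q.2, q.1.1) ∈ horizGain A q.1.2} := by
    have h1 : MeasurableSet {q : (ℝ × X) × X | ‖q.2‖ ^ 2 + q.1.1 ^ 2 < 1} :=
      measurableSet_lt (by fun_prop) measurable_const
    have h2 : MeasurableSet {q : (ℝ × X) × X | ‖q.2 - q.1.2‖ ^ 2 + q.1.1 ^ 2 < 1} :=
      measurableSet_lt (by fun_prop) measurable_const
    have h3 : Measurable fun q : (ℝ × X) × X => (q.2, q.1.1) := by fun_prop
    have h4 : Measurable fun q : (ℝ × X) × X => (q.2 - q.1.2, q.1.1) := by fun_prop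
    exact h1.inter (h2.inter ((h3 hA).inter (h4 hA).compl))
  calc _ ≤ ∫⁻ s, 2 * ∫⁻ k, poincareKernel X k * volume {y | (y, s) ∈ horizGain A k} :=
        lintegral_mono fun s => min_volume_ballSlice_le hA s
    _ = 2 * ∫⁻ k, ∫⁻ s, poincareKernel X k * volume {y | (y, s) ∈ horizGain A k} := by
        rw [lintegral_const_mul' _ _ (by norm_num), lintegral_lintegral_swap]
        exact ((measurable_poincareKernel.comp measurable_snd).mul
          (measurable_measure_prodMk_left mG)).aemeasurable
    _ = 2 * ∫⁻ k, poincareKernel X k * volume (horizGain A k) := by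
        congr 1
        refine lintegral_congr fun k => ?_
        have h := measurable_measure_prodMk_right (μ := (volume : Measure X))
          (measurableSet_horizGain hA k)
        rw [Measure.volume_eq_prod X ℝ, Measure.prod_apply_symm (measurableSet_horizGain hA k)]
        exact lintegral_const_mul _ h
    _ ≤ 2 * ∫⁻ k, ENNReal.ofReal ε * (Metric.ball (0 : X) 2).indicator
          (fun k => poincareKernel X k * ENNReal.ofReal ‖k‖) k := by
        refine mul_le_mul' le_rfl (lintegral_mono fun k => ?_)
        by_cases hk : ‖k‖ < 2
        · rw [Set.indicator_of_mem (by simpa using hk)]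
          refine (mul_le_mul' le_rfl (hH k)).trans_eq ?_
          rw [ENNReal.ofReal_mul hε]; ring
        · have : horizGain A k = ∅ := by
            refine Set.eq_empty_of_forall_notMem fun p hp => hk ?_
            have e1 : ‖p.1‖ < 1 := by nlinarith [hp.1, norm_nonneg p.1, sq_nonneg p.2]
            have e2 : ‖p.1 - k‖ < 1 := by nlinarith [hp.2.1, norm_nonneg (p.1 - k), sq_nonneg p.2]
            have e3 : ‖k‖ ≤ ‖p.1‖ + ‖p.1 - k‖ := by
              simpa using norm_sub_le p.1 (p.1 - k)
            linarith
          rw [this]; simp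
    _ = _ := by
        rw [lintegral_const_mul' _ _ ENNReal.ofReal_ne_top,
          lintegral_indicator Metric.isOpen_ball.measurableSet, poincareConst]
        ring

variable (X) in
/-- The constant in the estimate of the distance to a half-space. -/
noncomputable def flatConst : ℝ :=
  32 * (4 ^ Module.finrank ℝ X) ^ 3 * max 1 (poincareConst X).toReal

/-- The Poincaré inequality bounds the integrated minority volume by `O(ε)`. It remains to check
that an empty majority below a full one is expensive, so that the threshold lemma applies. -/
theorem exists_height_of_subgraph {A : Set (X × ℝ)} (hA : MeasurableSet A) {ε : ℝ} (hε : 0 ≤ ε)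
    (hH : ∀ k, volume (horizGain A k) ≤ ENNReal.ofReal (ε * ‖k‖)) {B : Set X} {g : X → ℝ}
    (hB : volume B ≤ ENNReal.ofReal ε)
    (hg : ∀ y, y ∉ B → ∀ s : ℝ, ‖y‖ ^ 2 + s ^ 2 < 1 → ((y, s) ∈ A ↔ s ≤ g y)) :
    ∃ t ∈ Set.Icc (-1 : ℝ) 1, volume {p : X × ℝ | ‖p.1‖ ^ 2 + p.2 ^ 2 < 1 ∧ ¬(p ∈ A ↔ p.2 ≤ t)} ≤
      ENNReal.ofReal (flatConst X * ε) := by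
  set a : ℝ → ℝ≥0∞ := fun s => volume (ballSlice A s) with ha
  set b : ℝ → ℝ≥0∞ := fun s => volume (ballSlice Aᶜ s) with hb
  have hat : ∀ s, a s ≠ ∞ := fun s => volume_ballSlice_ne_top A s
  have hbt : ∀ s, b s ≠ ∞ := fun s => volume_ballSlice_ne_top Aᶜ s
  have hmt : ∀ s, min (a s) (b s) ≠ ∞ := fun s =>
    ne_top_of_le_ne_top (hat s) (min_le_left _ _)
  set p : ℝ → ℝ := fun s => (min (a s) (b s)).toReal with hp
  have hpo : ∀ s, ENNReal.ofReal (p s) = min (a s) (b s) := fun s => ENNReal.ofReal_toReal (hmt s)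
  set Q : ℝ := max 1 (poincareConst X).toReal * ε with hQdef
  have hQ : 0 ≤ Q := by positivity
  have hεQ : ε ≤ Q := le_mul_of_one_le_left hε (le_max_left _ _)
  have hint : ∫⁻ s, ENNReal.ofReal (p s) ≤ ENNReal.ofReal Q := by
    simp only [hpo]
    refine (lintegral_min_volume_ballSlice_le hA hε hH).trans ?_
    rw [← ENNReal.ofReal_toReal (poincareConst_ne_top (X := X)),
      ← ENNReal.ofReal_mul ENNReal.toReal_nonneg]
    exact ENNReal.ofReal_le_ofReal (mul_le_mul_of_nonneg_right (le_max_right _ _) hε)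
  obtain ⟨t, ht, hmain⟩ := exists_threshold (m := Module.finrank ℝ X)
    (ω := volume.real (Metric.ball (0 : X) 1)) (Module.finrank_pos (R := ℝ) (M := X)).ne'
    measureReal_nonneg (p := p) (fun s => ENNReal.toReal_nonneg) hQ hint (F := {s | b s < a s}) (by
      intro e f hef he hf heF hfF
      have heF' : a e ≤ b e := not_lt.1 heF
      have hfF' : b f < a f := hfF
      have h1 : ENNReal.ofReal (min (discVol X e) (discVol X f)) ≤
          ENNReal.ofReal (Q + p e + p f) := by
        calc ENNReal.ofReal (min (discVol X e) (discVol X f))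
            ≤ volume ({y : X | ‖y‖ ^ 2 + e ^ 2 < 1} ∩ {y : X | ‖y‖ ^ 2 + f ^ 2 < 1}) := by
              rcases le_total (e ^ 2) (f ^ 2) with h | h
              · refine (ENNReal.ofReal_le_ofReal (min_le_right _ _)).trans ?_
                rw [← volume_disc]
                refine measure_mono fun y hy => ⟨?_, hy⟩
                have : ‖y‖ ^ 2 + f ^ 2 < 1 := hy
                exact (add_le_add le_rfl h).trans_lt this
              · refine (ENNReal.ofReal_le_ofReal (min_le_left _ _)).trans ?_
                rw [← volume_disc]
                refine measure_mono fun y hy => ⟨hy, ?_⟩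
                have : ‖y‖ ^ 2 + e ^ 2 < 1 := hy
                exact (add_le_add le_rfl h).trans_lt this
          -- Over a point outside `B` the set is a subgraph, so it cannot be absent at `e` and
          -- present at `f > e`. The common disc is thus covered by `B` and the two minority parts.
          _ ≤ volume (B ∪ ballSlice A e ∪ ballSlice Aᶜ f) := by
              refine measure_mono fun y hy => ?_
              by_cases hyB : y ∈ B
              · exact Or.inl (Or.inl hyB)
              by_cases hye : (y, e) ∈ A
              · exact Or.inl (Or.inr ⟨hy.1, hye⟩)
              · refine Or.inr ⟨hy.2, fun hyf => hye ?_⟩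
                rw [hg y hyB e hy.1]
                exact hef.le.trans ((hg y hyB f hy.2).1 hyf)
          _ ≤ ENNReal.ofReal ε + a e + b f :=
              (measure_union_le _ _).trans (add_le_add ((measure_union_le _ _).trans
                (add_le_add hB le_rfl)) le_rfl)
          _ ≤ ENNReal.ofReal Q + ENNReal.ofReal (p e) + ENNReal.ofReal (p f) := by
              rw [hpo, hpo, min_eq_left heF', min_eq_right hfF'.le]
              exact add_le_add (add_le_add (ENNReal.ofReal_le_ofReal hεQ) le_rfl) le_rfl
          _ = _ := by
              rw [← ENNReal.ofReal_add hQ ENNReal.toReal_nonneg, ← ENNReal.ofReal_add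
                (add_nonneg hQ ENNReal.toReal_nonneg) ENNReal.toReal_nonneg]
      exact (ENNReal.ofReal_le_ofReal_iff (add_nonneg (add_nonneg hQ ENNReal.toReal_nonneg)
        ENNReal.toReal_nonneg)).1 h1)
  refine ⟨t, ht, ?_⟩
  have mErr : MeasurableSet {p : X × ℝ | ‖p.1‖ ^ 2 + p.2 ^ 2 < 1 ∧ ¬(p ∈ A ↔ p.2 ≤ t)} := by
    have h1 : MeasurableSet {p : X × ℝ | ‖p.1‖ ^ 2 + p.2 ^ 2 < 1} :=
      measurableSet_lt (by fun_prop) measurable_const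
    have h2 : MeasurableSet {p : X × ℝ | p.2 ≤ t} := measurableSet_le measurable_snd
      measurable_const
    exact h1.inter (hA.iff h2).compl
  rw [Measure.volume_eq_prod, Measure.prod_apply_symm mErr]
  refine (hmain _ (fun s => ?_) fun s hs => ?_).trans_eq ?_
  · exact (measure_mono fun y hy => hy.1).trans_eq (volume_disc s)
  · rw [hpo]
    by_cases hst : s ≤ t
    · have : b s < a s := hs.2 hst
      rw [min_eq_right this.le]
      refine measure_mono fun y hy => ⟨hy.1, fun hyA => hy.2 ⟨fun _ => hst, fun _ => hyA⟩⟩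
    · have : a s ≤ b s := not_lt.1 fun h => hst (hs.1 h)
      rw [min_eq_left this]
      refine measure_mono fun y hy => ⟨hy.1, ?_⟩
      by_contra hyA
      exact hy.2 ⟨fun h => absurd h hyA, fun h => absurd h hst⟩
  · rw [hQdef, flatConst, mul_assoc, mul_assoc, mul_assoc]

/-- A set in the unit ball of `X × ℝ` which varies little horizontally and is a subgraph outside a
cylinder over a small set is close to a half-space. -/
theorem exists_height {A : Set (X × ℝ)} (hA : MeasurableSet A) {ε : ℝ} (hε : 0 ≤ ε)
    (hH : ∀ k, volume (horizGain A k) ≤ ENNReal.ofReal (ε * ‖k‖)) {B : Set X} {g : X → ℝ}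
    (mB : MeasurableSet B) (mg : Measurable g) (hB : volume B ≤ ENNReal.ofReal ε)
    (hg : ∀ y, y ∉ B → ∀ᵐ s : ℝ, ‖y‖ ^ 2 + s ^ 2 < 1 → ((y, s) ∈ A ↔ s ≤ g y)) :
    ∃ t ∈ Set.Icc (-1 : ℝ) 1, volume {p : X × ℝ | ‖p.1‖ ^ 2 + p.2 ^ 2 < 1 ∧ ¬(p ∈ A ↔ p.2 ≤ t)} ≤
      ENNReal.ofReal (flatConst X * ε) := by
  -- Modify the set on a null subset of the ball so that the subgraph property holds at every height
  -- rather than almost every one.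
  set A' : Set (X × ℝ) := {p | (p.1 ∈ B ∧ p ∈ A) ∨ (p.1 ∉ B ∧ p.2 ≤ g p.1)} with hA'
  have mA' : MeasurableSet A' := ((measurable_fst mB).inter hA).union
    ((measurable_fst mB).compl.inter (measurableSet_le measurable_snd (mg.comp measurable_fst)))
  have mN : MeasurableSet {p : X × ℝ | ‖p.1‖ ^ 2 + p.2 ^ 2 < 1 → (p ∈ A ↔ p ∈ A')} := by
    have h1 : MeasurableSet {p : X × ℝ | ‖p.1‖ ^ 2 + p.2 ^ 2 < 1} :=
      measurableSet_lt (by fun_prop) measurable_const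
    exact h1.imp (hA.iff mA')
  have hae : ∀ᵐ p : X × ℝ, ‖p.1‖ ^ 2 + p.2 ^ 2 < 1 → (p ∈ A ↔ p ∈ A') := by
    rw [Measure.volume_eq_prod, Measure.ae_prod_iff_ae_ae mN]
    refine Filter.Eventually.of_forall fun y => ?_
    by_cases hy : y ∈ B
    · exact Filter.Eventually.of_forall fun s _ => by simp [hA', hy]
    · filter_upwards [hg y hy] with s hs h1
      simp [hA', hy, hs h1]
  have hae' : ∀ k : X, ∀ᵐ p : X × ℝ, ‖p.1 - k‖ ^ 2 + p.2 ^ 2 < 1 →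
      ((p.1 - k, p.2) ∈ A ↔ (p.1 - k, p.2) ∈ A') := fun k =>
    ((measurePreserving_sub_right volume k).prod (MeasurePreserving.id volume)).quasiMeasurePreserving.ae hae
  obtain ⟨t, ht, h⟩ := exists_height_of_subgraph mA' hε (fun k => by
    refine (measure_mono_ae ?_).trans (hH k)
    filter_upwards [hae, hae' k] with p h1 h2 hp
    exact ⟨hp.1, hp.2.1, (h1 hp.1).2 hp.2.2.1, fun h => hp.2.2.2 ((h2 hp.2.1).1 h)⟩) (g := g) hB
    (fun y hy s _ => by simp [hA', hy])
  refine ⟨t, ht, (measure_mono_ae ?_).trans h⟩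
  filter_upwards [hae] with p h1 hp
  exact ⟨hp.1, by rw [← h1 hp.1]; exact hp.2⟩

end Slices

/-! ### Directional variation from crossings -/

section DirectionalVariation

variable {V : Type*} [NormedAddCommGroup V] [InnerProductSpace ℝ V] [FiniteDimensional ℝ V]
  [MeasurableSpace V] [BorelSpace V]

theorem setIntegral_le_of_eq_zero {ψ : V → ℝ} (hb : ∀ x, |ψ x| ≤ 1) {T G : Set V}
    (mT : MeasurableSet T) (hGT : G ⊆ T) (hG : volume G ≠ ∞) (h0 : ∀ x ∈ T \ G, ψ x = 0) :
    |∫ x in T, ψ x| ≤ volume.real G := by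
  rw [setIntegral_eq_of_subset_of_forall_sdiff_eq_zero mT hGT h0]
  have := norm_setIntegral_le_of_norm_le_const (f := ψ) (C := 1) (lt_top_iff_ne_top.2 hG)
    fun x _ => by simpa using hb x
  rwa [one_mul, Real.norm_eq_abs] at this

/-- The directional variation in the unit ball of a set is controlled by the volume of its crossings
under small translations. -/
theorem setIntegral_fderiv_le {ψ : V → ℝ} (hψ : ContDiff ℝ 1 ψ) (hc : HasCompactSupport ψ)
    (hs : tsupport ψ ⊆ Metric.ball 0 1) (hb : ∀ x, |ψ x| ≤ 1) {E : Set V} (hE : MeasurableSet E)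
    {v : V} {c t₀ : ℝ} (hc0 : 0 ≤ c) (ht₀ : 0 < t₀)
    (H : ∀ t, 0 < t → t ≤ t₀ → volume (gainSet E 1 (t • v)) + volume (gainSet Eᶜ 1 (t • v)) ≤
      ENNReal.ofReal (c * t)) :
    ∫ x in E, fderiv ℝ ψ x v ≤ c := by
  have hlim := (hasDerivAt_setIntegral_translate hψ hc E v).tendsto_slope_zero_right
  -- The support of the test function has positive distance from the sphere, so for small `t` every
  -- crossing it sees has both endpoints in the ball.
  obtain ⟨δ, hδ, hthick⟩ := hc.isCompact.exists_thickening_subset_open Metric.isOpen_ball hs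
  refine le_of_tendsto hlim ?_
  have hev : ∀ᶠ t : ℝ in nhdsWithin 0 (Set.Ioi 0), t < δ / (‖v‖ + 1) ∧ t < t₀ :=
    nhdsWithin_le_nhds ((gt_mem_nhds (by positivity)).and (gt_mem_nhds ht₀))
  filter_upwards [hev, self_mem_nhdsWithin] with t ht ht0
  have ht0 : 0 < t := ht0
  have hh : ‖t • v‖ < δ := by
    rw [norm_smul, Real.norm_of_nonneg ht0.le]
    have h1 : t * (‖v‖ + 1) < δ := (lt_div_iff₀ (by positivity)).1 ht.1
    nlinarith
  have hin : ∀ x, ψ x ≠ 0 → ‖x‖ < 1 ∧ ‖x - t • v‖ < 1 := by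
    intro x hx
    have hxs : x ∈ tsupport ψ := subset_tsupport ψ hx
    refine ⟨by simpa using hs hxs, ?_⟩
    have : x - t • v ∈ Metric.thickening δ (tsupport ψ) := by
      rw [Metric.mem_thickening_iff]
      exact ⟨x, hxs, by simpa [dist_eq_norm] using hh⟩
    simpa using hthick this
  have hfin : ∀ F : Set V, volume (gainSet F 1 (t • v)) ≠ ∞ := fun F =>
    ne_top_of_le_ne_top (volume_exitSet_lt_top F _).ne
      (measure_mono (gainSet_subset_exitSet F le_rfl _))
  have key : ∀ F : Set V, MeasurableSet F →
      |∫ x in {x | x ∈ F ∧ x - t • v ∉ F}, ψ x| ≤ volume.real (gainSet F 1 (t • v)) := by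
    intro F hF
    refine setIntegral_le_of_eq_zero hb
      (hF.inter (measurableSet_preimage (measurable_sub_const _) hF).compl)
      (fun x hx => hx.2.2) (hfin F) fun x hx => ?_
    by_contra hne
    exact hx.2 ⟨(hin x hne).1, (hin x hne).2, hx.1.1, hx.1.2⟩
  have h1 := key E hE
  have h2 := key Eᶜ hE.compl
  have hset : {x | x ∈ Eᶜ ∧ x - t • v ∉ Eᶜ} = {x | x ∉ E ∧ x - t • v ∈ E} := by ext x; simp
  rw [hset] at h2
  have h3 : volume.real (gainSet E 1 (t • v)) + volume.real (gainSet Eᶜ 1 (t • v)) ≤ c * t := by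
    have := ENNReal.toReal_le_of_le_ofReal (by positivity) (H t ht0 ht.2.le)
    rwa [ENNReal.toReal_add (hfin _) (hfin _)] at this
  have h4 := setIntegral_translate_sub hψ.continuous hc hE (t • v)
  rw [smul_eq_mul, zero_add, inv_mul_le_iff₀ ht0]
  simp only [zero_smul, add_zero]
  rw [h4]
  linarith [(abs_le.1 h1).1, (abs_le.1 h2).2]

end DirectionalVariation

/-! ### Perimeter after vertical rescaling -/

section Stretch

variable {m : ℕ}

/-- The vertical rescaling as a linear map. -/
noncomputable def stretchLinear (m : ℕ) (δ : ℝ) :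
    EuclideanSpace ℝ (Fin (m + 1)) →ₗ[ℝ] EuclideanSpace ℝ (Fin (m + 1)) where
  toFun := stretch δ
  map_add' x y := by
    ext i
    simp only [stretch, PiLp.add_apply]
    split_ifs <;> ring
  map_smul' c x := by
    ext i
    simp only [stretch, PiLp.smul_apply, smul_eq_mul, RingHom.id_apply]
    split_ifs <;> ring

theorem stretch_single_castSucc (δ : ℝ) (i : Fin m) :
    stretch δ (EuclideanSpace.single i.castSucc (1 : ℝ)) = EuclideanSpace.single i.castSucc 1 := by
  ext j
  simp only [stretch, PiLp.single_apply]
  split_ifs with h1 h2 <;> simp_all [Fin.ext_iff, Fin.last]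
  omega

theorem stretch_single_last (δ : ℝ) :
    stretch δ (EuclideanSpace.single (Fin.last m) (1 : ℝ)) =
      δ⁻¹ • EuclideanSpace.single (Fin.last m) 1 := by
  ext j
  simp only [stretch, PiLp.single_apply, PiLp.smul_apply, smul_eq_mul]
  split_ifs with h1 <;> simp

theorem det_stretchLinear (δ : ℝ) : LinearMap.det (stretchLinear m δ) = δ⁻¹ := by
  rw [← LinearMap.det_toMatrix (EuclideanSpace.basisFun (Fin (m + 1)) ℝ).toBasis]
  have : LinearMap.toMatrix (EuclideanSpace.basisFun (Fin (m + 1)) ℝ).toBasis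
      (EuclideanSpace.basisFun (Fin (m + 1)) ℝ).toBasis (stretchLinear m δ) =
      Matrix.diagonal fun i => if i = Fin.last m then δ⁻¹ else 1 := by
    ext i j
    rw [LinearMap.toMatrix_apply]
    simp only [OrthonormalBasis.coe_toBasis_repr_apply, EuclideanSpace.basisFun_repr,
      OrthonormalBasis.coe_toBasis, EuclideanSpace.basisFun_apply, Matrix.diagonal_apply]
    change stretch δ (EuclideanSpace.single j (1 : ℝ)) i = _
    simp only [stretch, PiLp.single_apply]
    split_ifs <;> simp_all
  rw [this, Matrix.det_diagonal, Fin.prod_univ_castSucc]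
  simp [Fin.castSucc_ne_last]

theorem stretch_injective {δ : ℝ} (hδ : 0 < δ) : Function.Injective (stretch (m := m) δ) := by
  intro x y h
  ext i
  have := congrArg (fun z : EuclideanSpace ℝ (Fin (m + 1)) => z i) h
  simp only [stretch] at this
  split_ifs at this
  · exact (div_left_inj' hδ.ne').1 this
  · exact this

theorem perimeter_congr_ae {n : ℕ} {Ω E E' : Set (EuclideanSpace ℝ (Fin n))}
    (h : E =ᵐ[volume] E') : perimeter Ω E = perimeter Ω E' := by
  unfold perimeter
  have : (E ∩ Ω : Set _) =ᵐ[volume] (E' ∩ Ω : Set _) := h.inter (Filter.EventuallyEq.refl _ _)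
  simp only [setIntegral_congr_set this]

theorem stretch_image_congr_ae {δ : ℝ} (hδ : 0 < δ) {E E' : Set (EuclideanSpace ℝ (Fin (m + 1)))}
    (h : E =ᵐ[volume] E') : (stretch δ '' E : Set _) =ᵐ[volume] (stretch δ '' E' : Set _) := by
  rw [ae_eq_set] at h ⊢
  have key : ∀ A : Set (EuclideanSpace ℝ (Fin (m + 1))), volume A = 0 →
      volume (stretch δ '' A) = 0 := fun A hA => by
    have := Measure.addHaar_image_linearMap volume (stretchLinear m δ) A
    rw [hA, mul_zero] at this
    exact this
  rw [← Set.image_sdiff (stretch_injective hδ), ← Set.image_sdiff (stretch_injective hδ)]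
  exact ⟨key _ h.1, key _ h.2⟩

/-- The flatness of the rescaled perimeter, from the crossings under small translations. -/
theorem flatThree_of_gainSet {δ : ℝ} (hδ : 0 < δ) {E : Set (EuclideanSpace ℝ (Fin (m + 1)))}
    (hE : MeasurableSet E) {a b t₀ : ℝ} (ha : 0 ≤ a) (hb : 0 ≤ b) (ht₀ : 0 < t₀)
    (Hhor : ∀ i : Fin m, ∀ t, 0 < t → t ≤ t₀ →
      volume (gainSet E 1 (t • EuclideanSpace.single i.castSucc (1 : ℝ))) +
        volume (gainSet Eᶜ 1 (t • EuclideanSpace.single i.castSucc (1 : ℝ))) ≤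
      ENNReal.ofReal (a * δ * t))
    (Hver : ∀ t, 0 < t → t ≤ t₀ →
      volume (gainSet E 1 (t • EuclideanSpace.single (Fin.last m) (1 : ℝ))) +
        volume (gainSet Eᶜ 1 (t • EuclideanSpace.single (Fin.last m) (1 : ℝ))) ≤
      ENNReal.ofReal ((b + a * δ) * t)) :
    FlatThree (m * a + b + a) δ E := by
  refine iSup₂_le fun φ hφ => ENNReal.ofReal_le_ofReal ?_
  obtain ⟨hφ1, hφc, hφs, hφb⟩ := hφ
  set S : EuclideanSpace ℝ (Fin (m + 1)) →L[ℝ] EuclideanSpace ℝ (Fin (m + 1)) :=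
    LinearMap.toContinuousLinearMap (stretchLinear m δ) with hS
  have hSs : ∀ x, S x = stretch δ x := fun x => rfl
  set ψ : Fin (m + 1) → EuclideanSpace ℝ (Fin (m + 1)) → ℝ := fun i x => φ (S x) i with hψ
  have hψ1 : ∀ i, ContDiff ℝ 1 (ψ i) := fun i =>
    (EuclideanSpace.proj (𝕜 := ℝ) i).contDiff.comp (hφ1.comp S.contDiff)
  have hψs : ∀ i, tsupport (ψ i) ⊆ Metric.ball 0 1 := by
    intro i x hx
    have h1 : tsupport (ψ i) ⊆ tsupport (φ ∘ S) := by
      refine closure_mono fun y hy hy0 => hy ?_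
      have : φ (S y) = 0 := hy0
      simp [hψ, this]
    have h2 := hφs (tsupport_comp_subset_preimage φ S.continuous (h1 hx))
    obtain ⟨y, hy, hyx⟩ := h2
    rwa [stretch_injective hδ (hyx : stretch δ y = stretch δ x)] at hy
  have hψc : ∀ i, HasCompactSupport (ψ i) := fun i =>
    HasCompactSupport.of_support_subset_isCompact (isCompact_closedBall 0 1)
      ((subset_tsupport _).trans ((hψs i).trans Metric.ball_subset_closedBall))
  have hψb : ∀ i x, |ψ i x| ≤ 1 := fun i x => by
    rw [← Real.norm_eq_abs]
    exact (PiLp.norm_apply_le (φ (S x)) i).trans (hφb _)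
  have hfd : ∀ i x v, fderiv ℝ (ψ i) x v = fderiv ℝ φ (S x) (S v) i := fun i x v => by
    have h1 : HasFDerivAt φ (fderiv ℝ φ (S x)) (S x) :=
      (hφ1.differentiable one_ne_zero (S x)).hasFDerivAt
    have h2 := (EuclideanSpace.proj (𝕜 := ℝ) i).hasFDerivAt.comp x (h1.comp x S.hasFDerivAt)
    have h3 : HasFDerivAt (ψ i) _ x := h2
    rw [h3.fderiv]
    rfl
  have hint : ∀ i v, Integrable fun x => fderiv ℝ (ψ i) x v := fun i v =>
    (((hψ1 i).continuous_fderiv one_ne_zero).clm_apply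
      continuous_const).integrable_of_hasCompactSupport ((hψc i).fderiv_apply ℝ v)
  have hcut : ∀ i v, ∫ x in E ∩ Metric.ball 0 1, fderiv ℝ (ψ i) x v =
      ∫ x in E, fderiv ℝ (ψ i) x v := fun i v => by
    refine (setIntegral_eq_of_subset_of_forall_sdiff_eq_zero hE Set.inter_subset_left
      fun x hx => ?_).symm
    have : x ∉ tsupport (ψ i) := fun h => hx.2 ⟨hx.1, hψs i h⟩
    rw [fderiv_of_notMem_tsupport ℝ this]; rfl
  -- By the chain rule, pulling back leaves the horizontal derivatives unchanged and gives the
  -- vertical one a factor `δ`.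
  have hdiv : ∀ x, divergence φ (S x) =
      (∑ i : Fin m, fderiv ℝ (ψ i.castSucc) x (EuclideanSpace.single i.castSucc 1)) +
        δ * fderiv ℝ (ψ (Fin.last m)) x (EuclideanSpace.single (Fin.last m) 1) := by
    intro x
    rw [divergence, Fin.sum_univ_castSucc]
    congr 1
    · refine Finset.sum_congr rfl fun i _ => ?_
      rw [hfd, hSs (EuclideanSpace.single _ _), stretch_single_castSucc]
    · rw [hfd, hSs (EuclideanSpace.single _ _), stretch_single_last, map_smul, PiLp.smul_apply,
        smul_eq_mul, ← mul_assoc, mul_inv_cancel₀ hδ.ne', one_mul]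
  rw [← Set.image_inter (stretch_injective hδ)]
  have hcv := integral_image_eq_integral_abs_det_fderiv_smul volume (f := stretch δ)
    (s := E ∩ Metric.ball 0 1)
    (f' := fun _ => S) (hE.inter Metric.isOpen_ball.measurableSet)
    (fun x _ => S.hasFDerivAt.hasFDerivWithinAt) (stretch_injective hδ).injOn (divergence φ)
  have hdet : S.det = δ⁻¹ := det_stretchLinear δ
  rw [hcv, hdet, abs_of_pos (inv_pos.2 hδ)]
  simp only [← hSs, hdiv, smul_eq_mul]
  rw [integral_const_mul, integral_add (integrable_finsetSum _ fun i _ =>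
    (hint _ _).integrableOn) ((hint _ _).integrableOn.const_mul _), integral_finsetSum _ fun i _ =>
    (hint _ _).integrableOn, integral_const_mul]
  simp only [hcut]
  have hA : ∑ i : Fin m, ∫ x in E, fderiv ℝ (ψ i.castSucc) x (EuclideanSpace.single i.castSucc 1)
      ≤ m * (a * δ) := by
    refine (Finset.sum_le_sum (g := fun _ => a * δ) fun i _ =>
      setIntegral_fderiv_le (hψ1 _) (hψc _) (hψs _) (hψb _) hE (by positivity) ht₀
        (Hhor i)).trans_eq ?_
    simp
  have hB := setIntegral_fderiv_le (hψ1 _) (hψc _) (hψs _) (hψb (Fin.last m)) hE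
    (by positivity) ht₀ Hver
  -- The Jacobian `δ⁻¹` turns the bounds into `m a + b + a δ`, which is at most `(m a + b + a) max 1
  -- δ`.
  rw [inv_mul_le_iff₀ hδ]
  have h1 : δ ≤ max 1 δ * δ := le_mul_of_one_le_left hδ.le (le_max_left _ _)
  have h2 : δ * δ ≤ max 1 δ * δ := mul_le_mul_of_nonneg_right (le_max_right _ _) hδ.le
  have h3 : (m * a + b) * δ ≤ (m * a + b) * (max 1 δ * δ) :=
    mul_le_mul_of_nonneg_left h1 (by positivity)
  have h4 : a * (δ * δ) ≤ a * (max 1 δ * δ) := mul_le_mul_of_nonneg_left h2 ha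
  have h5 := mul_le_mul_of_nonneg_left hB hδ.le
  nlinarith

end Stretch

/-! ### Borel representatives of minimizers -/

section Minimizer

variable {n : ℕ} {K : EuclideanSpace ℝ (Fin n) → ℝ}

theorem interaction_eq_pairMeasure (hK : Measurable K) {A B : Set (EuclideanSpace ℝ (Fin n))}
    (hA : MeasurableSet A) (hB : MeasurableSet B) :
    interaction K A B = pairMeasure (fun z => ENNReal.ofReal (K z)) (A ×ˢ B) := by
  have hm : Measurable fun p : EuclideanSpace ℝ (Fin n) × EuclideanSpace ℝ (Fin n) =>
      ENNReal.ofReal (K (p.1 - p.2)) :=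
    (hK.comp (measurable_fst.sub measurable_snd)).ennreal_ofReal
  rw [pairMeasure, withDensity_apply _ (hA.prod hB), ← Measure.prod_restrict,
    lintegral_prod _ hm.aemeasurable]
  rfl

theorem perK_eq_pairMeasure (hK : Measurable K) {Ω E : Set (EuclideanSpace ℝ (Fin n))}
    (hΩ : MeasurableSet Ω) (hE : MeasurableSet E) :
    perK K Ω E = pairMeasure (fun z => ENNReal.ofReal (K z)) (cutPairs Ω E) := by
  rw [perK, interaction_eq_pairMeasure hK (hE.inter hΩ) (hE.compl.inter hΩ),
    interaction_eq_pairMeasure hK (hE.inter hΩ) (hE.compl.diff hΩ),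
    interaction_eq_pairMeasure hK (hE.diff hΩ) (hE.compl.inter hΩ),
    ← measure_union _ ((hE.inter hΩ).prod (hE.compl.diff hΩ)),
    ← measure_union _ ((hE.diff hΩ).prod (hE.compl.inter hΩ))]
  · congr 1
    ext p
    simp only [cutPairs, Set.mem_union, Set.mem_prod, Set.mem_inter_iff, Set.mem_compl_iff,
      Set.mem_sdiff, Set.mem_ofPred_eq]
    tauto
  · refine Set.disjoint_left.2 fun p h1 h2 => ?_
    rcases h1 with h1 | h1 <;> exact h2.1.2 h1.1.2
  · exact Set.disjoint_left.2 fun p h1 h2 => h2.2.2 h1.2.2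

theorem interaction_congr_ae {A A' B B' : Set (EuclideanSpace ℝ (Fin n))} (hA : A =ᵐ[volume] A')
    (hB : B =ᵐ[volume] B') : interaction K A B = interaction K A' B' := by
  unfold interaction
  rw [Measure.restrict_congr_set hA, Measure.restrict_congr_set hB]

theorem perK_congr_ae {Ω E E' : Set (EuclideanSpace ℝ (Fin n))} (h : E =ᵐ[volume] E') :
    perK K Ω E = perK K Ω E' := by
  have r : Ω =ᵐ[volume] Ω := Filter.EventuallyEq.refl _ _
  unfold perK
  rw [interaction_congr_ae (h.inter r) (h.compl.inter r),
    interaction_congr_ae (h.inter r) (h.compl.diff r),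
    interaction_congr_ae (h.diff r) (h.compl.inter r)]

/-- A minimizer has a Borel representative which minimizes among Borel sets. -/
theorem IsMinimizer.exists_pairMinimizer (hK : Measurable K) {Ω E : Set (EuclideanSpace ℝ (Fin n))}
    (hΩ : MeasurableSet Ω) (h : IsMinimizer K Ω E) : ∃ E' : Set (EuclideanSpace ℝ (Fin n)),
      E' =ᵐ[volume] E ∧ PairMinimizer (pairMeasure fun z => ENNReal.ofReal (K z)) Ω E' := by
  obtain ⟨hE, hfin, hmin⟩ := h
  obtain ⟨E', -, mE', hE'⟩ := hE.exists_measurable_superset_ae_eq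
  refine ⟨E', hE', mE', hΩ, ?_, fun F mF hF => ?_⟩
  · rwa [← perK_eq_pairMeasure hK hΩ mE', perK_congr_ae hE']
  · rw [← perK_eq_pairMeasure hK hΩ mE', ← perK_eq_pairMeasure hK hΩ mF, perK_congr_ae hE']
    -- A competitor for the Borel representative agrees with `E` outside `Ω` only almost everywhere;
    -- replacing its exterior part by `E \ Ω` makes it admissible without changing its perimeter.
    have hF2 : (F ∩ Ω ∪ E \ Ω : Set _) =ᵐ[volume] F := by
      have h1 : (E \ Ω : Set _) =ᵐ[volume] (F \ Ω : Set _) := by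
        rw [hF]; exact hE'.symm.diff (Filter.EventuallyEq.refl _ _)
      have h2 := (Filter.EventuallyEq.refl (ae volume) (F ∩ Ω : Set _)).union h1
      rwa [Set.inter_union_sdiff] at h2
    rw [← perK_congr_ae hF2]
    refine hmin _ ((mF.inter hΩ).nullMeasurableSet.union (hE.diff hΩ.nullMeasurableSet)) ?_
    ext x
    simp only [Set.mem_sdiff, Set.mem_union, Set.mem_inter_iff]
    tauto

end Minimizer

/-! ### Rotating the selected direction to the vertical -/

section Rotation

/-- Reflect `e` to the last basis vector. If this reverses orientation, compose with the reflection
in the first coordinate, which fixes the last vector because `m ≠ 0`. -/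
theorem exists_rotation {m : ℕ} (hm : m ≠ 0) {e : EuclideanSpace ℝ (Fin (m + 1))} (he : ‖e‖ = 1) :
    ∃ ρ : EuclideanSpace ℝ (Fin (m + 1)) ≃ₗᵢ[ℝ] EuclideanSpace ℝ (Fin (m + 1)),
      LinearMap.det (ρ.toLinearEquiv : EuclideanSpace ℝ (Fin (m + 1)) →ₗ[ℝ]
        EuclideanSpace ℝ (Fin (m + 1))) = 1 ∧
      ρ e = EuclideanSpace.single (Fin.last m) 1 := by
  set f : EuclideanSpace ℝ (Fin (m + 1)) := EuclideanSpace.single (Fin.last m) 1 with hf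
  set u : EuclideanSpace ℝ (Fin (m + 1)) := EuclideanSpace.single 0 1 with hu
  have h0 : (0 : Fin (m + 1)) ≠ Fin.last m := by
    intro h
    exact hm (by simpa [Fin.ext_iff] using h.symm)
  set r₁ := (ℝ ∙ (e - f))ᗮ.reflection with hr₁
  set r₂ := (ℝ ∙ u)ᗮ.reflection with hr₂
  have h1 : r₁ e = f := Submodule.reflection_sub (by simp [he, hf])
  have h2 : r₂ f = f := by
    refine Submodule.reflection_mem_subspace_eq_self ?_
    rw [Submodule.mem_orthogonal_singleton_iff_inner_right, hu, hf,
      EuclideanSpace.inner_single_left]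
    simp [h0]
  have d2 : LinearMap.det (r₂.toLinearEquiv : EuclideanSpace ℝ (Fin (m + 1)) →ₗ[ℝ]
      EuclideanSpace ℝ (Fin (m + 1))) = -1 := by
    rw [hr₂, Submodule.det_reflection, Submodule.orthogonal_orthogonal,
      finrank_span_singleton (by simp [hu]), pow_one]
  have d1 : LinearMap.det (r₁.toLinearEquiv : EuclideanSpace ℝ (Fin (m + 1)) →ₗ[ℝ]
      EuclideanSpace ℝ (Fin (m + 1))) = 1 ∨
      LinearMap.det (r₁.toLinearEquiv : EuclideanSpace ℝ (Fin (m + 1)) →ₗ[ℝ]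
      EuclideanSpace ℝ (Fin (m + 1))) = -1 := by
    rw [hr₁, Submodule.det_reflection]
    exact neg_one_pow_eq_or ℝ _
  rcases d1 with d1 | d1
  · exact ⟨r₁, d1, h1⟩
  · refine ⟨r₁.trans r₂, ?_, by rw [LinearIsometryEquiv.trans_apply, h1, h2]⟩
    have : ((r₁.trans r₂).toLinearEquiv : EuclideanSpace ℝ (Fin (m + 1)) →ₗ[ℝ]
      EuclideanSpace ℝ (Fin (m + 1))) =
      (r₂.toLinearEquiv : EuclideanSpace ℝ (Fin (m + 1)) →ₗ[ℝ] EuclideanSpace ℝ (Fin (m + 1))) ∘ₗ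
        (r₁.toLinearEquiv : EuclideanSpace ℝ (Fin (m + 1)) →ₗ[ℝ]
          EuclideanSpace ℝ (Fin (m + 1))) := rfl
    rw [this, LinearMap.det_comp, d1, d2]
    norm_num

variable {V : Type*} [NormedAddCommGroup V] [InnerProductSpace ℝ V] [FiniteDimensional ℝ V]
  [MeasurableSpace V] [BorelSpace V]

theorem volume_gainSet_isometry {E : Set V} (hE : MeasurableSet E) (ρ : V ≃ₗᵢ[ℝ] V) (r : ℝ)
    (h : V) : volume (gainSet (ρ.symm ⁻¹' E) r h) = volume (gainSet E r (ρ.symm h)) := by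
  rw [← ρ.measurePreserving.measure_preimage (measurableSet_gainSet
    (ρ.symm.continuous.measurable hE) r h).nullMeasurableSet]
  congr 1
  ext x
  have : ‖ρ x - h‖ = ‖x - ρ.symm h‖ := by
    rw [← ρ.norm_map (x - ρ.symm h), map_sub, ρ.apply_symm_apply]
  simp [gainSet, this]

end Rotation

/-! ### Splitting into horizontal and vertical coordinates -/

section Coordinates

variable {m : ℕ}

/-- The point with given horizontal and vertical parts. -/
noncomputable def joinCoord (p : EuclideanSpace ℝ (Fin m) × ℝ) : EuclideanSpace ℝ (Fin (m + 1)) :=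
  WithLp.toLp 2 (Fin.snoc p.1 p.2 : Fin (m + 1) → ℝ)

theorem joinCoord_castSucc (p : EuclideanSpace ℝ (Fin m) × ℝ) (i : Fin m) :
    joinCoord p i.castSucc = p.1 i :=
  Fin.snoc_castSucc (α := fun _ : Fin (m + 1) => ℝ) _ _ i

theorem joinCoord_last (p : EuclideanSpace ℝ (Fin m) × ℝ) : joinCoord p (Fin.last m) = p.2 :=
  Fin.snoc_last (α := fun _ : Fin (m + 1) => ℝ) _ _

theorem measurable_joinCoord : Measurable (joinCoord (m := m)) := by
  refine (WithLp.measurable_toLp 2 (Fin (m + 1) → ℝ)).comp (measurable_pi_iff.2 fun i => ?_)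
  induction i using Fin.lastCases with
  | last => simp only [Fin.snoc_last]; exact measurable_snd
  | cast i =>
    simp only [Fin.snoc_castSucc]
    exact (EuclideanSpace.proj (𝕜 := ℝ) i).measurable.comp measurable_fst

theorem joinCoord_split (x : EuclideanSpace ℝ (Fin (m + 1))) : joinCoord (horiz x, vert x) = x := by
  ext i
  induction i using Fin.lastCases with
  | last => exact joinCoord_last _
  | cast i => exact joinCoord_castSucc _ i

theorem joinCoord_sub (p q : EuclideanSpace ℝ (Fin m) × ℝ) :
    joinCoord (p - q) = joinCoord p - joinCoord q := by
  ext i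
  induction i using Fin.lastCases with
  | last => rw [PiLp.sub_apply, joinCoord_last, joinCoord_last, joinCoord_last]; rfl
  | cast i =>
    rw [PiLp.sub_apply, joinCoord_castSucc, joinCoord_castSucc, joinCoord_castSucc]; rfl

theorem norm_joinCoord_sq (p : EuclideanSpace ℝ (Fin m) × ℝ) :
    ‖joinCoord p‖ ^ 2 = ‖p.1‖ ^ 2 + p.2 ^ 2 := by
  rw [EuclideanSpace.norm_sq_eq, EuclideanSpace.norm_sq_eq, Fin.sum_univ_castSucc]
  simp only [joinCoord_castSucc, joinCoord_last, Real.norm_eq_abs, sq_abs]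

theorem norm_joinCoord_lt_one_iff (p : EuclideanSpace ℝ (Fin m) × ℝ) :
    ‖joinCoord p‖ < 1 ↔ ‖p.1‖ ^ 2 + p.2 ^ 2 < 1 := by
  rw [← norm_joinCoord_sq, sq_lt_one_iff₀ (norm_nonneg _)]

theorem joinCoord_vert (t : ℝ) :
    joinCoord ((0 : EuclideanSpace ℝ (Fin m)), t) = t • EuclideanSpace.single (Fin.last m) 1 := by
  ext i
  induction i using Fin.lastCases with
  | last => rw [joinCoord_last]; simp
  | cast i => rw [joinCoord_castSucc]; simp [Fin.castSucc_ne_last]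

theorem measurePreserving_split :
    MeasurePreserving (fun x : EuclideanSpace ℝ (Fin (m + 1)) => (horiz x, vert x)) := by
  have h1 := EuclideanSpace.volume_preserving_symm_measurableEquiv_toLp (Fin (m + 1))
  have h2 := volume_preserving_piFinSuccAbove (fun _ : Fin (m + 1) => ℝ) (Fin.last m)
  have h3 : MeasurePreserving (Prod.swap : ℝ × (Fin m → ℝ) → (Fin m → ℝ) × ℝ) :=
    Measure.measurePreserving_swap
  have h4 : MeasurePreserving (Prod.map (WithLp.toLp 2 : (Fin m → ℝ) → EuclideanSpace ℝ (Fin m))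
      (id : ℝ → ℝ)) :=
    (PiLp.volume_preserving_toLp (Fin m)).prod (MeasurePreserving.id volume)
  have h5 := h4.comp (h3.comp (h2.comp h1))
  convert h5 using 1
  ext x i
  · simp [horiz, MeasurableEquiv.piFinSuccAbove, Fin.insertNthEquiv, Fin.init]
  · simp [vert, MeasurableEquiv.piFinSuccAbove, Fin.insertNthEquiv]

theorem volume_vertGain_preimage {G : Set (EuclideanSpace ℝ (Fin (m + 1)))} (hG : MeasurableSet G)
    (t : ℝ) : volume (vertGain (joinCoord ⁻¹' G) t) =
      volume (gainSet G 1 (t • EuclideanSpace.single (Fin.last m) 1)) := by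
  rw [← measurePreserving_split.measure_preimage (measurableSet_vertGain
    (measurable_joinCoord hG) t).nullMeasurableSet, ← joinCoord_vert]
  congr 1
  ext x
  have h : joinCoord (horiz x, vert x - t) = x - joinCoord (0, t) := by
    conv_rhs => rw [← joinCoord_split x, ← joinCoord_sub]
    simp
  have h1 := norm_joinCoord_lt_one_iff (horiz x, vert x)
  have h2 := norm_joinCoord_lt_one_iff (horiz x, vert x - t)
  rw [h] at h2
  rw [joinCoord_split] at h1
  simp only [vertGain, gainSet, Set.mem_preimage, Set.mem_ofPred_eq, h, h1, h2, joinCoord_split]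

theorem volume_horizGain_preimage {G : Set (EuclideanSpace ℝ (Fin (m + 1)))}
    (hG : MeasurableSet G) (k : EuclideanSpace ℝ (Fin m)) :
    volume (horizGain (joinCoord ⁻¹' G) k) = volume (gainSet G 1 (joinCoord (k, 0))) := by
  rw [← measurePreserving_split.measure_preimage (measurableSet_horizGain
    (measurable_joinCoord hG) k).nullMeasurableSet]
  congr 1
  ext x
  have h : joinCoord (horiz x - k, vert x) = x - joinCoord (k, 0) := by
    conv_rhs => rw [← joinCoord_split x, ← joinCoord_sub]
    simp
  have h1 := norm_joinCoord_lt_one_iff (horiz x, vert x)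
  have h2 := norm_joinCoord_lt_one_iff (horiz x - k, vert x)
  rw [h] at h2
  rw [joinCoord_split] at h1
  simp only [horizGain, gainSet, Set.mem_preimage, Set.mem_ofPred_eq, h, h1, h2, joinCoord_split]

end Coordinates

/-! ### The three flatness properties from the stability estimate -/

section Flatness

variable {m : ℕ}

theorem flatOne_of_split {E G : Set (EuclideanSpace ℝ (Fin (m + 1)))} (hG : MeasurableSet G)
    (hEG : E =ᵐ[volume] G) {δ t : ℝ} (ht : t ∈ Set.Icc (-1 : ℝ) 1)
    (h : volume {p : EuclideanSpace ℝ (Fin m) × ℝ |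
      ‖p.1‖ ^ 2 + p.2 ^ 2 < 1 ∧ ¬(p ∈ joinCoord ⁻¹' G ↔ p.2 ≤ t)} ≤ ENNReal.ofReal δ) :
    FlatOne δ E := by
  refine ⟨t, ht, ?_⟩
  have mS : MeasurableSet {p : EuclideanSpace ℝ (Fin m) × ℝ |
      ‖p.1‖ ^ 2 + p.2 ^ 2 < 1 ∧ ¬(p ∈ joinCoord ⁻¹' G ↔ p.2 ≤ t)} := by
    have h1 : MeasurableSet {p : EuclideanSpace ℝ (Fin m) × ℝ | ‖p.1‖ ^ 2 + p.2 ^ 2 < 1} :=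
      measurableSet_lt (by fun_prop) measurable_const
    have h2 : MeasurableSet {p : EuclideanSpace ℝ (Fin m) × ℝ | p.2 ≤ t} :=
      measurableSet_le measurable_snd measurable_const
    exact h1.inter ((measurable_joinCoord hG).iff h2).compl
  rw [← measurePreserving_split.measure_preimage mS.nullMeasurableSet] at h
  refine (measure_mono_ae ?_).trans h
  filter_upwards [hEG] with x hx
  have hx : x ∈ E ↔ x ∈ G := iff_of_eq hx
  rintro ⟨h1, h2⟩
  have h3 := norm_joinCoord_lt_one_iff (horiz x, vert x)
  rw [joinCoord_split] at h3
  refine ⟨h3.1 (by simpa using h2), ?_⟩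
  change ¬(joinCoord (horiz x, vert x) ∈ G ↔ vert x ≤ t)
  rw [joinCoord_split, ← hx]
  rcases h1 with ⟨a, b⟩ | ⟨a, b⟩
  · exact fun hh => b (hh.1 a)
  · exact fun hh => b (hh.2 a)

theorem flatTwo_of_split {E G : Set (EuclideanSpace ℝ (Fin (m + 1)))} (hG : MeasurableSet G)
    (hEG : E =ᵐ[volume] G) {δ : ℝ} {B : Set (EuclideanSpace ℝ (Fin m))}
    {g : EuclideanSpace ℝ (Fin m) → ℝ} (mB : MeasurableSet B) (hB1 : B ⊆ Metric.ball 0 1)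
    (hB : volume B ≤ ENNReal.ofReal δ) (mg : Measurable g) (hg1 : ∀ y, g y ∈ Set.Icc (-1 : ℝ) 1)
    (hg : ∀ y, y ∉ B → ∀ᵐ s : ℝ, ‖y‖ ^ 2 + s ^ 2 < 1 → ((y, s) ∈ joinCoord ⁻¹' G ↔ s ≤ g y)) :
    FlatTwo δ E := by
  refine ⟨B, g, mB, hB1.trans Metric.ball_subset_closedBall, hB, mg, fun y _ => hg1 y, ?_⟩
  have mN : MeasurableSet {p : EuclideanSpace ℝ (Fin m) × ℝ | p.1 ∉ B → ‖p.1‖ ^ 2 + p.2 ^ 2 < 1 →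
      (p ∈ joinCoord ⁻¹' G ↔ p.2 ≤ g p.1)} := by
    have h1 : MeasurableSet {p : EuclideanSpace ℝ (Fin m) × ℝ | ‖p.1‖ ^ 2 + p.2 ^ 2 < 1} :=
      measurableSet_lt (by fun_prop) measurable_const
    have h2 : MeasurableSet {p : EuclideanSpace ℝ (Fin m) × ℝ | p.2 ≤ g p.1} :=
      measurableSet_le measurable_snd (mg.comp measurable_fst)
    exact (measurable_fst mB).compl.imp (h1.imp ((measurable_joinCoord hG).iff h2))
  have hae : ∀ᵐ p : EuclideanSpace ℝ (Fin m) × ℝ, p.1 ∉ B → ‖p.1‖ ^ 2 + p.2 ^ 2 < 1 →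
      (p ∈ joinCoord ⁻¹' G ↔ p.2 ≤ g p.1) := by
    rw [Measure.volume_eq_prod, Measure.ae_prod_iff_ae_ae mN]
    refine Filter.Eventually.of_forall fun y => ?_
    by_cases hy : y ∈ B
    · exact Filter.Eventually.of_forall fun s h => absurd hy h
    · filter_upwards [hg y hy] with s hs _ using hs
  filter_upwards [hEG, measurePreserving_split.quasiMeasurePreserving.ae hae] with x hx h
  have hx : x ∈ E ↔ x ∈ G := iff_of_eq hx
  have h3 := norm_joinCoord_lt_one_iff (horiz x, vert x)
  rw [joinCoord_split] at h3
  have h4 : horiz x ∉ B → ‖x‖ < 1 → (x ∈ E ↔ vert x ≤ g (horiz x)) := fun a b => by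
    have := h a (h3.1 b)
    rwa [Set.mem_preimage, joinCoord_split, ← hx] at this
  refine propext ?_
  change ((x ∈ E ∧ x ∈ Metric.ball 0 1) ∧ horiz x ∉ B) ↔
    (x ∈ Metric.ball 0 1 ∧ (horiz x ∈ Metric.closedBall 0 1 ∧ horiz x ∉ B) ∧ vert x ≤ g (horiz x))
  rw [mem_ball_zero_iff, mem_closedBall_zero_iff]
  constructor
  · rintro ⟨⟨a, b⟩, c⟩
    refine ⟨b, ⟨?_, c⟩, (h4 c b).1 a⟩
    have := h3.1 b
    nlinarith [norm_nonneg (horiz x), sq_nonneg (vert x)]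
  · rintro ⟨b, ⟨-, c⟩, d⟩
    exact ⟨⟨(h4 c b).2 d, b⟩, c⟩

/-- A set satisfying the stability estimate is flat in a suitable direction. -/
theorem ProductBound.exists_flat (hm : m ≠ 0) [Nontrivial (EuclideanSpace ℝ (Fin m))]
    {E E' : Set (EuclideanSpace ℝ (Fin (m + 1)))}
    (hE' : MeasurableSet E') (hEE : E' =ᵐ[volume] E) {ε δ t₀ : ℝ} (hε : 0 ≤ ε) (ht₀ : 0 < t₀)
    (H : ProductBound E' ε t₀) (hδ : 0 < δ) (hεδ : ε ≤ δ)
    (hfδ : flatConst (EuclideanSpace ℝ (Fin m)) * ε ≤ δ) :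
    ∃ ρ : EuclideanSpace ℝ (Fin (m + 1)) ≃ₗᵢ[ℝ] EuclideanSpace ℝ (Fin (m + 1)),
      LinearMap.det (ρ.toLinearEquiv : EuclideanSpace ℝ (Fin (m + 1)) →ₗ[ℝ]
        EuclideanSpace ℝ (Fin (m + 1))) = 1 ∧ FlatOne δ (ρ '' E) ∧ FlatTwo δ (ρ '' E) ∧
      FlatThree (m * 2 + shellConst (EuclideanSpace ℝ (Fin (m + 1))) + 2) δ (ρ '' E) := by
  obtain ⟨e, he, hhor, hver⟩ := H.exists_direction hE' hε ht₀
  obtain ⟨ρ, hdet, hρ⟩ := exists_rotation hm he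
  set f : EuclideanSpace ℝ (Fin (m + 1)) := EuclideanSpace.single (Fin.last m) 1 with hf
  have hρf : ρ.symm f = e := by rw [← hρ, ρ.symm_apply_apply]
  have hinner : ∀ h, inner ℝ h f = 0 → inner ℝ (ρ.symm h) e = 0 := fun h hh => by
    rwa [← hρf, ρ.symm.inner_map_map]
  set G := ρ.symm ⁻¹' E' with hGdef
  have hG : MeasurableSet G := ρ.symm.continuous.measurable hE'
  have hEG : (ρ '' E : Set _) =ᵐ[volume] G := by
    have : ρ '' E = ρ.symm ⁻¹' E := ρ.toEquiv.image_eq_preimage_symm E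
    rw [this]
    exact ρ.symm.measurePreserving.quasiMeasurePreserving.preimage_ae_eq hEE.symm
  have g1 : ∀ h, inner ℝ h f = 0 → volume (gainSet G 1 h) ≤ ENNReal.ofReal (ε * ‖h‖) :=
    fun h hh => by
      rw [hGdef, volume_gainSet_isometry hE', ← ρ.symm.norm_map h]
      exact (hhor _ (hinner h hh)).1
  have g2 : ∀ h, inner ℝ h f = 0 → volume (gainSet Gᶜ 1 h) ≤ ENNReal.ofReal (ε * ‖h‖) :=
    fun h hh => by
      rw [hGdef, ← Set.preimage_compl, volume_gainSet_isometry hE'.compl, ← ρ.symm.norm_map h]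
      exact (hhor _ (hinner h hh)).2
  have g3 : ∀ s, 0 ≤ s → volume (gainSet G 1 (s • f)) ≤ ENNReal.ofReal (ε * s) := fun s hs => by
    rw [hGdef, volume_gainSet_isometry hE', map_smul, hρf]
    exact hver s hs
  have g4 : ∀ h, ‖h‖ ≤ t₀ → volume (gainSet G 1 h) + volume (gainSet Gᶜ 1 h) ≤
      ENNReal.ofReal ((shellConst (EuclideanSpace ℝ (Fin (m + 1))) + 2 * ε) * ‖h‖) := fun h hh => by
    rw [hGdef, ← Set.preimage_compl, volume_gainSet_isometry hE',
      volume_gainSet_isometry hE'.compl, ← ρ.symm.norm_map h]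
    exact (add_le_add (measure_mono (gainSet_subset_exitSet _ le_rfl _))
      (measure_mono (gainSet_subset_exitSet _ le_rfl _))).trans
      (H.volume_add_le Module.finrank_pos hE' hε (by rwa [ρ.symm.norm_map]))
  obtain ⟨B, g, mB, hB1, hB, mg, hg1, hg⟩ := exists_subgraph (measurable_joinCoord hG) (ε := ε)
    fun t ht => (volume_vertGain_preimage hG t).trans_le (g3 t ht)
  obtain ⟨t, ht, hflat⟩ := exists_height (measurable_joinCoord hG) hε (fun k => by
    rw [volume_horizGain_preimage hG]
    have hn : ‖joinCoord (k, (0 : ℝ))‖ = ‖k‖ := by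
      have := norm_joinCoord_sq (k, (0 : ℝ))
      simp only [ne_eq, OfNat.ofNat_ne_zero, not_false_eq_true, zero_pow, add_zero] at this
      exact (sq_eq_sq₀ (norm_nonneg _) (norm_nonneg _)).1 this
    rw [← hn]
    refine g1 _ ?_
    rw [hf, EuclideanSpace.inner_single_right, joinCoord_last]
    simp) mB mg hB hg
  refine ⟨ρ, hdet, flatOne_of_split hG hEG ht (hflat.trans (ENNReal.ofReal_le_ofReal hfδ)),
    flatTwo_of_split hG hEG mB hB1 (hB.trans (ENNReal.ofReal_le_ofReal hεδ)) mg hg1 hg, ?_⟩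
  rw [FlatThree, perimeter_congr_ae (stretch_image_congr_ae hδ hEG)]
  -- Horizontally the set and its complement each contribute `ε ≤ δ`, hence `2δ`; vertically the
  -- total is the shell constant plus `2ε`. Both constants are independent of the kernel.
  refine flatThree_of_gainSet hδ hG (a := 2) (by norm_num) shellConst_nonneg ht₀
    (fun i s hs _ => ?_) fun s hs hs0 => ?_
  · have hort : inner ℝ (s • EuclideanSpace.single i.castSucc (1 : ℝ)) f = 0 := by
      rw [hf, EuclideanSpace.inner_single_right]
      simp [(Fin.castSucc_ne_last i).symm]
    refine (add_le_add (g1 _ hort) (g2 _ hort)).trans ?_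
    rw [norm_smul, Real.norm_of_nonneg hs.le, PiLp.norm_single, norm_one, mul_one,
      ← ENNReal.ofReal_add (by positivity) (by positivity)]
    refine ENNReal.ofReal_le_ofReal ?_
    have := mul_le_mul_of_nonneg_right hεδ hs.le
    linarith
  · have hn : ‖s • f‖ = s := by
      rw [norm_smul, Real.norm_of_nonneg hs.le, hf, PiLp.norm_single, norm_one, mul_one]
    refine (g4 (s • f) (by rwa [hn])).trans (ENNReal.ofReal_le_ofReal ?_)
    rw [hn]
    gcongr

end Flatness

/-! ### Assembly of the theorem -/

theorem flatnessRate_mul (n : ℕ) (c A R : ℝ) :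
    flatnessRate n (c * A) R = c * flatnessRate n A R := by
  unfold flatnessRate
  split_ifs <;> ring

theorem flatnessRate_pos (n : ℕ) {A R : ℝ} (hA : 0 < A) (hR : 4 ≤ R) : 0 < flatnessRate n A R := by
  unfold flatnessRate
  split_ifs
  · have : 0 < R := by linarith
    positivity
  · exact div_pos hA (Real.sqrt_pos.2 (Real.log_pos (by linarith)))

theorem productBound_of_unit {V : Type*} [NormedAddCommGroup V] [InnerProductSpace ℝ V]
    [FiniteDimensional ℝ V] [MeasurableSpace V] [BorelSpace V] {E : Set V} {ε t₀ : ℝ}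
    (h : ∀ e : V, ‖e‖ = 1 → ∀ t : ℝ, 0 ≤ t → t ≤ t₀ →
      volume {x | ‖x‖ < 1 ∧ x ∉ E ∧ x - t • e ∈ E} *
        volume {x | ‖x‖ < 1 ∧ x ∈ E ∧ x - t • e ∉ E} ≤ ENNReal.ofReal ((ε * t) ^ 2)) :
    ProductBound E ε t₀ := by
  intro v hv
  rcases eq_or_ne v 0 with rfl | hv0
  · have : exitSet E (0 : V) = ∅ := by ext x; simp [exitSet]
    simp [this]
  · have hn : ‖v‖ ≠ 0 := norm_ne_zero_iff.2 hv0
    have h1 := h (‖v‖⁻¹ • v) (by rw [norm_smul, norm_inv, norm_norm, inv_mul_cancel₀ hn]) ‖v‖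
      (norm_nonneg _) hv
    rw [smul_smul, mul_inv_cancel₀ hn, one_smul] at h1
    simpa only [exitSet, Set.mem_compl_iff, not_not] using h1

end NonlocalPerimeter

theorem mainTheorem11 (m : ℕ) (hm : m + 1 = 2 ∨ m + 1 = 3) :
    ∃ C₀ : ℝ, 0 < C₀ ∧
      ∀ K : EuclideanSpace ℝ (Fin (m + 1)) → ℝ,
        NonlocalPerimeter.AdmissibleKernel K → HasCompactSupport K →
        ∃ C : ℝ, 0 < C ∧
          ∀ R : ℝ, 4 ≤ R → ∀ E : Set (EuclideanSpace ℝ (Fin (m + 1))),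
            NonlocalPerimeter.IsMinimizer K (Metric.ball 0 R) E →
            ∃ ρ : EuclideanSpace ℝ (Fin (m + 1)) ≃ₗᵢ[ℝ] EuclideanSpace ℝ (Fin (m + 1)),
              LinearMap.det (ρ.toLinearEquiv : EuclideanSpace ℝ (Fin (m + 1)) →ₗ[ℝ]
                EuclideanSpace ℝ (Fin (m + 1))) = 1 ∧
              NonlocalPerimeter.FlatOne
                (NonlocalPerimeter.flatnessRate (m + 1) C R) (ρ '' E) ∧
              NonlocalPerimeter.FlatTwo
                (NonlocalPerimeter.flatnessRate (m + 1) C R) (ρ '' E) ∧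
              NonlocalPerimeter.FlatThree C₀
                (NonlocalPerimeter.flatnessRate (m + 1) C R) (ρ '' E) := by
  have hm0 : m ≠ 0 := by omega
  have : NeZero m := ⟨hm0⟩
  have hshell := NonlocalPerimeter.shellConst_nonneg (V := EuclideanSpace ℝ (Fin (m + 1)))
  refine ⟨m * 2 + NonlocalPerimeter.shellConst (EuclideanSpace ℝ (Fin (m + 1))) + 2, by positivity,
    fun K hK hc => ?_⟩
  obtain ⟨A, t₀, hA, ht₀, hprod⟩ := NonlocalPerimeter.exists_product_bound hm hK hc
  -- The factor `c` is dimensional: it absorbs the loss in the half-space estimate, while the `1`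
  -- keeps the bound for the bad set. All dependence on the kernel is in `A`.
  set c := max 1 (NonlocalPerimeter.flatConst (EuclideanSpace ℝ (Fin m))) with hcdef
  have hc1 : 1 ≤ c := le_max_left _ _
  refine ⟨c * A, by positivity, fun R hR E hE => ?_⟩
  obtain ⟨E', hEE, hE'⟩ := hE.exists_pairMinimizer hK.measurable Metric.isOpen_ball.measurableSet
  have hε := NonlocalPerimeter.flatnessRate_pos (m + 1) hA hR
  rw [NonlocalPerimeter.flatnessRate_mul]
  exact (NonlocalPerimeter.productBound_of_unit (hprod R hR E' hE')).exists_flat hm0 hE'.meas hEE hε.le ht₀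
    (by positivity) (le_mul_of_one_le_left hε.le hc1)
    (mul_le_mul_of_nonneg_right (le_max_right _ _) hε.le)
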